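/- **Conventions.** A context-free grammar $G$ on the alphabet $\{x,y\}$ is a pair of substitution rules $x\to u$, $y\to v$ with $u,v\in\mathbb{Q}[x,y]$. Its formal derivative $D$ is the linear operator on $\mathbb{Q}[x,y]$ with $D(x)=u$, $D(y)=v$ and $D(fg)=D(f)g+fD(g)$; $D^n$ is its $n$-th iterate. Let $[n]=\{1,\dots,n\}$. * $\left\langle{n\atop k}\right\rangle$ is the number of permutations $\pi$ of $[n]$ with exactly $k$ descents ($i<n$ with $\pi(i)>\pi(i+1)$). * $B(n,k)$ is the number of signed permutations $\pi$ of $\{\pm1,\dots,\pm n\}$ (that is, $\pi(-i)=-\pi(i)$; put $\pi(0)=0$) with exactly $k$ indices $i\in[n]$ such that $\pi(i-1)>\pi(i)$. * $N(n,k)$ is the number of perfect matchings of $[2n]$ in which exactly $k$ matching pairs have an odd smaller entry. * For $0\le r\le n$, $\left\langle{n\atop k}\right\rangle_r$ is the number of sequences $(\sigma(1),\dots,\sigma(n-r))$ of distinct elements of $[n]$ with exactly $k$ indices $i$ such that $\sigma(i)>i$. * $T(n,k)$ is the coefficient of $t^k z^n/n!$ in $\sqrt{A(2t,z)}$ (the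 square root with constant term $1$ of a formal power series in $z$), where $A(t,z)=1+\sum_{n\ge1} t\left(\sum_{k=0}^{n-1}\left\langle{n\atop k}\right\rangle t^k\right)\frac{z^n}{n!}$. * $\left\{{n\atop k}\right\}$ is the number of partitions of $[n]$ into $k$ nonempty blocks, $\left[{n\atop k}\right]$ the number of permutations of $[n]$ with $k$ cycles, and $L(n,k)$ the number of partitions of $[n]$ into $k$ nonempty linearly ordered subsets. * $b(n,k)$ is the number of (unordered) forests of $k$ rooted ordered trees, each having at least one non-root vertex, with $n$ non-root vertices in total; the roots are unlabelled and the non-root vertices are labelled bijectively by $[n]$ so that labels increase along every path leading away from a root. * $a(n,k;r)$ is the number of unordered forests of $k$ plane increasing $r$-ary trees with $n$ vertices in total, labelled bijectively by $[n]$: every vertex has $r$ distinguishable places, each holding at most one child, and labels increase from parent to child. * $d(m,k)$ is the number of increasing mobiles with $m$ nodes and $k$ leaves, i.e. rooted trees with nodes labelled bijectively by $[m]$, labels increasing from parent to child, in which the children of every node are arranged in a circle; a leaf is a node without children. **Theorem.** For every integer $n\ge1$: * $(c_1)$ If $G=\{x\to xy^2,\ y\to x^2y\}$, then $D^n(xy)=xy\sum_{k=0}^n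 B(n,k)x^{2n-2k}y^{2k}$. * $(c_2)$ If $G=\{x\to xy^2,\ y\to x^2y\}$, then $D^n(x^2y^2)=2^nx^2y^2\sum_{k=0}^n\left\langle{n+1\atop k}\right\rangle x^{2n-2k}y^{2k}$. * $(c_3)$ If $G=\{x\to xy^2,\ y\to x^2y\}$, then $D^n(x)=x\sum_{k=1}^nN(n,k)x^{2n-2k}y^{2k}$. * $(c_4)$ If $G=\{x\to xy,\ y\to xy\}$, then for every integer $r\ge0$, $D^n(xy^r)=x\sum_{k=0}^{n}\left\langle{n+r\atop k}\right\rangle_{r}x^ky^{n+r-k}$. * $(c_5)$ If $G=\{x\to xy^2,\ y\to xy\}$, then $D^n(x)=x\sum_{k=0}^{n-1}2^k\left\langle{n\atop k}\right\rangle x^ky^{2n-2k}$. * $(c_6)$ One has $\sqrt{A(2t,z)}=1+\sum_{m\ge1}\sum_{k=1}^mT(m,k)t^k\frac{z^m}{m!}$, and if $G=\{x\to xy^2,\ y\to xy\}$, then $D^n(y)=\sum_{k=1}^{n}T(n,k)x^ky^{2n-2k+1}$. * $(c_7)$ If $G=\{x\to x^2y,\ y\to y\}$, then $D^n(x)=x\sum_{k=1}^nk!\left\{{n\atop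 k}\right\}x^ky^k$. * $(c_8)$ If $G=\{x\to x^2y,\ y\to y^2\}$, then $D^n(x)=x\sum_{k=1}^nk!\left[{n\atop k}\right]x^{k}y^n$. * $(c_9)$ If $G=\{x\to xy^2,\ y\to y^2\}$, then $D^n(x)=x\sum_{k=1}^nL(n,k)y^{n+k}$. * $(c_{10})$ If $G=\{x\to xy^3,\ y\to y^3\}$, then $D^n(x)=x\sum_{k=1}^{n}b(n,k)y^{2n+k}$. * $(c_{11})$ For every integer $r\ge4$, if $G=\{x\to xy^r,\ y\to y^r\}$, then $D^n(x)=x\sum_{k=1}^{n}a(n,k;r)y^{(r-1)n+k}$. * $(c_{12})$ If $G=\{x\to x^2y,\ y\to xy\}$, then $D^n(y)=x^n\sum_{k=1}^nd(n+1,k)y^k$. -/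

import Mathlib

namespace Gram

open MvPolynomial Finset

/-! ### Grammars and their formal derivative -/

/-- A context-free grammar over the alphabet `A`, given as the substitution rules `a → G a`; letters
are commuting indeterminates and every letter is replaced by a polynomial in the letters. -/
abbrev Grammar (A : Type*) := A → MvPolynomial A ℚ

/-- The formal derivative of a grammar: the linear operator satisfying the Leibniz rule whose value
at each letter is the right-hand side of the rule of that letter. -/
noncomputable def formalDerivative {A : Type*} (G : Grammar A) :
    Derivation ℚ (MvPolynomial A ℚ) (MvPolynomial A ℚ) :=
  MvPolynomial.mkDerivation ℚ G

/-- The first letter of the two-letter alphabet. -/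
noncomputable abbrev x : MvPolynomial (Fin 2) ℚ := X 0

/-- The second letter of the two-letter alphabet. -/
noncomputable abbrev y : MvPolynomial (Fin 2) ℚ := X 1

/-- `derivPow u v n w` is `D ^ n (w)`, where `D` is the formal derivative of the grammar
`{x → u, y → v}`. -/
noncomputable def derivPow (u v : MvPolynomial (Fin 2) ℚ) (n : ℕ) (w : MvPolynomial (Fin 2) ℚ) :
    MvPolynomial (Fin 2) ℚ :=
  (⇑(formalDerivative ![u, v]))^[n] w

/-! ### Permutation statistics -/

/-- The number of descents of a permutation. -/
def descents {n : ℕ} (π : Equiv.Perm (Fin n)) : ℕ :=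
  #{i : Fin n | ∃ j : Fin n, (j : ℕ) = i + 1 ∧ π j < π i}

/-- The Eulerian number: permutations of `n` elements with `k` descents. -/
noncomputable def eulerian (n k : ℕ) : ℕ :=
  {π : Equiv.Perm (Fin n) | descents π = k}.ncard

/-- The `r`-restricted Eulerian number (for `r ≤ n`): sequences of `n - r` distinct elements of an
`n`-element set with `k` excedances. -/
noncomputable def restrictedEulerian (r n k : ℕ) : ℕ :=
  {σ : Fin (n - r) ↪ Fin n | #{i : Fin (n - r) | (i : ℕ) < (σ i : ℕ)} = k}.ncard

/-- The signed permutations of `{±1, …, ±n}`, i.e. those with `π (-i) = -π i`. A permutation of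
`{±1, …, ±n}` is regarded as a permutation of `ℤ` that fixes all the other integers; in particular
`π 0 = 0`. -/
def SignedPerm (n : ℕ) : Set (Equiv.Perm ℤ) :=
  {π | (∀ i, π (-i) = -π i) ∧ ∀ i, (n : ℤ) < |i| → π i = i}

/-- The number of type B descents, i.e. of `i ∈ {1, …, n}` with `π (i - 1) > π i`. -/
noncomputable def descentsB (n : ℕ) (π : Equiv.Perm ℤ) : ℕ :=
  #{i ∈ Finset.Icc (1 : ℤ) n | π i < π (i - 1)}

/-- The Eulerian number of type B. -/
noncomputable def eulerianB (n k : ℕ) : ℕ :=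
  {π | π ∈ SignedPerm n ∧ descentsB n π = k}.ncard

/-- The number of permutations of `n` elements with `k` cycles (fixed points are cycles). -/
noncomputable def stirlingCycle (n k : ℕ) : ℕ :=
  {π : Equiv.Perm (Fin n) | Nat.card (Quotient (Equiv.Perm.SameCycle.setoid π)) = k}.ncard

/-! ### Matchings and partitions -/

/-- The number of perfect matchings of `{1, …, 2n}` in which exactly `k` pairs have an odd smaller
entry. A perfect matching is given by the map `f` sending each entry to its partner; the entry
`i : Fin (2 * n)` stands for `i + 1`. -/
noncomputable def oddMatchings (n k : ℕ) : ℕ :=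
  {f : Fin (2 * n) → Fin (2 * n) | (∀ i, f (f i) = i) ∧ (∀ i, f i ≠ i) ∧
    #{i : Fin (2 * n) | i < f i ∧ Odd ((i : ℕ) + 1)} = k}.ncard

/-- The number of partitions of an `n`-element set into `k` nonempty blocks. -/
noncomputable def stirlingPartition (n k : ℕ) : ℕ :=
  {P : Finpartition (Finset.univ : Finset (Fin n)) | #P.parts = k}.ncard

/-- The unsigned Lah number: sets of `k` nonempty lists in which, taken together, every one of the
`n` elements occurs exactly once. -/
noncomputable def lah (n k : ℕ) : ℕ :=
  {S : Finset (List (Fin n)) | #S = k ∧ (∀ l ∈ S, l ≠ []) ∧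
    ∑ l ∈ S, (l : Multiset (Fin n)) = (Finset.univ : Finset (Fin n)).val}.ncard

/-! ### Forests and mobiles -/

/-- A forest of `k` rooted ordered trees whose `n` non-root vertices are labelled bijectively and
increasingly along every path away from the root; the roots carry no label and every root has at
least one child. A vertex is identified with its label, `c v` is the list of the children of `v`
from left to right, and `R` is the (unordered) set of the lists of children of the roots. Every
non-root vertex is a child of exactly one vertex. -/
def IsOrganicForest (n k : ℕ) (R : Finset (List (Fin n))) (c : Fin n → List (Fin n)) : Prop :=
  #R = k ∧ (∀ l ∈ R, l ≠ []) ∧ (∀ v, ∀ w ∈ c v, v < w) ∧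
    (∑ l ∈ R, (l : Multiset (Fin n))) + ∑ v, (c v : Multiset (Fin n)) =
      (Finset.univ : Finset (Fin n)).val

/-- The number of forests of `k` organically labelled rooted ordered trees with `n` non-root
vertices. -/
noncomputable def organicForests (n k : ℕ) : ℕ :=
  {F : Finset (List (Fin n)) × (Fin n → List (Fin n)) | IsOrganicForest n k F.1 F.2}.ncard

/-- An unordered forest of `k` plane increasing `r`-ary trees on `n` vertices, identified with
their labels. In an `r`-ary tree every vertex has `r` places, each of which holds at most one child.
Here `p v = some (u, s)` means that `v` is the child of `u` at the place `s`, and `p v = none`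
means that `v` is a root; labels increase from parent to child. -/
def IsIncreasingForest (r n k : ℕ) (p : Fin n → Option (Fin n × Fin r)) : Prop :=
  (∀ v u s, p v = some (u, s) → u < v) ∧
    (∀ v w q, p v = some q → p w = some q → v = w) ∧
    #{v : Fin n | p v = none} = k

/-- The number of unordered forests of `k` plane increasing `r`-ary trees with `n` vertices in
total. -/
noncomputable def increasingForests (r n k : ℕ) : ℕ :=
  {p : Fin n → Option (Fin n × Fin r) | IsIncreasingForest r n k p}.ncard

/-- An increasing mobile with `m` nodes and `k` leaves: a rooted tree on labelled nodes, with
labels increasing from parent to child, in which the children of each node are arranged in a circle.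
Here `c v` is the circular arrangement of the children of `v`; every node except the root is a child
of exactly one node, and a leaf is a node without children. -/
def IsIncreasingMobile (m k : ℕ) (c : Fin m → Cycle (Fin m)) : Prop :=
  (∃ root : Fin m,
      {root} + ∑ v, (c v).toMultiset = (Finset.univ : Finset (Fin m)).val) ∧
    (∀ v, ∀ w ∈ c v, v < w) ∧
    #{v : Fin m | c v = Cycle.nil} = k

/-- The number of increasing mobiles with `m` nodes and `k` leaves. -/
noncomputable def increasingMobiles (m k : ℕ) : ℕ :=
  {c : Fin m → Cycle (Fin m) | IsIncreasingMobile m k c}.ncard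

/-! ### The square root of the Eulerian generating function -/

/-- The exponential generating function `A(t, z) = 1 + ∑_{n ≥ 1} t A_n(t) z^n / n!` of the Eulerian
polynomials, as a power series in `z`. -/
noncomputable def eulerianSeries {R : Type*} [CommRing R] [Algebra ℚ R] (t : R) : PowerSeries R :=
  PowerSeries.mk fun n =>
    if n = 0 then 1
    else (1 / (n.factorial : ℚ)) • (t * ∑ k ∈ Finset.range n, (eulerian n k : R) * t ^ k)

/-- The coefficients of the square root with constant term `1` of a power series with coefficients
`f` and constant term `f 0 = 1`. -/
noncomputable def sqrtCoeff {R : Type*} [CommRing R] [Algebra ℚ R] (f : ℕ → R) : ℕ → R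
  | 0 => 1
  | n + 1 => (1 / 2 : ℚ) • (f (n + 1) - ∑ i : Fin n, sqrtCoeff f (i + 1) * sqrtCoeff f (n - i))
termination_by n => n
decreasing_by all_goals omega

/-- The square root, with constant term `1`, of a power series with constant term `1`. -/
noncomputable def seriesSqrt {R : Type*} [CommRing R] [Algebra ℚ R] (F : PowerSeries R) :
    PowerSeries R :=
  PowerSeries.mk (sqrtCoeff fun n => PowerSeries.coeff n F)

theorem constantCoeff_seriesSqrt {R : Type*} [CommRing R] [Algebra ℚ R] (F : PowerSeries R) :
    PowerSeries.constantCoeff (seriesSqrt F) = 1 := by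
  rw [← PowerSeries.coeff_zero_eq_constantCoeff_apply, seriesSqrt, PowerSeries.coeff_mk, sqrtCoeff]

theorem seriesSqrt_sq {R : Type*} [CommRing R] [Algebra ℚ R] (F : PowerSeries R)
    (hF : PowerSeries.constantCoeff F = 1) : seriesSqrt F ^ 2 = F := by
  ext n
  rw [sq, PowerSeries.coeff_mul]
  cases n with
  | zero => simp [seriesSqrt, sqrtCoeff, hF]
  | succ n =>
    rw [Finset.Nat.sum_antidiagonal_eq_sum_range_succ_mk, Finset.sum_range_succ,
      Finset.sum_range_succ']
    simp only [seriesSqrt, PowerSeries.coeff_mk, Nat.sub_self, Nat.sub_zero,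
      Nat.add_sub_add_right]
    have h0 : sqrtCoeff (fun n => PowerSeries.coeff n F) 0 = 1 := by rw [sqrtCoeff]
    have h1 := sqrtCoeff.eq_2 (fun n => PowerSeries.coeff n F) n
    rw [Fin.sum_univ_eq_sum_range (fun i => sqrtCoeff (fun n => PowerSeries.coeff n F) (i + 1) *
      sqrtCoeff (fun n => PowerSeries.coeff n F) (n - i))] at h1
    have h2 : (2 : ℚ) • sqrtCoeff (fun n => PowerSeries.coeff n F) (n + 1) =
        sqrtCoeff (fun n => PowerSeries.coeff n F) (n + 1) +
        sqrtCoeff (fun n => PowerSeries.coeff n F) (n + 1) := two_smul _ _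
    rw [h0, one_mul, mul_one, add_assoc, ← h2, h1, smul_smul]
    norm_num

/-- `√A(2t, z)`, as a power series in `z` whose coefficients are polynomials in `t`. -/
noncomputable def sqrtA : PowerSeries (Polynomial ℚ) :=
  seriesSqrt (eulerianSeries (2 * Polynomial.X))

/-- `T(n, k)` is the coefficient of `t ^ k z ^ n / n!` in `√A(2t, z)`. -/
noncomputable def T (n k : ℕ) : ℚ :=
  (n.factorial : ℚ) * (PowerSeries.coeff n sqrtA).coeff k

end Gram

namespace Gram

open MvPolynomial Finset

/-! ### Triangular recurrences -/

/-! Every identity compares two solutions of one triangular recurrence.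

On the algebraic side, each grammar has a family of monomials `M n k` on which the derivative has
two terms: `D (M n k) = a n k * M (n + 1) k + b n k * M (n + 1) (k + 1)`. Replacing a letter by its
rule multiplies the monomial by a fixed monomial, and the multiplicities come from the exponents of
the letters. Hence the coefficients of the iterates satisfy the recurrence with weights `a`, `b`
(`IsTriangle.iterate_eq`). Constant factors per column, such as `2 ^ k` or `k!`, are moved into `b`
by `IsTriangle.rescale`.

On the combinatorial side, an object of size `n + 1` arises exactly once by inserting a new largest
element (for matchings, a new pair) into an object of size `n`. If `a n k` insertions keep the
statistic `k` and the remaining `b n k` raise it by one, the counts satisfy the same recurrence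
(`isTriangle_of_insertion`). What is left for each family is a good encoding, an inverse for the
insertion and a count of the places that preserve the statistic. Lists of blocks and organic forests
are handled together by `isTriangle_listForest`, and mobiles by cutting each circle in front of its
least entry.

The numbers `T n k` are defined by a square root and need another argument. For a derivation `D`,
the exponential series of the iterates `D ^ n f` is multiplicative in `f`. For `x → x y ^ 2`, `y → x
y` one has `D (y ^ 2) = 2 * D x`, so the square of the series of `y` is determined by the Eulerian
formula for `D ^ n x`, and it equals `A(2t, z)` after setting `x = t`, `y = 1` (`sqrtA_eq`). -/

/-- The triangle `f` satisfies `f (n + 1) k = a n k * f n k + b n (k - 1) * f n (k - 1)` with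
initial row `1, 0, 0, …`. -/
structure IsTriangle (a b f : ℕ → ℕ → ℕ) : Prop where
  zero_zero : f 0 0 = 1
  zero_succ : ∀ k, f 0 (k + 1) = 0
  succ_zero : ∀ n, f (n + 1) 0 = a n 0 * f n 0
  succ_succ : ∀ n k, f (n + 1) (k + 1) = a n (k + 1) * f n (k + 1) + b n k * f n k

namespace IsTriangle

variable {a b f : ℕ → ℕ → ℕ}

theorem eq_zero_of_lt (h : IsTriangle a b f) {n k : ℕ} (hk : n < k) : f n k = 0 := by
  induction n generalizing k with
  | zero =>
    obtain ⟨k, rfl⟩ := Nat.exists_eq_succ_of_ne_zero hk.ne'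
    exact h.zero_succ k
  | succ n ih =>
    obtain ⟨k, rfl⟩ := Nat.exists_eq_succ_of_ne_zero (Nat.zero_lt_of_lt hk).ne'
    rw [h.succ_succ, ih (by omega), ih (by omega)]
    simp

/-- The diagonal is fed only by the preceding diagonal entry, with weight `b n n`. For the Eulerian
triangle this drops the top term of a sum. -/
theorem self_eq_zero (h : IsTriangle a b f) (hb : ∀ n, b n n = 0) {n : ℕ} (hn : 1 ≤ n) :
    f n n = 0 := by
  obtain ⟨n, rfl⟩ := Nat.exists_eq_add_of_le' hn
  rw [h.succ_succ, hb, h.eq_zero_of_lt (Nat.lt_succ_self n)]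
  simp

/-- Column `0` is fed only by itself, so a vanishing first weight kills it from row `1` on. This
lets the sums in the theorem start at `k = 1`. -/
theorem col_zero_eq_zero (h : IsTriangle a b f) (ha : a 0 0 = 0) {n : ℕ} (hn : 1 ≤ n) :
    f n 0 = 0 := by
  induction n, hn using Nat.le_induction with
  | base => rw [h.succ_zero, ha, zero_mul]
  | succ n _ ih => rw [h.succ_zero, ih, mul_zero]

/-- Multiplying the entries in column `k` by `∏ j < k, c j` multiplies `b n k` by `c k`. -/
theorem rescale (h : IsTriangle a b f) (c : ℕ → ℕ) :
    IsTriangle a (fun n k => c k * b n k) (fun n k => (∏ j ∈ range k, c j) * f n k) where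
  zero_zero := by simp [h.zero_zero]
  zero_succ k := by simp [h.zero_succ]
  succ_zero n := by simp [h.succ_zero]
  succ_succ n k := by rw [h.succ_succ, prod_range_succ]; ring

/-- Iterates of an additive operator on a triangular family of elements. -/
theorem iterate_eq (h : IsTriangle a b f) {R : Type*} [CommSemiring R] (D : R → R)
    (hadd : ∀ p q, D (p + q) = D p + D q) (hsmul : ∀ (m : ℕ) p, D (m * p) = m * D p)
    (M : ℕ → ℕ → R)
    (hM : ∀ n k, k ≤ n → D (M n k) = a n k * M (n + 1) k + b n k * M (n + 1) (k + 1)) (n : ℕ) :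
    D^[n] (M 0 0) = ∑ k ∈ range (n + 1), (f n k : R) * M n k := by
  induction n with
  | zero => simp [h.zero_zero]
  | succ n ih =>
    have hzero : D 0 = 0 := by simpa using hsmul 0 0
    have hsum : ∀ (s : Finset ℕ) (g : ℕ → R), D (∑ k ∈ s, g k) = ∑ k ∈ s, D (g k) := by
      intro s g
      induction s using Finset.induction_on with
      | empty => simpa using hzero
      | insert i s hi ih => rw [sum_insert hi, sum_insert hi, hadd, ih]
    rw [Function.iterate_succ_apply', ih, hsum]
    have h1 : ∀ k ∈ range (n + 1), D ((f n k : R) * M n k) =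
        (a n k * f n k : R) * M (n + 1) k + (b n k * f n k : R) * M (n + 1) (k + 1) := by
      intro k hk
      rw [hsmul, hM n k (by simpa [Nat.lt_succ_iff] using hk)]
      ring
    rw [sum_congr rfl h1, sum_add_distrib]
    conv_rhs => rw [sum_range_succ']
    simp only [h.succ_succ, h.succ_zero, Nat.cast_add, Nat.cast_mul, add_mul, sum_add_distrib]
    -- The entry in column `n + 1` of row `n` is zero, so the `a`-part may be summed up to `n + 1`
    -- and then have its term `k = 0` split off.
    have h2 := sum_range_succ' (fun k => (a n k * f n k : R) * M (n + 1) k) (n + 1)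
    rw [sum_range_succ, h.eq_zero_of_lt (Nat.lt_succ_self n)] at h2
    simp only [Nat.cast_zero, mul_zero, zero_mul, add_zero] at h2
    rw [h2]
    ring

end IsTriangle

theorem sum_range_succ_eq_sum_Icc {R : Type*} [AddCommMonoid R] (n : ℕ) (g : ℕ → R)
    (h : g 0 = 0) : ∑ k ∈ range (n + 1), g k = ∑ k ∈ Icc 1 n, g k := by
  rw [Finset.range_eq_Ico, Finset.sum_eq_sum_Ico_succ_bot (Nat.succ_pos n), h, zero_add]
  rfl

/-! ### Counting by insertion -/

/-- If every object of `S'` arises in exactly one way from an object of `S` by one of finitely many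
insertions, and every insertion raises the statistic by at most one, then the numbers of objects
with a given statistic satisfy a triangular recurrence. -/
theorem ncard_of_insertion {α β γ : Type*} [DecidableEq γ] {S : Set α} {S' : Set β}
    (hS : S.Finite)
    (s : α → ℕ) (s' : β → ℕ) (C : α → Finset γ) (ins : α → γ → β) (a b : ℕ → ℕ)
    (hmaps : ∀ o ∈ S, ∀ c ∈ C o, ins o c ∈ S')
    (hinj : ∀ o ∈ S, ∀ c ∈ C o, ∀ o' ∈ S, ∀ c' ∈ C o', ins o c = ins o' c' → o = o' ∧ c = c')
    (hsurj : ∀ o' ∈ S', ∃ o ∈ S, ∃ c ∈ C o, ins o c = o')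
    (hs : ∀ o ∈ S, ∀ c ∈ C o, s' (ins o c) = s o ∨ s' (ins o c) = s o + 1)
    (ha : ∀ o ∈ S, #{c ∈ C o | s' (ins o c) = s o} = a (s o))
    (hb : ∀ o ∈ S, #(C o) = a (s o) + b (s o)) :
    S'.Finite ∧ {o ∈ S' | s' o = 0}.ncard = a 0 * {o ∈ S | s o = 0}.ncard ∧
      ∀ k, {o ∈ S' | s' o = k + 1}.ncard =
        a (k + 1) * {o ∈ S | s o = k + 1}.ncard + b k * {o ∈ S | s o = k}.ncard := by
  classical
  obtain ⟨S, rfl⟩ := hS.exists_finset_coe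
  simp only [Finset.mem_coe] at *
  -- An insertion that does not keep the statistic raises it by one, so these are the remaining `b`
  -- insertions.
  have hb' : ∀ o ∈ S, #{c ∈ C o | s' (ins o c) = s o + 1} = b (s o) := by
    intro o ho
    have h1 := Finset.card_filter_add_card_filter_not (s := C o) (fun c => s' (ins o c) = s o)
    have h2 : {c ∈ C o | ¬ s' (ins o c) = s o} = {c ∈ C o | s' (ins o c) = s o + 1} := by
      apply Finset.filter_congr
      intro c hc
      have := hs o ho c hc
      omega
    rw [h2, ha o ho, hb o ho] at h1
    omega
  let f : (Σ _ : α, γ) → β := fun p => ins p.1 p.2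
  have himg : S' = ((S.sigma C).image f : Finset β) := by
    ext o'
    simp only [Finset.coe_image, Set.mem_image, Finset.mem_coe, Finset.mem_sigma, f]
    constructor
    · intro h
      obtain ⟨o, ho, c, hc, h⟩ := hsurj o' h
      exact ⟨⟨o, c⟩, ⟨ho, hc⟩, h⟩
    · rintro ⟨⟨o, c⟩, ⟨ho, hc⟩, rfl⟩
      exact hmaps o ho c hc
  -- Insertion is a bijection from pairs (object, place) onto `S'`, so the objects with statistic
  -- `k` can be sorted by the object they come from.
  have hcount : ∀ k, {o ∈ S' | s' o = k}.ncard = ∑ o ∈ S, #{c ∈ C o | s' (ins o c) = k} := by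
    intro k
    have : {o ∈ S' | s' o = k} =
        (((S.sigma fun o => {c ∈ C o | s' (ins o c) = k}).image f : Finset β) : Set β) := by
      ext o'
      simp only [himg, Finset.coe_image, Set.mem_image, Finset.mem_coe, Finset.mem_sigma, f,
        Set.mem_ofPred_eq, Finset.mem_filter]
      constructor
      · rintro ⟨⟨p, ⟨h1, h2⟩, rfl⟩, h3⟩
        exact ⟨p, ⟨h1, h2, h3⟩, rfl⟩
      · rintro ⟨p, ⟨h1, h2, h3⟩, rfl⟩
        exact ⟨⟨p, ⟨h1, h2⟩, rfl⟩, h3⟩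
    rw [this, Set.ncard_coe_finset, Finset.card_image_of_injOn, Finset.card_sigma]
    rintro ⟨o, c⟩ h1 ⟨o2, c2⟩ h2 h3
    simp only [Finset.mem_coe, Finset.mem_sigma, Finset.mem_filter] at h1 h2
    obtain ⟨rfl, rfl⟩ := hinj o h1.1 c h1.2.1 o2 h2.1 c2 h2.2.1 h3
    rfl
  have hcount' : ∀ k, {o : α | o ∈ S ∧ s o = k}.ncard = #{o ∈ S | s o = k} := by
    intro k
    rw [← Set.ncard_coe_finset]
    simp
  refine ⟨himg ▸ Finset.finite_toSet _, ?_, fun k => ?_⟩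
  · rw [hcount, hcount', mul_comm, ← smul_eq_mul, ← Finset.sum_const, Finset.sum_filter]
    refine Finset.sum_congr rfl fun o ho => ?_
    split_ifs with h
    · rw [← h, ha o ho]
    · rw [Finset.card_eq_zero, Finset.filter_eq_empty_iff]
      intro c hc
      have := hs o ho c hc
      omega
  · rw [hcount, hcount', hcount', mul_comm, ← smul_eq_mul, ← Finset.sum_const,
      mul_comm (b k), ← smul_eq_mul (a := #_), ← Finset.sum_const, Finset.sum_filter,
      Finset.sum_filter, ← Finset.sum_add_distrib]
    refine Finset.sum_congr rfl fun o ho => ?_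
    split_ifs with h h' h'
    · omega
    · rw [add_zero, ← h, ha o ho]
    · rw [zero_add, ← h', hb' o ho]
    · rw [add_zero, Finset.card_eq_zero, Finset.filter_eq_empty_iff]
      intro c hc
      have := hs o ho c hc
      omega

/-- The triangle of the numbers of objects counted by size and by a statistic, for objects of size
`n + 1` that arise by insertion from those of size `n`. -/
theorem isTriangle_of_insertion {α : ℕ → Type*} {γ : ℕ → Type*} [∀ n, DecidableEq (γ n)]
    (S : ∀ n, Set (α n)) (s : ∀ n, α n → ℕ) (C : ∀ n, α n → Finset (γ n))
    (ins : ∀ n, α n → γ n → α (n + 1)) (a b : ℕ → ℕ → ℕ) (o₀ : α 0)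
    (h₀ : ∀ o, o ∈ S 0 ↔ o = o₀) (hs₀ : s 0 o₀ = 0)
    (hmaps : ∀ n, ∀ o ∈ S n, ∀ c ∈ C n o, ins n o c ∈ S (n + 1))
    (hinj : ∀ n, ∀ o ∈ S n, ∀ c ∈ C n o, ∀ o' ∈ S n, ∀ c' ∈ C n o',
      ins n o c = ins n o' c' → o = o' ∧ c = c')
    (hsurj : ∀ n, ∀ o' ∈ S (n + 1), ∃ o ∈ S n, ∃ c ∈ C n o, ins n o c = o')
    (hs : ∀ n, ∀ o ∈ S n, ∀ c ∈ C n o,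
      s (n + 1) (ins n o c) = s n o ∨ s (n + 1) (ins n o c) = s n o + 1)
    (ha : ∀ n, ∀ o ∈ S n, #{c ∈ C n o | s (n + 1) (ins n o c) = s n o} = a n (s n o))
    (hb : ∀ n, ∀ o ∈ S n, #(C n o) = a n (s n o) + b n (s n o)) :
    IsTriangle a b (fun n k => {o ∈ S n | s n o = k}.ncard) := by
  have hS₀ : S 0 = {o₀} := by
    ext o
    simpa using h₀ o
  -- Finiteness is carried from size to size, since the ambient types need not be finite: signed
  -- permutations live in `Equiv.Perm ℤ`.
  have hfin : ∀ n, (S n).Finite := by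
    intro n
    induction n with
    | zero => rw [hS₀]; exact Set.finite_singleton _
    | succ n ih =>
      exact (ncard_of_insertion ih (s n) (s (n + 1)) (C n) (ins n) (a n) (b n) (hmaps n) (hinj n)
        (hsurj n) (hs n) (ha n) (hb n)).1
  have key := fun n => (ncard_of_insertion (hfin n) (s n) (s (n + 1)) (C n) (ins n) (a n) (b n)
    (hmaps n) (hinj n) (hsurj n) (hs n) (ha n) (hb n)).2
  refine ⟨?_, fun k => ?_, fun n => (key n).1, fun n k => (key n).2 k⟩
  · have : {o ∈ S 0 | s 0 o = 0} = {o₀} := by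
      ext o
      simp only [hS₀, Set.mem_singleton_iff, Set.mem_ofPred_eq]
      exact ⟨fun h => h.1, fun h => ⟨h, h ▸ hs₀⟩⟩
    rw [this, Set.ncard_singleton]
  · have : {o ∈ S 0 | s 0 o = k + 1} = ∅ := by
      ext o
      simp only [hS₀, Set.mem_singleton_iff, Set.mem_ofPred_eq, Set.mem_empty_iff_false,
        iff_false, not_and]
      rintro rfl
      omega
    rw [this, Set.ncard_empty]

end Gram

namespace Gram

open MvPolynomial Finset

/-! ### Formal derivatives of monomials -/

section FormalDerivative

variable (u v : MvPolynomial (Fin 2) ℚ)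

theorem formalDerivative_x : formalDerivative ![u, v] x = u := by
  simp [formalDerivative, x, mkDerivation_X]

theorem formalDerivative_y : formalDerivative ![u, v] y = v := by
  simp [formalDerivative, y, mkDerivation_X]

/-- The truncated exponents `i - 1` and `j - 1` are harmless: at `0` they come with coefficient `0`.
-/
theorem formalDerivative_monomial (i j : ℕ) :
    formalDerivative ![u, v] (x ^ i * y ^ j) =
      (i : MvPolynomial (Fin 2) ℚ) * x ^ (i - 1) * u * y ^ j +
        (j : MvPolynomial (Fin 2) ℚ) * x ^ i * y ^ (j - 1) * v := by
  rw [Derivation.leibniz, Derivation.leibniz_pow, Derivation.leibniz_pow, formalDerivative_x,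
    formalDerivative_y]
  simp only [smul_eq_mul, nsmul_eq_mul]
  ring

/-- The iterates of the formal derivative on a triangular family of monomials. -/
theorem IsTriangle.derivPow_eq {a b f : ℕ → ℕ → ℕ} (h : IsTriangle a b f)
    (M : ℕ → ℕ → MvPolynomial (Fin 2) ℚ)
    (hM : ∀ n k, k ≤ n → formalDerivative ![u, v] (M n k) =
      a n k * M (n + 1) k + b n k * M (n + 1) (k + 1)) (n : ℕ) :
    derivPow u v n (M 0 0) =
      ∑ k ∈ range (n + 1), (f n k : MvPolynomial (Fin 2) ℚ) * M n k :=
  h.iterate_eq _ (map_add _) (fun m p => by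
    rw [← nsmul_eq_mul, ← nsmul_eq_mul, map_nsmul]) M hM n

end FormalDerivative

/-! ### The derivatives as sums over triangles -/

section Triangles

variable {f : ℕ → ℕ → ℕ} (n : ℕ)

/-- On `x ^ (2(n-k)+1) * y ^ (2k+1)` the rule for `y` contributes a factor `x ^ 2` and stays in
column `k`; the rule for `x` contributes `y ^ 2` and moves to column `k + 1`. The weights are the
two exponents. -/
theorem derivPow_c1 (h : IsTriangle (fun _ k => 2 * k + 1) (fun n k => 2 * (n - k) + 1) f) :
    derivPow (x * y ^ 2) (x ^ 2 * y) n (x * y) =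
      x * y * ∑ k ∈ range (n + 1),
        (f n k : MvPolynomial (Fin 2) ℚ) * x ^ (2 * n - 2 * k) * y ^ (2 * k) := by
  have := h.derivPow_eq (x * y ^ 2) (x ^ 2 * y)
    (fun n k => x ^ (2 * n - 2 * k + 1) * y ^ (2 * k + 1)) (fun n k hk => by
      -- With `n = k + m` every truncated difference in the exponents becomes an honest sum.
      obtain ⟨m, rfl⟩ := Nat.exists_eq_add_of_le hk
      rw [formalDerivative_monomial, show 2 * (k + m) - 2 * k = 2 * m by omega,
        show 2 * (k + m + 1) - 2 * k = 2 * m + 2 by omega, Nat.add_sub_cancel_left,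
        show 2 * (k + m + 1) - 2 * (k + 1) = 2 * m by omega, Nat.add_sub_cancel,
        Nat.add_sub_cancel]
      push_cast
      ring) n
  simp only [mul_zero, Nat.sub_zero, zero_add, pow_one] at this
  rw [this, mul_sum]
  exact sum_congr rfl fun k _ => by ring

theorem derivPow_c2 (h : IsTriangle (fun _ k => k + 1) (fun n k => n - k) f) :
    derivPow (x * y ^ 2) (x ^ 2 * y) n (x ^ 2 * y ^ 2) =
      2 ^ n * x ^ 2 * y ^ 2 * ∑ k ∈ range (n + 1),
        (f (n + 1) k : MvPolynomial (Fin 2) ℚ) * x ^ (2 * n - 2 * k) * y ^ (2 * k) := by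
  have h10 : f 1 0 = 1 := by rw [h.succ_zero, h.zero_zero]
  -- The exponents `2(k+1)` and `2(n+1-k)` are twice the Eulerian weights of row `n + 1`; the
  -- doubling produces `2 ^ n`, and the seed `x ^ 2 * y ^ 2` is row `1`.
  have h' : IsTriangle (fun _ k => 2 * (k + 1)) (fun n k => 2 * (n + 1 - k))
      (fun n k => 2 ^ n * f (n + 1) k) :=
    { zero_zero := by simp [h10]
      zero_succ := fun k => by simp [h.succ_succ, h.zero_succ]
      succ_zero := fun n => by rw [h.succ_zero]; ring
      succ_succ := fun n k => by rw [h.succ_succ]; ring }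
  have := h'.derivPow_eq (x * y ^ 2) (x ^ 2 * y)
    (fun n k => x ^ (2 * n - 2 * k + 2) * y ^ (2 * k + 2)) (fun n k hk => by
      obtain ⟨m, rfl⟩ := Nat.exists_eq_add_of_le hk
      rw [formalDerivative_monomial, show 2 * (k + m) - 2 * k = 2 * m by omega,
        show 2 * (k + m + 1) - 2 * k = 2 * m + 2 by omega,
        show k + m + 1 - k = m + 1 by omega,
        show 2 * (k + m + 1) - 2 * (k + 1) = 2 * m by omega,
        show 2 * m + 2 - 1 = 2 * m + 1 by omega, show 2 * k + 2 - 1 = 2 * k + 1 by omega]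
      push_cast
      ring) n
  simp only [mul_zero, Nat.sub_zero, zero_add] at this
  rw [this, mul_sum]
  exact sum_congr rfl fun k _ => by push_cast; ring

theorem derivPow_c3 (hn : 1 ≤ n)
    (h : IsTriangle (fun _ k => 2 * k) (fun n k => 2 * (n - k) + 1) f) :
    derivPow (x * y ^ 2) (x ^ 2 * y) n x =
      x * ∑ k ∈ Icc 1 n,
        (f n k : MvPolynomial (Fin 2) ℚ) * x ^ (2 * n - 2 * k) * y ^ (2 * k) := by
  have := h.derivPow_eq (x * y ^ 2) (x ^ 2 * y)
    (fun n k => x ^ (2 * n - 2 * k + 1) * y ^ (2 * k)) (fun n k hk => by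
      obtain ⟨m, rfl⟩ := Nat.exists_eq_add_of_le hk
      rw [formalDerivative_monomial, show 2 * (k + m) - 2 * k = 2 * m by omega,
        show 2 * (k + m + 1) - 2 * k = 2 * m + 2 by omega, Nat.add_sub_cancel_left,
        show 2 * (k + m + 1) - 2 * (k + 1) = 2 * m by omega, Nat.add_sub_cancel]
      -- For `k = 0` there is no `y` to differentiate, and `2 * k - 1` would be truncated.
      cases k with
      | zero => push_cast; ring
      | succ k =>
        rw [show 2 * (k + 1) - 1 = 2 * k + 1 by omega]
        push_cast
        ring) n
  simp only [mul_zero, Nat.sub_zero, zero_add, pow_one, pow_zero, mul_one] at this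
  rw [this, sum_range_succ_eq_sum_Icc _ _ (by simp [h.col_zero_eq_zero rfl hn]), mul_sum]
  exact sum_congr rfl fun k _ => by ring

theorem derivPow_c4 (r : ℕ) (h : IsTriangle (fun _ k => k + 1) (fun n k => n + r - k) f) :
    derivPow (x * y) (x * y) n (x * y ^ r) =
      x * ∑ k ∈ range (n + 1),
        (f n k : MvPolynomial (Fin 2) ℚ) * x ^ k * y ^ (n + r - k) := by
  have := h.derivPow_eq (x * y) (x * y)
    (fun n k => x ^ (k + 1) * y ^ (n + r - k)) (fun n k hk => by
      obtain ⟨m, rfl⟩ := Nat.exists_eq_add_of_le hk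
      rw [formalDerivative_monomial, show k + m + r - k = m + r by omega,
        show k + m + 1 + r - k = m + r + 1 by omega,
        show k + m + 1 + r - (k + 1) = m + r by omega, Nat.add_sub_cancel]
      cases h : m + r with
      | zero => push_cast; ring
      | succ l =>
        rw [Nat.add_sub_cancel]
        push_cast
        ring) n
  simp only [Nat.sub_zero, zero_add, pow_one] at this
  rw [this, mul_sum]
  exact sum_congr rfl fun k _ => by ring

theorem derivPow_c5 (h : IsTriangle (fun _ k => k + 1) (fun n k => n - k) f) :
    derivPow (x * y ^ 2) (x * y) n x =
      x * ∑ k ∈ range (n + 1),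
        2 ^ k * (f n k : MvPolynomial (Fin 2) ℚ) * x ^ k * y ^ (2 * n - 2 * k) := by
  -- The exponent of `y` is `2(n-k)`, twice the Eulerian weight, so column `k` acquires the factor
  -- `2 ^ k`.
  have := (h.rescale fun _ => 2).derivPow_eq (x * y ^ 2) (x * y)
    (fun n k => x ^ (k + 1) * y ^ (2 * n - 2 * k)) (fun n k hk => by
      obtain ⟨m, rfl⟩ := Nat.exists_eq_add_of_le hk
      rw [formalDerivative_monomial, show 2 * (k + m) - 2 * k = 2 * m by omega,
        show 2 * (k + m + 1) - 2 * k = 2 * m + 2 by omega, Nat.add_sub_cancel_left,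
        show 2 * (k + m + 1) - 2 * (k + 1) = 2 * m by omega, Nat.add_sub_cancel]
      cases m with
      | zero => push_cast; ring
      | succ m =>
        rw [show 2 * (m + 1) - 1 = 2 * m + 1 by omega]
        push_cast
        ring) n
  simp only [mul_zero, Nat.sub_zero, zero_add, pow_one, pow_zero, mul_one, prod_const,
    card_range] at this
  rw [this, mul_sum]
  exact sum_congr rfl fun k _ => by push_cast; ring

theorem derivPow_c6 (h : IsTriangle (fun _ k => k) (fun n k => 2 * (n - k) + 1) f) :
    derivPow (x * y ^ 2) (x * y) n y =
      ∑ k ∈ range (n + 1),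
        (f n k : MvPolynomial (Fin 2) ℚ) * x ^ k * y ^ (2 * n - 2 * k + 1) := by
  have := h.derivPow_eq (x * y ^ 2) (x * y)
    (fun n k => x ^ k * y ^ (2 * n - 2 * k + 1)) (fun n k hk => by
      obtain ⟨m, rfl⟩ := Nat.exists_eq_add_of_le hk
      rw [formalDerivative_monomial, show 2 * (k + m) - 2 * k = 2 * m by omega,
        show 2 * (k + m + 1) - 2 * k = 2 * m + 2 by omega, Nat.add_sub_cancel_left,
        show 2 * (k + m + 1) - 2 * (k + 1) = 2 * m by omega, Nat.add_sub_cancel]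
      cases k with
      | zero => push_cast; ring
      | succ k =>
        rw [Nat.add_sub_cancel]
        push_cast
        ring) n
  simp only [mul_zero, Nat.sub_zero, zero_add, pow_one, pow_zero, one_mul] at this
  rw [this]
  exact sum_congr rfl fun k _ => by ring

theorem derivPow_c7 (hn : 1 ≤ n) (h : IsTriangle (fun _ k => k) (fun _ _ => 1) f) :
    derivPow (x ^ 2 * y) y n x =
      x * ∑ k ∈ Icc 1 n,
        (k.factorial : MvPolynomial (Fin 2) ℚ) * (f n k : ℕ) * x ^ k * y ^ k := by
  -- The exponent `k + 1` of `x` weights the passage from column `k` to column `k + 1`; these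
  -- factors accumulate to `k!`.
  have := (h.rescale fun k => k + 1).derivPow_eq (x ^ 2 * y) y
    (fun n k => x ^ (k + 1) * y ^ k) (fun n k hk => by
      rw [formalDerivative_monomial, Nat.add_sub_cancel]
      cases k with
      | zero => push_cast; ring
      | succ k =>
        rw [Nat.add_sub_cancel]
        push_cast
        ring) n
  simp only [zero_add, pow_one, pow_zero, mul_one, prod_range_add_one_eq_factorial] at this
  rw [this, sum_range_succ_eq_sum_Icc _ _ (by simp [h.col_zero_eq_zero rfl hn]), mul_sum]
  exact sum_congr rfl fun k _ => by push_cast; ring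

theorem derivPow_c8 (hn : 1 ≤ n) (h : IsTriangle (fun n _ => n) (fun _ _ => 1) f) :
    derivPow (x ^ 2 * y) (y ^ 2) n x =
      x * ∑ k ∈ Icc 1 n,
        (k.factorial : MvPolynomial (Fin 2) ℚ) * (f n k : ℕ) * x ^ k * y ^ n := by
  have := (h.rescale fun k => k + 1).derivPow_eq (x ^ 2 * y) (y ^ 2)
    (fun n k => x ^ (k + 1) * y ^ n) (fun n k hk => by
      rw [formalDerivative_monomial, Nat.add_sub_cancel]
      cases n with
      | zero => push_cast; ring
      | succ n =>
        rw [Nat.add_sub_cancel]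
        push_cast
        ring) n
  simp only [zero_add, pow_one, pow_zero, mul_one, prod_range_add_one_eq_factorial] at this
  rw [this, sum_range_succ_eq_sum_Icc _ _ (by simp [h.col_zero_eq_zero rfl hn]), mul_sum]
  exact sum_congr rfl fun k _ => by push_cast; ring

/-- The derivatives of `x` for the grammar `x → x y ^ (s + 1)`, `y → y ^ (s + 1)`. -/
theorem derivPow_x_of_pow (hn : 1 ≤ n) (s : ℕ)
    (h : IsTriangle (fun n k => s * n + k) (fun _ _ => 1) f) :
    derivPow (x * y ^ (s + 1)) (y ^ (s + 1)) n x =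
      x * ∑ k ∈ Icc 1 n, (f n k : MvPolynomial (Fin 2) ℚ) * y ^ (s * n + k) := by
  have := h.derivPow_eq (x * y ^ (s + 1)) (y ^ (s + 1))
    (fun n k => x ^ 1 * y ^ (s * n + k)) (fun n k hk => by
      rw [formalDerivative_monomial, mul_add_one]
      -- If the exponent of `y` is zero, then only the rule for `x` acts.
      cases h : s * n + k with
      | zero =>
        obtain ⟨h1, h2⟩ : s * n = 0 ∧ k = 0 := by omega
        rw [h1, h2]
        push_cast
        ring
      | succ m =>
        rw [show s * n + s + k = m + 1 + s by omega,
          show s * n + s + (k + 1) = m + 1 + s + 1 by omega, Nat.add_sub_cancel]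
        push_cast
        ring) n
  simp only [mul_zero, zero_add, pow_one, pow_zero, mul_one] at this
  rw [this, sum_range_succ_eq_sum_Icc _ _ (by simp [h.col_zero_eq_zero (by simp) hn]), mul_sum]
  exact sum_congr rfl fun k _ => by ring

/-- The first derivative `D y = x * y` serves as the seed, so row `n` of the triangle describes `D ^
(n + 1) y`. -/
theorem derivPow_c12 (h : IsTriangle (fun _ k => k + 1) (fun n _ => n + 1) f) :
    derivPow (x ^ 2 * y) (x * y) (n + 1) y =
      x ^ (n + 1) * ∑ k ∈ range (n + 1),
        (f n k : MvPolynomial (Fin 2) ℚ) * y ^ (k + 1) := by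
  have := h.derivPow_eq (x ^ 2 * y) (x * y)
    (fun n k => x ^ (n + 1) * y ^ (k + 1)) (fun n k hk => by
      rw [formalDerivative_monomial, Nat.add_sub_cancel, Nat.add_sub_cancel]
      push_cast
      ring) n
  simp only [zero_add, pow_one] at this
  rw [derivPow, Function.iterate_succ_apply, formalDerivative_y, ← derivPow, this, mul_sum]
  exact sum_congr rfl fun k _ => by ring

end Triangles

end Gram

namespace Gram

open MvPolynomial Finset

/-! ### The square root of the Eulerian series -/

/-- The general Leibniz rule. -/
theorem derivation_iterate_mul {R A : Type*} [CommSemiring R] [CommSemiring A] [Algebra R A]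
    (D : Derivation R A A) (n : ℕ) (f g : A) :
    D^[n] (f * g) = ∑ ij ∈ antidiagonal n, n.choose ij.1 • (D^[ij.1] f * D^[ij.2] g) := by
  induction n with
  | zero => simp
  | succ n ih =>
    rw [sum_antidiagonal_choose_succ_nsmul (fun i j => D^[i] f * D^[j] g) n]
    simp only [Function.iterate_succ_apply', ih, map_sum, map_nsmul, Derivation.leibniz, smul_add,
      sum_add_distrib, smul_eq_mul]
    congr 1
    refine sum_congr rfl fun ⟨i, j⟩ hij => ?_
    rw [n.choose_symm_of_eq_add (mem_antidiagonal.1 hij).symm, mul_comm]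

/-- The exponential generating function of the iterates of a derivation, after applying an algebra
homomorphism. -/
noncomputable def iterateSeries {A B : Type*} [CommRing A] [Algebra ℚ A] [CommRing B] [Algebra ℚ B]
    (D : Derivation ℚ A A) (φ : A →ₐ[ℚ] B) (f : A) : PowerSeries B :=
  PowerSeries.mk fun n => (1 / (n.factorial : ℚ)) • φ (D^[n] f)

/-- The series is `exp (z D) f` followed by `φ`, and the exponential of a derivation is
multiplicative: division by the factorials turns the binomial sum of Leibniz's rule into a Cauchy
product. -/
theorem iterateSeries_mul {A B : Type*} [CommRing A] [Algebra ℚ A] [CommRing B] [Algebra ℚ B]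
    (D : Derivation ℚ A A) (φ : A →ₐ[ℚ] B) (f g : A) :
    iterateSeries D φ (f * g) = iterateSeries D φ f * iterateSeries D φ g := by
  ext n
  rw [PowerSeries.coeff_mul]
  simp only [iterateSeries, PowerSeries.coeff_mk, derivation_iterate_mul, map_sum, smul_sum,
    map_nsmul, map_mul]
  refine sum_congr rfl fun ⟨i, j⟩ hij => ?_
  obtain rfl := mem_antidiagonal.1 hij
  rw [smul_mul_smul_comm, ← Nat.cast_smul_eq_nsmul ℚ, smul_smul]
  congr 1
  have h := Nat.add_choose_mul_factorial_mul_factorial i j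
  rw [← Nat.choose_symm_add] at h
  have h' : ((i + j).choose i : ℚ) * i.factorial * j.factorial = (i + j).factorial := by
    exact_mod_cast h
  have hi : (i.factorial : ℚ) ≠ 0 := by positivity
  have hj : (j.factorial : ℚ) ≠ 0 := by positivity
  have hij : ((i + j).factorial : ℚ) ≠ 0 := by positivity
  field_simp
  linarith

/-- Over a domain two square roots differ by a sign, and the constant term `1` selects the sign
because `1 ≠ -1` in characteristic zero. -/
theorem eq_seriesSqrt {R : Type*} [CommRing R] [IsDomain R] [Algebra ℚ R] {F G : PowerSeries R}
    (hF : PowerSeries.constantCoeff F = 1) (hG : PowerSeries.constantCoeff G = 1)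
    (h : G ^ 2 = F) : seriesSqrt F = G := by
  have hsq := seriesSqrt_sq F hF
  rw [← h] at hsq
  rcases sq_eq_sq_iff_eq_or_eq_neg.1 hsq with h' | h'
  · rw [← h, h']
  · have h1 := congrArg PowerSeries.constantCoeff h'
    rw [map_neg, hG, constantCoeff_seriesSqrt] at h1
    have : CharZero R := algebraRat.charZero R
    exact absurd h1 (by norm_num [eq_neg_iff_add_eq_zero])

/-- The triangle of the derivatives of `y` for the grammar `x → x y ^ 2`, `y → x y`. -/
def sqrtTriangle : ℕ → ℕ → ℕ
  | 0, 0 => 1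
  | 0, _ + 1 => 0
  | _ + 1, 0 => 0
  | n + 1, k + 1 => (k + 1) * sqrtTriangle n (k + 1) + (2 * (n - k) + 1) * sqrtTriangle n k

theorem isTriangle_sqrtTriangle :
    IsTriangle (fun _ k => k) (fun n k => 2 * (n - k) + 1) sqrtTriangle where
  zero_zero := rfl
  zero_succ _ := rfl
  succ_zero n := by simp [sqrtTriangle]
  succ_succ n k := by simp [sqrtTriangle]

/-- After `x = t`, `y = 1`, the series of `y` has the coefficients on the right, and its square is
the series of `y ^ 2`. That series is `A(2t, z)`, because `D ^ (n + 1) (y ^ 2) = 2 * D ^ (n + 1) x`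
and the Eulerian expansion of the latter carries exactly the powers of `2 * t`. -/
theorem sqrtA_eq (hE : IsTriangle (fun _ k => k + 1) (fun n k => n - k) eulerian) :
    sqrtA = PowerSeries.mk fun n => (1 / (n.factorial : ℚ)) •
      ∑ k ∈ range (n + 1), (sqrtTriangle n k : Polynomial ℚ) * Polynomial.X ^ k := by
  set φ : MvPolynomial (Fin 2) ℚ →ₐ[ℚ] Polynomial ℚ := aeval ![Polynomial.X, 1] with hφ
  have hx : φ x = Polynomial.X := by simp [hφ]
  have hy : φ y = 1 := by simp [hφ]
  set D := formalDerivative ![x * y ^ 2, x * y] with hD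
  have hG : iterateSeries D φ y = PowerSeries.mk fun n => (1 / (n.factorial : ℚ)) •
      ∑ k ∈ range (n + 1), (sqrtTriangle n k : Polynomial ℚ) * Polynomial.X ^ k := by
    ext1 n
    simp only [iterateSeries, PowerSeries.coeff_mk]
    rw [hD, ← derivPow, derivPow_c6 n isTriangle_sqrtTriangle]
    simp [hx, hy]
  rw [← hG, sqrtA]
  have hF : iterateSeries D φ (y * y) = eulerianSeries (2 * Polynomial.X) := by
    ext1 n
    simp only [iterateSeries, eulerianSeries, PowerSeries.coeff_mk]
    cases n with
    | zero => simp [hy]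
    | succ n =>
      rw [if_neg (Nat.succ_ne_zero n)]
      congr 1
      -- Both sides are `2 * x * y ^ 2`; this is the link between the two letters.
      have h1 : D (y * y) = 2 • D x := by
        rw [Derivation.leibniz, hD, formalDerivative_x, formalDerivative_y]
        simp only [smul_eq_mul]
        ring
      have h2 : ∀ (n : ℕ) (p : MvPolynomial (Fin 2) ℚ), D^[n] (2 • p) = 2 • D^[n] p := by
        intro n p
        induction n generalizing p with
        | zero => rfl
        | succ n ih => rw [Function.iterate_succ_apply, map_nsmul, ih, Function.iterate_succ_apply]
      rw [Function.iterate_succ_apply, h1, h2, ← Function.iterate_succ_apply, hD, ← derivPow,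
        derivPow_c5 _ hE, sum_range_succ, hE.self_eq_zero (fun n => Nat.sub_self n) (Nat.succ_pos n)]
      simp only [Nat.cast_zero, mul_zero, zero_mul, add_zero, map_mul, map_sum, map_pow,
        hx, hy, one_pow, mul_one, map_natCast, map_ofNat, nsmul_eq_mul, Nat.cast_ofNat, mul_assoc]
      congr 2
      exact sum_congr rfl fun k _ => by ring
  refine eq_seriesSqrt ?_ ?_ ?_
  · rw [← PowerSeries.coeff_zero_eq_constantCoeff_apply]
    simp [eulerianSeries]
  · rw [← PowerSeries.coeff_zero_eq_constantCoeff_apply]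
    simp [iterateSeries, hy]
  · rw [sq, ← iterateSeries_mul, hF]

theorem T_eq (hE : IsTriangle (fun _ k => k + 1) (fun n k => n - k) eulerian) (n k : ℕ) :
    T n k = sqrtTriangle n k := by
  rw [T, sqrtA_eq hE, PowerSeries.coeff_mk]
  have h0 : (n.factorial : ℚ) ≠ 0 := by positivity
  simp only [Polynomial.coeff_smul, Polynomial.finsetSum_coeff, smul_eq_mul,
    Polynomial.coeff_natCast_mul, Polynomial.coeff_X_pow, mul_ite, mul_one, mul_zero,
    sum_ite_eq, mem_range]
  rw [← mul_assoc, mul_one_div_cancel h0, one_mul]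
  split_ifs with h
  · rfl
  · rw [isTriangle_sqrtTriangle.eq_zero_of_lt (by omega), Nat.cast_zero]

theorem sqrtA_eq_sum_T (hE : IsTriangle (fun _ k => k + 1) (fun n k => n - k) eulerian) :
    sqrtA = 1 + PowerSeries.mk (fun m : ℕ => if m = 0 then 0 else
      (1 / (m.factorial : ℚ)) • ∑ k ∈ Icc 1 m,
        Polynomial.C (T m k) * Polynomial.X ^ k) := by
  rw [sqrtA_eq hE]
  ext1 n
  simp only [map_add, PowerSeries.coeff_mk, PowerSeries.coeff_one]
  split_ifs with h
  · subst h
    simp [sqrtTriangle]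
  · rw [zero_add, sum_range_succ_eq_sum_Icc]
    · simp [T_eq hE]
    · rw [isTriangle_sqrtTriangle.col_zero_eq_zero rfl (Nat.pos_of_ne_zero h)]
      simp

theorem derivPow_y_eq_sum_T (hE : IsTriangle (fun _ k => k + 1) (fun n k => n - k) eulerian)
    (n : ℕ) (hn : 1 ≤ n) :
    derivPow (x * y ^ 2) (x * y) n y =
      ∑ k ∈ Icc 1 n, C (T n k) * x ^ k * y ^ (2 * n - 2 * k + 1) := by
  rw [derivPow_c6 n isTriangle_sqrtTriangle, sum_range_succ_eq_sum_Icc]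
  · simp [T_eq hE]
  · rw [isTriangle_sqrtTriangle.col_zero_eq_zero rfl hn]
    simp

end Gram

namespace Gram

open Finset

theorem card_filter_fin_succ {n : ℕ} (p : Fin (n + 1) → Prop) [DecidablePred p] :
    #{i | p i} = #{i : Fin n | p i.castSucc} + if p (Fin.last n) then 1 else 0 := by
  rw [card_filter, card_filter, Fin.sum_univ_castSucc]

/-! ### Increasing forests -/

/-- Among the `r * n` places, those that are taken correspond bijectively to the vertices that are
not roots. -/
theorem card_free_places {r n : ℕ} (p : Fin n → Option (Fin n × Fin r))
    (h : ∀ v w q, p v = some q → p w = some q → v = w) :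
    #{q : Fin n × Fin r | ∀ v, p v ≠ some q} + n = r * n + #{v | p v = none} := by
  have h1 := card_filter_add_card_filter_not (s := (univ : Finset (Fin n × Fin r)))
    (fun q => ∀ v, p v ≠ some q)
  have h2 := card_filter_add_card_filter_not (s := (univ : Finset (Fin n))) (fun v => p v = none)
  have h3 : #{q : Fin n × Fin r | ¬ ∀ v, p v ≠ some q} = #{v | ¬ p v = none} := by
    symm
    refine card_bij (fun v hv => (p v).get (by simpa [Option.isSome_iff_ne_none] using hv)) ?_ ?_ ?_
    · intro v hv
      simp only [mem_filter_univ, ne_eq, not_forall, not_not]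
      exact ⟨v, by simp⟩
    · intro v hv w hw hvw
      exact h v w _ (Option.some_get _).symm (by rw [hvw]; exact (Option.some_get _).symm)
    · intro q hq
      simp only [mem_filter_univ, ne_eq, not_forall, not_not] at hq
      obtain ⟨v, hv⟩ := hq
      exact ⟨v, by simp [hv], by simp [hv]⟩
  simp only [card_univ, Fintype.card_prod, Fintype.card_fin] at h1 h2
  rw [mul_comm r n]
  omega

/-- Adding a vertex with the largest label at the place `c`, or as a root. -/
def forestInsert {r n : ℕ} (p : Fin n → Option (Fin n × Fin r)) (c : Option (Fin n × Fin r)) :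
    Fin (n + 1) → Option (Fin (n + 1) × Fin r) :=
  Fin.snoc (α := fun _ => Option (Fin (n + 1) × Fin r))
    (fun v => (p v).map (Prod.map Fin.castSucc id)) (c.map (Prod.map Fin.castSucc id))

@[simp]
theorem forestInsert_castSucc {r n : ℕ} (p : Fin n → Option (Fin n × Fin r))
    (c : Option (Fin n × Fin r)) (v : Fin n) :
    forestInsert p c v.castSucc = (p v).map (Prod.map Fin.castSucc id) := by
  simp [forestInsert]

@[simp]
theorem forestInsert_last {r n : ℕ} (p : Fin n → Option (Fin n × Fin r))
    (c : Option (Fin n × Fin r)) :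
    forestInsert p c (Fin.last n) = c.map (Prod.map Fin.castSucc id) := by
  simp [forestInsert]

theorem castSucc_prodMap_injective {r n : ℕ} :
    Function.Injective (Prod.map (Fin.castSucc (n := n)) (id : Fin r → Fin r)) :=
  (Fin.castSucc_injective n).prodMap Function.injective_id

/-- The largest label is always a leaf. It can be a new root, or sit at any of the `(s + 1) * n - (n
- k) = s * n + k` free places, which leaves the number of roots unchanged. -/
theorem isTriangle_increasingForests (s : ℕ) :
    IsTriangle (fun n k => s * n + k) (fun _ _ => 1) (increasingForests (s + 1)) := by
  have key := isTriangle_of_insertion (α := fun n => Fin n → Option (Fin n × Fin (s + 1)))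
    (γ := fun n => Option (Fin n × Fin (s + 1)))
    (fun n => {p | (∀ v u s, p v = some (u, s) → u < v) ∧
      ∀ v w q, p v = some q → p w = some q → v = w})
    (fun n p => #{v : Fin n | p v = none})
    (fun n p => insertNone {q | ∀ v, p v ≠ some q})
    (fun n p c => forestInsert p c)
    (fun n k => s * n + k) (fun _ _ => 1) Fin.elim0
    (fun o => ⟨fun _ => Subsingleton.elim _ _, fun _ => ⟨fun v => v.elim0, fun v => v.elim0⟩⟩)
    rfl ?_ ?_ ?_ ?_ ?_ ?_
  · convert key using 3
    simp only [increasingForests, IsIncreasingForest, Set.mem_ofPred_eq, and_assoc]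
  · rintro n p ⟨h1, h2⟩ c hc
    simp only [mem_insertNone, mem_filter_univ, Option.mem_def] at hc
    constructor
    · intro v u t
      cases v using Fin.lastCases with
      | last =>
        simp only [forestInsert_last, Option.map_eq_some_iff, Prod.map, Prod.mk.injEq]
        rintro ⟨q, -, rfl, -⟩
        exact Fin.castSucc_lt_last _
      | cast v =>
        simp only [forestInsert_castSucc, Option.map_eq_some_iff, Prod.map, Prod.mk.injEq]
        rintro ⟨q, hq, rfl, -⟩
        exact Fin.castSucc_lt_castSucc_iff.2 (h1 v _ _ hq)
    · intro v w q hv hw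
      cases v using Fin.lastCases with
      | last =>
        cases w using Fin.lastCases with
        | last => rfl
        | cast w =>
          simp only [forestInsert_castSucc, forestInsert_last, Option.map_eq_some_iff] at hv hw
          obtain ⟨a, ha, rfl⟩ := hv
          obtain ⟨b, hb, hab⟩ := hw
          rw [castSucc_prodMap_injective hab] at hb
          exact absurd hb (hc a ha w)
      | cast v =>
        cases w using Fin.lastCases with
        | last =>
          simp only [forestInsert_castSucc, forestInsert_last, Option.map_eq_some_iff] at hv hw
          obtain ⟨a, ha, rfl⟩ := hw
          obtain ⟨b, hb, hab⟩ := hv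
          rw [castSucc_prodMap_injective hab] at hb
          exact absurd hb (hc a ha v)
        | cast w =>
          simp only [forestInsert_castSucc, Option.map_eq_some_iff] at hv hw
          obtain ⟨a, ha, rfl⟩ := hv
          obtain ⟨b, hb, hab⟩ := hw
          rw [castSucc_prodMap_injective hab] at hb
          rw [h2 v w a ha hb]
  · intro n p _ c _ p' _ c' _ h
    refine ⟨funext fun v => ?_, ?_⟩
    · have := congrFun h v.castSucc
      rw [forestInsert_castSucc, forestInsert_castSucc] at this
      exact Option.map_injective castSucc_prodMap_injective this
    · have := congrFun h (Fin.last n)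
      rw [forestInsert_last, forestInsert_last] at this
      exact Option.map_injective castSucc_prodMap_injective this
  · rintro n p' ⟨h1, h2⟩
    -- Labels increase, so the largest label is nobody's parent and every recorded place already
    -- exists among the smaller labels.
    have hlift : ∀ v, ∃ c : Option (Fin n × Fin (s + 1)),
        c.map (Prod.map Fin.castSucc id) = p' v := by
      intro v
      cases hv : p' v with
      | none => exact ⟨none, rfl⟩
      | some q =>
        have hne : q.1 ≠ Fin.last n := ((h1 v q.1 q.2 hv).trans_le (Fin.le_last v)).ne
        exact ⟨some (q.1.castPred hne, q.2), by simp⟩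
    choose g hg using hlift
    refine ⟨fun v => g v.castSucc, ⟨?_, ?_⟩, g (Fin.last n), ?_, ?_⟩
    · intro v u t hv
      beta_reduce at hv
      have := h1 v.castSucc u.castSucc t (by rw [← hg, hv]; rfl)
      exact Fin.castSucc_lt_castSucc_iff.1 this
    · intro v w q hv hw
      beta_reduce at hv hw
      exact Fin.castSucc_injective _ (h2 v.castSucc w.castSucc (Prod.map Fin.castSucc id q)
        (by rw [← hg, hv]; rfl) (by rw [← hg, hw]; rfl))
    · simp only [mem_insertNone, mem_filter_univ, Option.mem_def]
      intro q hq v hv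
      exact (Fin.castSucc_lt_last v).ne (h2 v.castSucc (Fin.last n) (Prod.map Fin.castSucc id q)
        (by rw [← hg, hv]; rfl) (by rw [← hg, hq]; rfl))
    · funext v
      cases v using Fin.lastCases with
      | last => rw [forestInsert_last, hg]
      | cast v => rw [forestInsert_castSucc, hg]
  · intro n p _ c _
    simp only [card_filter_fin_succ, forestInsert_castSucc, forestInsert_last,
      Option.map_eq_none_iff]
    split_ifs <;> simp
  · rintro n p ⟨-, h⟩
    have := card_free_places p h
    have h1 : {c ∈ insertNone {q | ∀ v, p v ≠ some q} |
        #{v | forestInsert p c v = none} = #{v | p v = none}} =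
        ({q | ∀ v, p v ≠ some q} : Finset _).map Function.Embedding.some := by
      ext c
      cases c <;> simp [card_filter_fin_succ]
    rw [h1, card_map]
    rw [add_one_mul] at this
    omega
  · rintro n p ⟨-, h⟩
    have := card_free_places p h
    rw [card_insertNone]
    rw [add_one_mul] at this
    omega

/-! ### Sequences of distinct elements -/

/-- Adding a last term `v` to a sequence of distinct elements; the term equal to `v`, if there is
one, becomes the largest element. -/
def embeddingInsert {n N : ℕ} (σ : Fin n ↪ Fin N) (v : Fin (N + 1)) : Fin (n + 1) ↪ Fin (N + 1) where
  toFun := Fin.snoc (α := fun _ => Fin (N + 1))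
    (fun i => Equiv.swap v (Fin.last N) (σ i).castSucc) v
  inj' := by
    intro i j
    cases i using Fin.lastCases with
    | last =>
      cases j using Fin.lastCases with
      | last => simp
      | cast j =>
        simp only [Fin.snoc_last, Fin.snoc_castSucc]
        intro h
        have h' := (Equiv.swap_apply_right v (Fin.last N)).trans h
        exact absurd ((Equiv.injective _) h') (Fin.castSucc_lt_last _).ne'
    | cast i =>
      cases j using Fin.lastCases with
      | last =>
        simp only [Fin.snoc_last, Fin.snoc_castSucc]
        intro h
        have h' := h.trans (Equiv.swap_apply_right v (Fin.last N)).symm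
        exact absurd ((Equiv.injective _) h') (Fin.castSucc_lt_last _).ne
      | cast j => simp

@[simp]
theorem embeddingInsert_castSucc {n N : ℕ} (σ : Fin n ↪ Fin N) (v : Fin (N + 1)) (i : Fin n) :
    embeddingInsert σ v i.castSucc = Equiv.swap v (Fin.last N) (σ i).castSucc :=
  Fin.snoc_castSucc (α := fun _ => Fin (N + 1)) v
    (fun i => Equiv.swap v (Fin.last N) (σ i).castSucc) i

@[simp]
theorem embeddingInsert_last {n N : ℕ} (σ : Fin n ↪ Fin N) (v : Fin (N + 1)) :
    embeddingInsert σ v (Fin.last n) = v :=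
  Fin.snoc_last (α := fun _ => Fin (N + 1)) v
    (fun i => Equiv.swap v (Fin.last N) (σ i).castSucc)

theorem embeddingInsert_injective {n N : ℕ} {σ σ' : Fin n ↪ Fin N} {v v' : Fin (N + 1)}
    (h : embeddingInsert σ v = embeddingInsert σ' v') : σ = σ' ∧ v = v' := by
  have hv : v = v' := by simpa using DFunLike.congr_fun h (Fin.last n)
  subst hv
  refine ⟨DFunLike.ext _ _ fun i => ?_, rfl⟩
  simpa using DFunLike.congr_fun h i.castSucc

/-- Swapping the last term with the largest value frees that value from the other terms; the swap is
its own inverse. -/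
theorem embeddingInsert_surjective {n N : ℕ} (τ : Fin (n + 1) ↪ Fin (N + 1)) :
    ∃ (σ : Fin n ↪ Fin N) (v : Fin (N + 1)), embeddingInsert σ v = τ := by
  have hne : ∀ i : Fin n, Equiv.swap (τ (Fin.last n)) (Fin.last N) (τ i.castSucc) ≠ Fin.last N := by
    intro i h
    rw [Equiv.swap_apply_eq_iff, Equiv.swap_apply_right, τ.injective.eq_iff] at h
    exact (Fin.castSucc_lt_last i).ne h
  refine ⟨⟨fun i => (Equiv.swap (τ (Fin.last n)) (Fin.last N) (τ i.castSucc)).castPred (hne i), ?_⟩,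
    τ (Fin.last n), ?_⟩
  · intro i j h
    simpa using h
  · ext i
    cases i using Fin.lastCases with
    | last => simp
    | cast i =>
      rw [embeddingInsert_castSucc]
      change (Equiv.swap (τ (Fin.last n)) (Fin.last N)
        ((Equiv.swap (τ (Fin.last n)) (Fin.last N) (τ i.castSucc)).castPred (hne i)).castSucc :
          ℕ) = _
      rw [Fin.castSucc_castPred, Equiv.swap_apply_self]

/-- The new term, at index `n`, is an excedance iff `n < v`. If `v = σ j`, then the term at `j`
becomes the largest value `N > j`, which is a gain iff `σ j ≤ j`. The two gains exclude each other,
since `σ j ≤ j` forces `v < n`. -/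
theorem excedances_embeddingInsert {n N : ℕ} (hnN : n ≤ N) (σ : Fin n ↪ Fin N) (v : Fin (N + 1)) :
    #{i : Fin (n + 1) | (i : ℕ) < embeddingInsert σ v i} = #{i : Fin n | (i : ℕ) < σ i} +
      if n < (v : ℕ) ∨ ∃ i : Fin n, (σ i : ℕ) ≤ i ∧ (σ i).castSucc = v then 1 else 0 := by
  rw [card_filter_fin_succ]
  simp only [embeddingInsert_castSucc, embeddingInsert_last, Fin.val_castSucc, Fin.val_last]
  by_cases h : ∃ i, (σ i).castSucc = v
  · obtain ⟨j, rfl⟩ := h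
    have hset : ({i : Fin n | (i : ℕ) < Equiv.swap (σ j).castSucc (Fin.last N) (σ i).castSucc} :
        Finset (Fin n)) = insert j ({i : Fin n | (i : ℕ) < σ i} : Finset (Fin n)) := by
      ext i
      rw [mem_insert, mem_filter_univ, mem_filter_univ]
      by_cases hij : i = j
      · subst hij
        simp only [Equiv.swap_apply_left, Fin.val_last, true_or, iff_true]
        omega
      · rw [Equiv.swap_apply_of_ne_of_ne (by simpa using hij) (Fin.castSucc_lt_last _).ne]
        simp [hij]
    rw [hset]
    have hex : (∃ i : Fin n, (σ i : ℕ) ≤ i ∧ (σ i).castSucc = (σ j).castSucc) ↔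
        (σ j : ℕ) ≤ j := by
      simp
    simp only [hex, Fin.val_castSucc]
    by_cases hj : (j : ℕ) < σ j
    · rw [insert_eq_of_mem (by simpa using hj)]
      simp [Nat.not_le.2 hj]
    · rw [card_insert_of_notMem (by simpa using hj)]
      have : ¬ n < (σ j : ℕ) := by omega
      simp [this, Nat.not_lt.1 hj]
  · have hset : ({i : Fin n | (i : ℕ) < Equiv.swap v (Fin.last N) (σ i).castSucc} :
        Finset (Fin n)) = ({i : Fin n | (i : ℕ) < σ i} : Finset (Fin n)) := by
      ext i
      rw [mem_filter_univ, mem_filter_univ, Equiv.swap_apply_of_ne_of_ne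
        (fun h' => h ⟨i, h'⟩) (Fin.castSucc_lt_last _).ne]
      rfl
    rw [hset]
    congr 2
    rw [eq_iff_iff]
    exact ⟨Or.inl, fun h' => h'.resolve_right fun ⟨i, hi⟩ => h ⟨i, hi.2⟩⟩

/-- The preserving values are the `n + 1` values `v ≤ n` without the values at non-excedances, which
are distinct and below `n`. -/
theorem card_excedance_preserving {n N : ℕ} (hnN : n ≤ N) (σ : Fin n ↪ Fin N) :
    #{v : Fin (N + 1) | ¬ (n < (v : ℕ) ∨ ∃ i : Fin n, (σ i : ℕ) ≤ i ∧ (σ i).castSucc = v)} =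
      #{i : Fin n | (i : ℕ) < σ i} + 1 := by
  have h1 : ({v : Fin (N + 1) | ¬ (n < (v : ℕ) ∨ ∃ i : Fin n, (σ i : ℕ) ≤ i ∧
      (σ i).castSucc = v)} : Finset _) = ({v : Fin (N + 1) | (v : ℕ) < n + 1} : Finset _) \
        ({i : Fin n | ¬ (i : ℕ) < σ i} : Finset _).image fun i => (σ i).castSucc := by
    ext v
    simp only [mem_filter_univ, mem_sdiff, mem_image, not_or, not_lt, Nat.lt_succ_iff]
  have h2 : #{v : Fin (N + 1) | (v : ℕ) < n + 1} = n + 1 := by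
    rw [Fin.card_filter_val_lt]
    omega
  have h3 : #(({i : Fin n | ¬ (i : ℕ) < σ i} : Finset _).image fun i => (σ i).castSucc) =
      #{i : Fin n | ¬ (i : ℕ) < σ i} :=
    card_image_of_injective _ ((Fin.castSucc_injective _).comp σ.injective)
  have h4 := card_filter_add_card_filter_not (s := (univ : Finset (Fin n)))
    (fun i => (i : ℕ) < σ i)
  rw [card_univ, Fintype.card_fin] at h4
  rw [h1, card_sdiff_of_subset, h2, h3]
  · omega
  · intro v
    simp only [mem_image, mem_filter_univ, forall_exists_index, and_imp]
    rintro i hi rfl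
    rw [Fin.val_castSucc]
    omega

theorem isTriangle_restrictedEulerian (r : ℕ) :
    IsTriangle (fun _ k => k + 1) (fun n k => n + r - k)
      (fun n k => restrictedEulerian r (n + r) k) := by
  -- The ambient size is written `r + n` so that `r + (n + 1)` is definitionally `(r + n) + 1`.
  have key := isTriangle_of_insertion (α := fun n => Fin n ↪ Fin (r + n))
    (γ := fun n => Fin (r + n + 1)) (fun n => Set.univ)
    (fun n σ => #{i : Fin n | (i : ℕ) < σ i}) (fun n σ => univ)
    (fun n σ v => embeddingInsert σ v) (fun _ k => k + 1) (fun n k => n + r - k)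
    ⟨Fin.elim0, fun i => i.elim0⟩ (fun o => ⟨fun _ => Subsingleton.elim _ _, fun _ => trivial⟩)
    rfl (fun n σ _ v _ => trivial) ?_ ?_ ?_ ?_ ?_
  · convert key using 3 with n k
    rw [add_comm n r, restrictedEulerian, Nat.add_sub_cancel_left]
    simp
  · intro n σ _ v _ σ' _ v' _ h
    exact embeddingInsert_injective h
  · intro n τ _
    obtain ⟨σ, v, h⟩ := embeddingInsert_surjective τ
    exact ⟨σ, trivial, v, mem_univ v, h⟩
  · intro n σ _ v _
    rw [excedances_embeddingInsert (Nat.le_add_left n r)]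
    split_ifs <;> simp
  · intro n σ _
    rw [← card_excedance_preserving (Nat.le_add_left n r)]
    congr 1
    apply filter_congr
    intro v _
    rw [excedances_embeddingInsert (Nat.le_add_left n r)]
    split_ifs with h <;> simp [h]
  · intro n σ _
    have : #{i : Fin n | (i : ℕ) < σ i} ≤ n := (card_le_univ _).trans_eq (Fintype.card_fin n)
    rw [card_univ, Fintype.card_fin]
    omega

end Gram

namespace Gram

open Finset

/-! ### Inserting a value into a permutation -/

/-- The permutation that sends `p` to `q` and is `π` on the remaining elements, up to the
order-preserving relabellings. -/
def permInsert {n : ℕ} (p q : Fin (n + 1)) (π : Equiv.Perm (Fin n)) : Equiv.Perm (Fin (n + 1)) :=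
  (finSuccEquiv' p).trans ((Equiv.optionCongr π).trans (finSuccEquiv' q).symm)

@[simp]
theorem permInsert_self {n : ℕ} (p q : Fin (n + 1)) (π : Equiv.Perm (Fin n)) :
    permInsert p q π p = q := by
  simp [permInsert]

@[simp]
theorem permInsert_succAbove {n : ℕ} (p q : Fin (n + 1)) (π : Equiv.Perm (Fin n)) (i : Fin n) :
    permInsert p q π (p.succAbove i) = q.succAbove (π i) := by
  simp [permInsert]

theorem permInsert_injective {n : ℕ} (p q : Fin (n + 1)) : Function.Injective (permInsert p q) := by
  intro π π' h
  ext1 i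
  simpa using DFunLike.congr_fun h (p.succAbove i)

/-- Relabelling source and target so that `p` and `q` become `none` gives a permutation of `Option
(Fin n)` that fixes `none`, hence comes from a permutation of `Fin n`. -/
theorem exists_permInsert_eq {n : ℕ} {p q : Fin (n + 1)} {τ : Equiv.Perm (Fin (n + 1))}
    (h : τ p = q) : ∃ π, permInsert p q π = τ := by
  refine ⟨Equiv.removeNone ((finSuccEquiv' p).symm.trans (τ.trans (finSuccEquiv' q))), ?_⟩
  rw [permInsert]
  have : Equiv.optionCongr (Equiv.removeNone
      ((finSuccEquiv' p).symm.trans (τ.trans (finSuccEquiv' q)))) =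
      (finSuccEquiv' p).symm.trans (τ.trans (finSuccEquiv' q)) := by
    set e := (finSuccEquiv' p).symm.trans (τ.trans (finSuccEquiv' q)) with he
    have hnone : e none = none := by simp [he, h]
    ext1 o
    cases o with
    | none => rw [hnone]; rfl
    | some x =>
      have hx : e (some x) ≠ none := fun hx => by simpa using e.injective (hx.trans hnone.symm)
      obtain ⟨y, hy⟩ := Option.ne_none_iff_exists'.1 hx
      exact Equiv.removeNone_some e ⟨y, hy⟩
  rw [this]
  ext1 i
  simp

/-! ### Cycles of permutations -/

/-- A function unchanged by one step of `π` descends to the set of cycles; the maps between cycle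
sets below are built this way. -/
theorem _root_.Equiv.Perm.SameCycle.apply_eq_of_invariant {α β : Type*} {π : Equiv.Perm α}
    {h : α → β} (hh : ∀ i, h (π i) = h i) {i j : α} (hij : π.SameCycle i j) : h i = h j := by
  obtain ⟨m, rfl⟩ := hij
  induction m using Int.induction_on generalizing i with
  | zero => rfl
  | succ m ih => rw [zpow_add, zpow_one, Equiv.Perm.mul_apply, ← ih, hh]
  | pred m ih =>
    rw [zpow_sub, zpow_one, Equiv.Perm.mul_apply, ← ih, ← hh (π⁻¹ i), ← Equiv.Perm.mul_apply,
      mul_inv_cancel, Equiv.Perm.one_apply]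

/-- Inserting the last element in front of `v` in the cycle of `v`, or as a fixed point. -/
def cycleInsert {n : ℕ} (π : Equiv.Perm (Fin n)) (v : Fin (n + 1)) : Equiv.Perm (Fin (n + 1)) :=
  Equiv.swap v (Fin.last n) * permInsert (Fin.last n) (Fin.last n) π

theorem cycleInsert_last {n : ℕ} (π : Equiv.Perm (Fin n)) (v : Fin (n + 1)) :
    cycleInsert π v (Fin.last n) = v := by
  simp [cycleInsert]

theorem cycleInsert_castSucc {n : ℕ} (π : Equiv.Perm (Fin n)) (v : Fin (n + 1)) (i : Fin n) :
    cycleInsert π v i.castSucc = Equiv.swap v (Fin.last n) (π i).castSucc := by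
  rw [cycleInsert, Equiv.Perm.mul_apply, ← Fin.succAbove_last, permInsert_succAbove]

/-- The number of cycles, fixed points included. -/
noncomputable def cycleCount {n : ℕ} (π : Equiv.Perm (Fin n)) : ℕ :=
  Nat.card (Quotient (Equiv.Perm.SameCycle.setoid π))

/-- The new element joins the cycle of `u`, and the other classes stay as they are. The inclusion of
the old elements and the map sending the new element to the class of `u` induce inverse bijections
of the cycle sets. -/
theorem cycleCount_cycleInsert_castSucc {n : ℕ} (π : Equiv.Perm (Fin n)) (u : Fin n) :
    cycleCount (cycleInsert π u.castSucc) = cycleCount π := by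
  have hl := cycleInsert_last π u.castSucc
  have hc := cycleInsert_castSucc π u.castSucc
  set π' := cycleInsert π u.castSucc
  let q : Fin n → Quotient (Equiv.Perm.SameCycle.setoid π) := Quotient.mk _
  let q' : Fin (n + 1) → Quotient (Equiv.Perm.SameCycle.setoid π') := Quotient.mk _
  have hq' : ∀ a, q' (π' a) = q' a := fun a =>
    Quotient.sound (Equiv.Perm.sameCycle_apply_left.2 (Equiv.Perm.SameCycle.refl _ _))
  have hq : ∀ a, q (π a) = q a := fun a =>
    Quotient.sound (Equiv.Perm.sameCycle_apply_left.2 (Equiv.Perm.SameCycle.refl _ _))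
  have hlast : q' (Fin.last n) = q' u.castSucc := by
    rw [← hq' (Fin.last n), hl]
  -- A step of `π` into `u` is now a detour through the new element, which lies in the cycle of `u`;
  -- all other steps are unchanged.
  have hstep : ∀ i : Fin n, q' (π i).castSucc = q' i.castSucc := by
    intro i
    rw [← hq' i.castSucc, hc]
    by_cases h : (π i).castSucc = u.castSucc
    · rw [h, Equiv.swap_apply_left, hlast]
    · rw [Equiv.swap_apply_of_ne_of_ne h (Fin.castSucc_lt_last _).ne]
  let g : Fin (n + 1) → Quotient (Equiv.Perm.SameCycle.setoid π) :=
    fun a => Fin.lastCases (q u) q a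
  have hgl : g (Fin.last n) = q u := by simp [g]
  have hgc : ∀ i : Fin n, g i.castSucc = q i := by simp [g]
  have hg : ∀ a, g (π' a) = g a := by
    intro a
    cases a using Fin.lastCases with
    | last => rw [hl, hgl, hgc]
    | cast i =>
      rw [hc]
      by_cases h : (π i).castSucc = u.castSucc
      · rw [h, Equiv.swap_apply_left, hgl, hgc, ← hq i, Fin.castSucc_injective _ h]
      · rw [Equiv.swap_apply_of_ne_of_ne h (Fin.castSucc_lt_last _).ne, hgc, hgc, hq]
  let F : Quotient (Equiv.Perm.SameCycle.setoid π') → Quotient (Equiv.Perm.SameCycle.setoid π) :=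
    Quotient.lift g fun a b hab => Equiv.Perm.SameCycle.apply_eq_of_invariant hg hab
  let F' : Quotient (Equiv.Perm.SameCycle.setoid π) → Quotient (Equiv.Perm.SameCycle.setoid π') :=
    Quotient.lift (fun i => q' i.castSucc) fun a b hab =>
      Equiv.Perm.SameCycle.apply_eq_of_invariant (π := π) (h := fun i => q' i.castSucc) hstep hab
  refine Nat.card_congr ⟨F, F', ?_, ?_⟩
  · intro c
    induction c using Quotient.inductionOn with
    | h a =>
      cases a using Fin.lastCases with
      | last =>
        change F' (g (Fin.last n)) = _
        rw [hgl]
        exact hlast.symm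
      | cast i =>
        change F' (g i.castSucc) = _
        rw [hgc]
        rfl
  · intro c
    induction c using Quotient.inductionOn with
    | h a => exact hgc a

/-- The new element is a fixed point, so the cycle set gains exactly one element, modelled by
`none`. -/
theorem cycleCount_cycleInsert_last {n : ℕ} (π : Equiv.Perm (Fin n)) :
    cycleCount (cycleInsert π (Fin.last n)) = cycleCount π + 1 := by
  have hl := cycleInsert_last π (Fin.last n)
  have hc := cycleInsert_castSucc π (Fin.last n)
  set π' := cycleInsert π (Fin.last n)
  let q : Fin n → Quotient (Equiv.Perm.SameCycle.setoid π) := Quotient.mk _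
  let q' : Fin (n + 1) → Quotient (Equiv.Perm.SameCycle.setoid π') := Quotient.mk _
  have hq' : ∀ a, q' (π' a) = q' a := fun a =>
    Quotient.sound (Equiv.Perm.sameCycle_apply_left.2 (Equiv.Perm.SameCycle.refl _ _))
  have hq : ∀ a, q (π a) = q a := fun a =>
    Quotient.sound (Equiv.Perm.sameCycle_apply_left.2 (Equiv.Perm.SameCycle.refl _ _))
  have hcast : ∀ i : Fin n, π' i.castSucc = (π i).castSucc := by
    intro i
    rw [hc, Equiv.swap_self, Equiv.refl_apply]
  have hstep : ∀ i : Fin n, q' (π i).castSucc = q' i.castSucc := by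
    intro i
    rw [← hq' i.castSucc, hcast]
  let g : Fin (n + 1) → Option (Quotient (Equiv.Perm.SameCycle.setoid π)) :=
    fun a => Fin.lastCases none (fun i => some (q i)) a
  have hgl : g (Fin.last n) = none := by simp [g]
  have hgc : ∀ i : Fin n, g i.castSucc = some (q i) := by simp [g]
  have hg : ∀ a, g (π' a) = g a := by
    intro a
    cases a using Fin.lastCases with
    | last => rw [hl]
    | cast i => rw [hcast, hgc, hgc, hq]
  let F : Quotient (Equiv.Perm.SameCycle.setoid π') →
      Option (Quotient (Equiv.Perm.SameCycle.setoid π)) :=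
    Quotient.lift g fun a b hab => Equiv.Perm.SameCycle.apply_eq_of_invariant hg hab
  let F' : Quotient (Equiv.Perm.SameCycle.setoid π) → Quotient (Equiv.Perm.SameCycle.setoid π') :=
    Quotient.lift (fun i => q' i.castSucc) fun a b hab =>
      Equiv.Perm.SameCycle.apply_eq_of_invariant (π := π) (h := fun i => q' i.castSucc) hstep hab
  rw [cycleCount, cycleCount, ← Finite.card_option]
  refine Nat.card_congr ⟨F, fun o => o.elim (q' (Fin.last n)) F', ?_, ?_⟩
  · intro c
    induction c using Quotient.inductionOn with
    | h a =>
      cases a using Fin.lastCases with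
      | last =>
        change Option.elim (g (Fin.last n)) _ F' = _
        rw [hgl]
        rfl
      | cast i =>
        change Option.elim (g i.castSucc) _ F' = _
        rw [hgc]
        rfl
  · intro c
    cases c with
    | none => exact hgl
    | some c =>
      induction c using Quotient.inductionOn with
      | h a => exact hgc a

theorem cycleCount_cycleInsert {n : ℕ} (π : Equiv.Perm (Fin n)) (v : Fin (n + 1)) :
    cycleCount (cycleInsert π v) = cycleCount π + if v = Fin.last n then 1 else 0 := by
  cases v using Fin.lastCases with
  | last => rw [cycleCount_cycleInsert_last, if_pos rfl]
  | cast u =>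
    rw [cycleCount_cycleInsert_castSucc, if_neg (Fin.castSucc_lt_last u).ne, add_zero]

theorem isTriangle_stirlingCycle : IsTriangle (fun n _ => n) (fun _ _ => 1) stirlingCycle := by
  have key := isTriangle_of_insertion (α := fun n => Equiv.Perm (Fin n))
    (γ := fun n => Fin (n + 1)) (fun n => Set.univ) (fun n π => cycleCount π) (fun n π => univ)
    (fun n π v => cycleInsert π v) (fun n _ => n) (fun _ _ => 1) 1
    (fun o => ⟨fun _ => Subsingleton.elim _ _, fun _ => trivial⟩)
    (by
      rw [cycleCount, Nat.card_eq_zero]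
      exact Or.inl ⟨fun c => Quotient.inductionOn c fun a => a.elim0⟩)
    (fun n σ _ v _ => trivial) ?_ ?_ ?_ ?_ ?_
  · convert key using 3 with n k
    simp only [stirlingCycle, cycleCount, Set.mem_univ, true_and]
  · intro n π _ v _ π' _ v' _ h
    have hv : v = v' := by
      rw [← cycleInsert_last π v, h, cycleInsert_last]
    subst hv
    exact ⟨permInsert_injective _ _ (mul_left_cancel h), rfl⟩
  · intro n τ _
    -- The place is the image of the last element; composing with the swap makes the last element
    -- fixed, and it can be deleted.
    obtain ⟨π, hπ⟩ := exists_permInsert_eq (p := Fin.last n) (q := Fin.last n)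
      (τ := Equiv.swap (τ (Fin.last n)) (Fin.last n) * τ) (by simp)
    refine ⟨π, trivial, τ (Fin.last n), mem_univ _, ?_⟩
    rw [cycleInsert, hπ, ← mul_assoc, Equiv.swap_mul_self, one_mul]
  · intro n π _ v _
    rw [cycleCount_cycleInsert]
    split_ifs <;> simp
  · intro n π _
    have : ({v | cycleCount (cycleInsert π v) = cycleCount π} : Finset (Fin (n + 1))) =
        univ.erase (Fin.last n) := by
      ext v
      simp [cycleCount_cycleInsert]
    rw [this, card_erase_of_mem (mem_univ _), card_univ, Fintype.card_fin, Nat.add_sub_cancel]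
  · intro n π _
    rw [card_univ, Fintype.card_fin]

end Gram

namespace Gram

open Finset

/-! ### Perfect matchings -/

/-- The map `f` sends every element to its partner in a perfect matching. -/
def IsPartnerMap {m : ℕ} (f : Fin m → Fin m) : Prop :=
  (∀ i, f (f i) = i) ∧ ∀ i, f i ≠ i

/-- The number of pairs with an odd smaller entry, where `i : Fin m` stands for `i + 1`. -/
def oddSmaller {m : ℕ} (f : Fin m → Fin m) : ℕ :=
  #{i : Fin m | i < f i ∧ Odd ((i : ℕ) + 1)}

/-- Adding a pair of two new elements. -/
def matchExtend {m : ℕ} (f : Fin m → Fin m) : Fin (m + 2) → Fin (m + 2) :=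
  Fin.snoc (α := fun _ => Fin (m + 2))
    (Fin.snoc (α := fun _ => Fin (m + 2)) (fun i => (f i).castSucc.castSucc) (Fin.last (m + 1)))
    (Fin.last m).castSucc

/-- Adding two new elements, the last of which is matched to `v`. -/
def matchInsert {m : ℕ} (f : Fin m → Fin m) (v : Fin (m + 1)) (i : Fin (m + 2)) : Fin (m + 2) :=
  Equiv.swap v.castSucc (Fin.last m).castSucc
    (matchExtend f (Equiv.swap v.castSucc (Fin.last m).castSucc i))

section

variable {m : ℕ} (f : Fin m → Fin m)

@[simp]
theorem matchExtend_last : matchExtend f (Fin.last (m + 1)) = (Fin.last m).castSucc := by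
  simp [matchExtend]

@[simp]
theorem matchExtend_castSucc_last :
    matchExtend f (Fin.last m).castSucc = Fin.last (m + 1) := by
  simp only [matchExtend, Fin.snoc_castSucc, Fin.snoc_last]

@[simp]
theorem matchExtend_castSucc_castSucc (i : Fin m) :
    matchExtend f i.castSucc.castSucc = (f i).castSucc.castSucc := by
  simp only [matchExtend, Fin.snoc_castSucc]

theorem matchInsert_last (v : Fin (m + 1)) :
    matchInsert f v (Fin.last (m + 1)) = v.castSucc := by
  rw [matchInsert, Equiv.swap_apply_of_ne_of_ne (Fin.castSucc_lt_last _).ne'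
    (Fin.castSucc_lt_last _).ne', matchExtend_last, Equiv.swap_apply_right]

theorem matchInsert_eq_matchExtend : matchInsert f (Fin.last m) = matchExtend f := by
  funext i
  simp [matchInsert]

theorem matchInsert_castSucc_last (u : Fin m) :
    matchInsert f u.castSucc (Fin.last m).castSucc =
      Equiv.swap u.castSucc.castSucc (Fin.last m).castSucc (f u).castSucc.castSucc := by
  rw [matchInsert, Equiv.swap_apply_right, matchExtend_castSucc_castSucc]

theorem matchInsert_self (u : Fin m) :
    matchInsert f u.castSucc u.castSucc.castSucc = Fin.last (m + 1) := by
  rw [matchInsert, Equiv.swap_apply_left, matchExtend_castSucc_last,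
    Equiv.swap_apply_of_ne_of_ne (Fin.castSucc_lt_last _).ne' (Fin.castSucc_lt_last _).ne']

theorem matchInsert_of_ne {u i : Fin m} (h : i ≠ u) :
    matchInsert f u.castSucc i.castSucc.castSucc =
      if f i = u then (Fin.last m).castSucc else (f i).castSucc.castSucc := by
  rw [matchInsert, Equiv.swap_apply_of_ne_of_ne (by simpa using h)
    (fun h' => (Fin.castSucc_lt_last i).ne (Fin.castSucc_injective _ h')),
    matchExtend_castSucc_castSucc]
  split_ifs with h'
  · rw [h', Equiv.swap_apply_left]
  · rw [Equiv.swap_apply_of_ne_of_ne (by simpa using h')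
      (fun h' => (Fin.castSucc_lt_last (f i)).ne (Fin.castSucc_injective _ h'))]

variable {f}

theorem IsPartnerMap.matchExtend (hf : IsPartnerMap f) : IsPartnerMap (matchExtend f) := by
  constructor
  · intro i
    cases i using Fin.lastCases with
    | last => simp
    | cast i =>
      cases i using Fin.lastCases with
      | last => simp
      | cast i => simp [hf.1]
  · intro i
    cases i using Fin.lastCases with
    | last =>
      rw [matchExtend_last]
      exact (Fin.castSucc_lt_last _).ne
    | cast i =>
      cases i using Fin.lastCases with
      | last =>
        rw [matchExtend_castSucc_last]
        exact (Fin.castSucc_lt_last _).ne'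
      | cast i => simpa using hf.2 i

theorem IsPartnerMap.conj (hf : IsPartnerMap f) (i j : Fin m) :
    IsPartnerMap fun a => Equiv.swap i j (f (Equiv.swap i j a)) := by
  constructor
  · intro a
    simp [hf.1]
  · intro a h
    rw [Equiv.swap_apply_eq_iff] at h
    exact hf.2 _ h

theorem IsPartnerMap.matchInsert (hf : IsPartnerMap f) (v : Fin (m + 1)) :
    IsPartnerMap (matchInsert f v) :=
  hf.matchExtend.conj _ _

theorem matchInsert_injective {g : Fin m → Fin m} {v w : Fin (m + 1)}
    (h : matchInsert f v = matchInsert g w) : f = g ∧ v = w := by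
  have hv : v = w := by
    have := congrFun h (Fin.last (m + 1))
    rw [matchInsert_last, matchInsert_last] at this
    exact Fin.castSucc_injective _ this
  subst hv
  refine ⟨funext fun i => ?_, rfl⟩
  have := congrFun h (Equiv.swap v.castSucc (Fin.last m).castSucc i.castSucc.castSucc)
  simpa [matchInsert] using this

/-- Take `v` to be the partner of the last element. Conjugation by the swap of `v` with the
penultimate element pairs the last two elements with each other, so the rest is a perfect matching.
-/
theorem exists_matchInsert_eq {g : Fin (m + 2) → Fin (m + 2)} (hg : IsPartnerMap g) :
    ∃ f, IsPartnerMap f ∧ ∃ v, matchInsert f v = g := by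
  set v := (g (Fin.last (m + 1))).castPred (hg.2 _) with hv
  have hv' : v.castSucc = g (Fin.last (m + 1)) := by simp [hv]
  have hs := hg.conj v.castSucc (Fin.last m).castSucc
  set g' := fun a => Equiv.swap v.castSucc (Fin.last m).castSucc
    (g (Equiv.swap v.castSucc (Fin.last m).castSucc a)) with hg'
  have hlast : g' (Fin.last (m + 1)) = (Fin.last m).castSucc := by
    simp only [hg']
    rw [Equiv.swap_apply_of_ne_of_ne (Fin.castSucc_lt_last _).ne' (Fin.castSucc_lt_last _).ne',
      ← hv', Equiv.swap_apply_left]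
  have hlast' : g' (Fin.last m).castSucc = Fin.last (m + 1) := by
    rw [← hlast, hs.1]
  have hex : ∀ i : Fin m, ∃ j : Fin m, j.castSucc.castSucc = g' i.castSucc.castSucc := by
    intro i
    have h1 : g' i.castSucc.castSucc ≠ Fin.last (m + 1) := by
      intro h
      have := congrArg g' h
      rw [hs.1, hlast] at this
      exact (Fin.castSucc_lt_last i).ne (Fin.castSucc_injective _ this)
    have h2 : (g' i.castSucc.castSucc).castPred h1 ≠ Fin.last m := by
      intro h
      have h3 := congrArg Fin.castSucc h
      rw [Fin.castSucc_castPred] at h3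
      have := congrArg g' h3
      rw [hs.1, hlast'] at this
      exact (Fin.castSucc_lt_last _).ne this
    exact ⟨Fin.castPred _ h2, by simp⟩
  choose f hf using hex
  have hfg : Gram.matchExtend f = g' := by
    funext i
    cases i using Fin.lastCases with
    | last => rw [matchExtend_last, hlast]
    | cast i =>
      cases i using Fin.lastCases with
      | last => rw [matchExtend_castSucc_last, hlast']
      | cast i => rw [matchExtend_castSucc_castSucc, hf]
  refine ⟨f, ⟨fun i => ?_, fun i h => ?_⟩, v, ?_⟩
  · have := hs.1 i.castSucc.castSucc
    rw [← hf, ← hf] at this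
    simpa using this
  · apply hs.2 i.castSucc.castSucc
    rw [← hf, h]
  · funext i
    simp [Gram.matchInsert, hfg, hg']

/-! ### Odd smaller entries under insertion -/

theorem oddSmaller_matchExtend (hm : Even m) :
    oddSmaller (matchExtend f) = oddSmaller f + 1 := by
  rw [oddSmaller, card_filter_fin_succ, card_filter_fin_succ]
  simp only [matchExtend_last, matchExtend_castSucc_last, matchExtend_castSucc_castSucc]
  rw [if_pos ⟨Fin.castSucc_lt_last _, by simpa using hm.add_one⟩,
    if_neg (fun h => absurd h.1 (Fin.castSucc_lt_last _).not_gt)]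
  rfl

/-- The pair `{u, f u}` is broken up and each of its members is paired with a new, larger element.
So the larger member becomes a smaller entry too, and this counts iff it is odd. -/
theorem oddSmaller_matchInsert_castSucc (hf : IsPartnerMap f) (u : Fin m) :
    oddSmaller (matchInsert f u.castSucc) =
      oddSmaller f + if Odd (((max u (f u) : Fin m) : ℕ) + 1) then 1 else 0 := by
  have hfu : (f u).castSucc.castSucc ≠ u.castSucc.castSucc := by simpa using hf.2 u
  have hfu' : (f u).castSucc.castSucc ≠ (Fin.last m).castSucc :=
    fun h => (Fin.castSucc_lt_last (f u)).ne (Fin.castSucc_injective _ h)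
  rw [oddSmaller, card_filter_fin_succ, card_filter_fin_succ, matchInsert_last,
    matchInsert_castSucc_last, Equiv.swap_apply_of_ne_of_ne hfu hfu']
  have hA : ¬ Fin.last (m + 1) < u.castSucc.castSucc := (Fin.castSucc_lt_last _).not_gt
  have hB : ¬ (Fin.last m).castSucc < (f u).castSucc.castSucc :=
    (Fin.castSucc_lt_castSucc_iff.2 (Fin.castSucc_lt_last _)).not_gt
  simp only [hA, hB, false_and, if_false, add_zero]
  have hmem : ∀ i : Fin m, (i.castSucc.castSucc < matchInsert f u.castSucc i.castSucc.castSucc ∧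
      Odd ((i.castSucc.castSucc : ℕ) + 1)) ↔
      (i < f i ∧ Odd ((i : ℕ) + 1)) ∨ (i = max u (f u) ∧ Odd ((i : ℕ) + 1)) := by
    intro i
    rw [← or_and_right, Fin.val_castSucc, Fin.val_castSucc]
    apply and_congr_left
    intro _
    by_cases hiu : i = u
    · subst hiu
      rw [matchInsert_self]
      simp only [Fin.castSucc_lt_last, true_iff]
      rcases lt_or_gt_of_ne (hf.2 i) with h | h
      · exact Or.inr (max_eq_left h.le).symm
      · exact Or.inl h
    · rw [matchInsert_of_ne f hiu]
      split_ifs with h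
      · simp only [Fin.castSucc_lt_castSucc_iff, Fin.castSucc_lt_last, true_iff]
        have hi : f u = i := by rw [← h, hf.1]
        rw [h, hi]
        rcases lt_or_gt_of_ne hiu with h' | h'
        · exact Or.inl h'
        · exact Or.inr (max_eq_right h'.le).symm
      · simp only [Fin.castSucc_lt_castSucc_iff]
        refine ⟨Or.inl, fun h' => h'.resolve_right fun h'' => ?_⟩
        rcases max_choice u (f u) with h3 | h3
        · exact hiu (h''.trans h3)
        · exact h (by rw [h'', h3, hf.1])
  have hnot : ¬ max u (f u) < f (max u (f u)) := by
    rcases max_choice u (f u) with h3 | h3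
    · rw [h3]; exact not_lt.2 (max_eq_left_iff.1 h3)
    · rw [h3, hf.1]; exact not_lt.2 (max_eq_right_iff.1 h3)
  simp only [hmem]
  split_ifs with h
  · rw [oddSmaller, ← card_insert_of_notMem (a := max u (f u)) (by simp [hnot])]
    congr 1
    ext i
    simp only [mem_filter_univ, mem_insert]
    constructor
    · rintro (h' | h')
      · exact Or.inr h'
      · exact Or.inl h'.1
    · rintro (h' | h')
      · exact Or.inr ⟨h', h' ▸ h⟩
      · exact Or.inl h'
  · rw [oddSmaller, add_zero]
    congr 1
    apply filter_congr
    intro i _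
    refine ⟨fun h' => h'.resolve_right fun h'' => h (h''.1 ▸ h''.2), Or.inl⟩

theorem card_odd_fin (n : ℕ) : #{i : Fin (2 * n) | Odd ((i : ℕ) + 1)} = n := by
  induction n with
  | zero => rfl
  | succ n ih =>
    change #{i : Fin (2 * n + 1 + 1) | Odd ((i : ℕ) + 1)} = n + 1
    rw [card_filter_fin_succ, card_filter_fin_succ]
    simp only [Fin.val_castSucc, Fin.val_last]
    rw [ih, if_pos (by simp), if_neg (by simp [parity_simps])]

theorem IsPartnerMap.card_filter_comp (hf : IsPartnerMap f) (p : Fin m → Prop) [DecidablePred p] :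
    #{i | p (f i)} = #{i | p i} :=
  card_bij' (fun i _ => f i) (fun i _ => f i) (by simp) (by simp [hf.1]) (fun i _ => hf.1 i)
    (fun i _ => hf.1 i)

/-- There are `n` pairs and `n` odd entries. Hence the pairs with even larger entry and the odd
smaller entries are both `n` minus the number of odd larger entries; each such pair has two members
`u`. -/
theorem card_even_larger {n : ℕ} {f : Fin (2 * n) → Fin (2 * n)} (hf : IsPartnerMap f) :
    #{u | ¬ Odd (((max u (f u) : Fin (2 * n)) : ℕ) + 1)} = 2 * oddSmaller f := by
  have hsplit : ∀ (p q : Fin (2 * n) → Prop) [DecidablePred p] [DecidablePred q],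
      #{i | p i} = #{i | p i ∧ q i} + #{i | p i ∧ ¬ q i} := by
    intro p q _ _
    rw [← card_filter_add_card_filter_not (s := {i | p i}) q, filter_filter, filter_filter]
  have hgt : ∀ i, ¬ i < f i ↔ f i < i := fun i =>
    ⟨fun h => lt_of_le_of_ne (not_lt.1 h) (hf.2 i), fun h => h.not_gt⟩
  have h1 := hsplit (fun _ => True) (fun i => i < f i)
  have h2 := hsplit (fun i => f i < i) (fun i => Odd ((i : ℕ) + 1))
  have h3 := hsplit (fun i => Odd ((i : ℕ) + 1)) (fun i => i < f i)
  have h4 := hsplit (fun u => ¬ Odd (((max u (f u) : Fin (2 * n)) : ℕ) + 1)) (fun i => i < f i)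
  have h5 := hf.card_filter_comp (fun i => f i < i)
  have h6 := hf.card_filter_comp (fun i => f i < i ∧ ¬ Odd ((i : ℕ) + 1))
  simp only [hgt, hf.1, true_and, card_odd_fin, filter_true, card_univ, Fintype.card_fin] at *
  have h7 : #{i | ¬ Odd (((max i (f i) : Fin (2 * n)) : ℕ) + 1) ∧ i < f i} =
      #{i | i < f i ∧ ¬ Odd ((f i : ℕ) + 1)} := by
    congr 1
    ext i
    simp only [mem_filter_univ]
    rw [and_comm]
    apply and_congr_right
    intro h
    rw [max_eq_right h.le]
  have h8 : #{i | ¬ Odd (((max i (f i) : Fin (2 * n)) : ℕ) + 1) ∧ f i < i} =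
      #{i | f i < i ∧ ¬ Odd ((i : ℕ) + 1)} := by
    congr 1
    ext i
    simp only [mem_filter_univ]
    rw [and_comm]
    apply and_congr_right
    intro h
    rw [max_eq_left h.le]
  have h9 : #{i : Fin (2 * n) | Odd ((i : ℕ) + 1) ∧ i < f i} = oddSmaller f := by
    simp only [oddSmaller, and_comm]
  have h10 : #{i : Fin (2 * n) | Odd ((i : ℕ) + 1) ∧ f i < i} = #{i | f i < i ∧ Odd ((i : ℕ) + 1)} := by
    simp only [and_comm]
  omega

theorem oddSmaller_le {n : ℕ} (f : Fin (2 * n) → Fin (2 * n)) : oddSmaller f ≤ n := by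
  rw [oddSmaller]
  conv_rhs => rw [← card_odd_fin n]
  exact card_le_card fun i => by simp +contextual

end

theorem isTriangle_oddMatchings :
    IsTriangle (fun _ k => 2 * k) (fun n k => 2 * (n - k) + 1) oddMatchings := by
  have hm : ∀ n : ℕ, Even (2 * n) := fun n => even_two_mul n
  have key := isTriangle_of_insertion (α := fun n => Fin (2 * n) → Fin (2 * n))
    (γ := fun n => Fin (2 * n + 1)) (fun n => {f | IsPartnerMap f}) (fun n f => oddSmaller f)
    (fun n f => univ) (fun n f v => matchInsert f v) (fun _ k => 2 * k)
    (fun n k => 2 * (n - k) + 1) Fin.elim0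
    (fun o => ⟨fun _ => funext fun v => v.elim0, fun _ => ⟨fun v => v.elim0, fun v => v.elim0⟩⟩)
    rfl (fun n f hf v _ => IsPartnerMap.matchInsert hf v)
    (fun n f _ v _ g _ w _ h => matchInsert_injective h) ?_ ?_ ?_ ?_
  · convert key using 3
    simp only [oddMatchings, IsPartnerMap, oddSmaller, Set.mem_ofPred_eq, and_assoc]
  · intro n g hg
    obtain ⟨f, hf, v, h⟩ := exists_matchInsert_eq (m := 2 * n) hg
    exact ⟨f, hf, v, mem_univ v, h⟩
  · intro n f hf v _
    -- `2 * (n + 1)` is definitionally `2 * n + 2`, the size for which the insertion lemmas are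
    -- stated.
    change oddSmaller (m := 2 * n + 2) (matchInsert f v) = _ ∨
      oddSmaller (m := 2 * n + 2) (matchInsert f v) = _
    cases v using Fin.lastCases with
    | last =>
      rw [matchInsert_eq_matchExtend, oddSmaller_matchExtend (hm n)]
      exact Or.inr rfl
    | cast u =>
      rw [oddSmaller_matchInsert_castSucc hf]
      split_ifs <;> simp
  · intro n f hf
    change #{v | oddSmaller (m := 2 * n + 2) (matchInsert f v) = _} = _
    rw [card_filter_fin_succ, matchInsert_eq_matchExtend, oddSmaller_matchExtend (hm n),
      if_neg (by omega), add_zero, ← card_even_larger hf]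
    congr 1
    apply filter_congr
    intro u _
    rw [oddSmaller_matchInsert_castSucc hf]
    split_ifs with h
    · exact iff_of_false (by omega) (not_not.2 h)
    · exact iff_of_true (add_zero _) h
  · intro n f hf
    have := oddSmaller_le f
    rw [card_univ, Fintype.card_fin]
    omega

end Gram

namespace Gram

open Finset

/-! ### Descents of words -/

/-- The number of descents of the word `w 0, …, w n`. -/
def wordDescents (w : ℕ → ℤ) (n : ℕ) : ℕ :=
  #{i ∈ range n | w (i + 1) < w i}

/-- The word obtained by inserting `z` after the letter with index `p`. -/
def wordInsert (w : ℕ → ℤ) (p : ℕ) (z : ℤ) (i : ℕ) : ℤ :=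
  if i ≤ p then w i else if i = p + 1 then z else w (i - 1)

theorem wordDescents_congr {w w' : ℕ → ℤ} {n : ℕ} (h : ∀ i ≤ n, w i = w' i) :
    wordDescents w n = wordDescents w' n := by
  rw [wordDescents, wordDescents]
  congr 1
  apply filter_congr
  intro i hi
  rw [mem_range] at hi
  rw [h i hi.le, h (i + 1) hi]

/-- Only the step from `w p` to `w (p + 1)` is replaced, by the two steps through `z`; for `p = n`
there is no right neighbour. The lost descent is added on the left to avoid subtraction. -/
theorem wordDescents_insert (w : ℕ → ℤ) {n p : ℕ} (hp : p ≤ n) (z : ℤ) :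
    wordDescents (wordInsert w p z) (n + 1) + (if p < n ∧ w (p + 1) < w p then 1 else 0) =
      wordDescents w n + (if z < w p then 1 else 0) +
        if p < n ∧ w (p + 1) < z then 1 else 0 := by
  obtain ⟨q, rfl⟩ := Nat.exists_eq_add_of_le hp
  simp only [wordDescents, card_filter]
  rw [add_assoc p q 1, sum_range_add _ p (q + 1), sum_range_add _ p q, sum_range_succ']
  have h1 : ∑ i ∈ range p, (if wordInsert w p z (i + 1) < wordInsert w p z i then 1 else 0) =
      ∑ i ∈ range p, if w (i + 1) < w i then 1 else 0 := by
    refine sum_congr rfl fun i hi => ?_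
    rw [mem_range] at hi
    simp [wordInsert, hi.le, Nat.succ_le_iff.2 hi]
  have h2 : wordInsert w p z (p + 0 + 1) = z := by simp [wordInsert]
  have h3 : wordInsert w p z (p + 0) = w p := by simp [wordInsert]
  have h4 : ∀ i, wordInsert w p z (p + (i + 1) + 1) = w (p + i + 1) := by
    intro i
    simp only [wordInsert]
    rw [if_neg (by omega), if_neg (by omega)]
    congr 1
  rw [h1, h2, h3]
  simp only [h4]
  cases q with
  | zero => simp
  | succ q =>
    rw [sum_range_succ', sum_range_succ']
    have h5 : wordInsert w p z (p + (0 + 1)) = z := by simp [wordInsert]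
    have h6 : ∀ i, wordInsert w p z (p + (i + 1 + 1)) = w (p + (i + 1)) := h4
    rw [h5]
    simp only [h6, add_zero]
    have : p < p + (q + 1) := by omega
    simp only [this, true_and]
    ring

/-- A largest letter has a descent on its right and none on its left, so nothing is gained at the
end of the word or inside an old descent. -/
theorem wordDescents_insert_top (w : ℕ → ℤ) {n p : ℕ} (hp : p ≤ n) {z : ℤ}
    (hz : ∀ i ≤ n, w i < z) :
    wordDescents (wordInsert w p z) (n + 1) =
      wordDescents w n + if p < n ∧ ¬ w (p + 1) < w p then 1 else 0 := by
  have h := wordDescents_insert w hp z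
  rw [if_neg (hz p hp).not_gt] at h
  by_cases hn : p < n
  · simp only [hn, hz (p + 1) hn, true_and, if_true] at h ⊢
    split_ifs at h ⊢ <;> omega
  · simp only [hn, false_and, if_false] at h ⊢
    omega

/-- A least letter has a descent on its left and none on its right, so only a place inside an old
descent preserves the number. -/
theorem wordDescents_insert_bot (w : ℕ → ℤ) {n p : ℕ} (hp : p ≤ n) {z : ℤ}
    (hz : ∀ i ≤ n, z < w i) :
    wordDescents (wordInsert w p z) (n + 1) =
      wordDescents w n + if p < n ∧ w (p + 1) < w p then 0 else 1 := by
  have h := wordDescents_insert w hp z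
  rw [if_pos (hz p hp)] at h
  by_cases hn : p < n
  · simp only [hn, (hz (p + 1) hn).not_gt, true_and, if_false] at h ⊢
    split_ifs at h ⊢ <;> omega
  · simp only [hn, false_and, if_false] at h ⊢
    omega

theorem wordDescents_le (w : ℕ → ℤ) (n : ℕ) : wordDescents w n ≤ n :=
  (card_filter_le _ _).trans_eq (card_range n)

theorem card_bot_preserving (w : ℕ → ℤ) (n : ℕ) :
    #{p : Fin (n + 1) | (p : ℕ) < n ∧ w (p + 1) < w p} = wordDescents w n := by
  rw [card_filter, Fin.sum_univ_eq_sum_range (fun p => if p < n ∧ w (p + 1) < w p then 1 else 0),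
    sum_range_succ, wordDescents, card_filter]
  simp only [lt_irrefl, false_and, if_false, add_zero]
  refine sum_congr rfl fun p hp => ?_
  simp [mem_range.1 hp]

theorem card_top_preserving (w : ℕ → ℤ) (n : ℕ) :
    #{p : Fin (n + 1) | ¬ ((p : ℕ) < n ∧ ¬ w (p + 1) < w p)} = wordDescents w n + 1 := by
  rw [card_filter,
    Fin.sum_univ_eq_sum_range (fun p => if ¬ (p < n ∧ ¬ w (p + 1) < w p) then 1 else 0),
    sum_range_succ, wordDescents, card_filter]
  simp only [lt_irrefl, false_and, not_false_eq_true, if_true]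
  congr 1
  refine sum_congr rfl fun p hp => ?_
  simp [mem_range.1 hp]

/-! ### Descents of permutations -/

/-- The values of a permutation as a word with the letters `1, …, n`, preceded by `0`. -/
def permWord {n : ℕ} (π : Equiv.Perm (Fin n)) : ℕ → ℤ
  | 0 => 0
  | i + 1 => if h : i < n then (π ⟨i, h⟩ : ℕ) + 1 else 0

theorem permWord_succ {n : ℕ} (π : Equiv.Perm (Fin n)) (i : ℕ) :
    permWord π (i + 1) = if h : i < n then ((π ⟨i, h⟩ : ℕ) + 1 : ℤ) else 0 :=
  rfl

theorem permWord_lt {n : ℕ} (π : Equiv.Perm (Fin n)) (i : ℕ) : permWord π i < n + 1 := by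
  cases i with
  | zero => (simp only [permWord]; omega)
  | succ i =>
    simp only [permWord]
    split_ifs with h
    · have := (π ⟨i, h⟩).isLt
      omega
    · omega

/-- The leading `0` is below all letters and creates no descent; it turns insertion at the front
into insertion after index `0`. -/
theorem descents_eq_wordDescents {n : ℕ} (π : Equiv.Perm (Fin n)) :
    descents π = wordDescents (permWord π) n := by
  rw [descents, wordDescents]
  refine card_bij (fun i _ => (i : ℕ) + 1) ?_ ?_ ?_
  · intro i hi
    simp only [mem_filter_univ] at hi
    obtain ⟨j, hj, hlt⟩ := hi
    have hjn := j.isLt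
    rw [mem_filter, mem_range]
    refine ⟨by omega, ?_⟩
    simp only [permWord]
    rw [dif_pos (by omega), dif_pos i.isLt]
    have : (⟨(i : ℕ) + 1, by omega⟩ : Fin n) = j := Fin.ext hj.symm
    rw [this]
    simpa using hlt
  · intro i _ j _ h
    exact Fin.ext (by simpa using h)
  · intro b hb
    rw [mem_filter, mem_range] at hb
    obtain ⟨hb, hlt⟩ := hb
    cases b with
    | zero =>
      simp only [permWord] at hlt
      split_ifs at hlt
      omega
    | succ b =>
      refine ⟨⟨b, by omega⟩, ?_, rfl⟩
      rw [mem_filter_univ]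
      refine ⟨⟨b + 1, hb⟩, rfl, ?_⟩
      simp only [permWord] at hlt
      rw [dif_pos hb, dif_pos (by omega)] at hlt
      simpa using hlt

theorem permWord_permInsert {n : ℕ} (π : Equiv.Perm (Fin n)) (p : Fin (n + 1)) {i : ℕ}
    (hi : i ≤ n + 1) :
    permWord (permInsert p (Fin.last n) π) i = wordInsert (permWord π) p (n + 1) i := by
  cases i with
  | zero => simp [permWord, wordInsert]
  | succ j =>
    have hj : j < n + 1 := hi
    rw [permWord_succ, dif_pos hj, wordInsert]
    rcases lt_trichotomy j p with h | h | h
    · have hjn : j < n := by omega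
      have : (⟨j, hj⟩ : Fin (n + 1)) = p.succAbove ⟨j, hjn⟩ := by
        rw [Fin.succAbove_of_castSucc_lt]
        · rfl
        · exact h
      rw [this, permInsert_succAbove, if_pos (show j + 1 ≤ (p : ℕ) from h), permWord_succ,
        dif_pos hjn, Fin.succAbove_last]
      rfl
    · have : (⟨j, hj⟩ : Fin (n + 1)) = p := Fin.ext h
      rw [this, permInsert_self, if_neg (by omega), if_pos (by omega)]
      rfl
    · obtain ⟨j, rfl⟩ := Nat.exists_eq_add_of_le' (Nat.zero_lt_of_lt h)
      have hjn : j < n := by omega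
      have : (⟨j + 1, hj⟩ : Fin (n + 1)) = p.succAbove ⟨j, hjn⟩ := by
        rw [Fin.succAbove_of_le_castSucc]
        · rfl
        · exact Fin.le_def.2 (Nat.lt_succ_iff.1 h)
      rw [this, permInsert_succAbove, if_neg (by omega), if_neg (by omega),
        Nat.add_sub_cancel, Fin.succAbove_last, permWord_succ, dif_pos hjn]
      rfl

theorem descents_permInsert {n : ℕ} (π : Equiv.Perm (Fin n)) (p : Fin (n + 1)) :
    descents (permInsert p (Fin.last n) π) =
      descents π + if (p : ℕ) < n ∧ ¬ permWord π (p + 1) < permWord π p then 1 else 0 := by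
  rw [descents_eq_wordDescents, descents_eq_wordDescents,
    wordDescents_congr fun i hi => permWord_permInsert π p hi,
    wordDescents_insert_top _ (Nat.lt_succ_iff.1 p.isLt) fun i _ => permWord_lt π i]

theorem isTriangle_eulerian : IsTriangle (fun _ k => k + 1) (fun n k => n - k) eulerian := by
  have key := isTriangle_of_insertion (α := fun n => Equiv.Perm (Fin n))
    (γ := fun n => Fin (n + 1)) (fun n => Set.univ) (fun n π => descents π) (fun n π => univ)
    (fun n π p => permInsert p (Fin.last n) π) (fun _ k => k + 1) (fun n k => n - k) 1
    (fun o => ⟨fun _ => Subsingleton.elim _ _, fun _ => trivial⟩)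
    rfl (fun n π _ v _ => trivial) ?_ ?_ ?_ ?_ ?_
  · convert key using 3 with n k
    simp only [eulerian, Set.mem_univ, true_and]
  · intro n π _ p _ π' _ p' _ h
    have hp : p = p' := by
      have := permInsert_self p (Fin.last n) π
      rw [h] at this
      exact Equiv.injective _ (this.trans (permInsert_self p' (Fin.last n) π').symm)
    subst hp
    exact ⟨permInsert_injective _ _ h, rfl⟩
  · intro n τ _
    obtain ⟨π, hπ⟩ := exists_permInsert_eq (τ.apply_symm_apply (Fin.last n))
    exact ⟨π, trivial, _, mem_univ _, hπ⟩
  · intro n π _ p _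
    rw [descents_permInsert]
    split_ifs <;> simp
  · intro n π _
    have h := card_top_preserving (permWord π) n
    rw [← descents_eq_wordDescents] at h
    rw [← h]
    congr 1
    apply filter_congr
    intro p _
    rw [descents_permInsert]
    split_ifs with h
    · exact iff_of_false (by omega) (not_not.2 h)
    · exact iff_of_true (add_zero _) h
  · intro n π _
    have := wordDescents_le (permWord π) n
    rw [← descents_eq_wordDescents] at this
    rw [card_univ, Fintype.card_fin]
    omega

/-! ### Descents of signed permutations -/

theorem descentsB_eq_wordDescents (n : ℕ) (π : Equiv.Perm ℤ) :
    descentsB n π = wordDescents (fun i => π i) n := by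
  rw [descentsB, wordDescents]
  symm
  refine card_bij (fun i _ => (i : ℤ) + 1) ?_ ?_ ?_
  · intro i hi
    rw [mem_filter, mem_range] at hi
    rw [mem_filter, mem_Icc, add_sub_cancel_right]
    refine ⟨by omega, ?_⟩
    simpa using hi.2
  · intro i _ j _ h
    omega
  · intro b hb
    rw [mem_filter, mem_Icc] at hb
    refine ⟨(b - 1).toNat, ?_, by omega⟩
    rw [mem_filter, mem_range]
    refine ⟨by omega, ?_⟩
    rw [show (((b - 1).toNat + 1 : ℕ) : ℤ) = b by omega,
      show (((b - 1).toNat : ℕ) : ℤ) = b - 1 by omega]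
    exact hb.2

/-- The value `n + 1` or `-(n + 1)`. -/
def signedTop (n : ℕ) (b : Bool) : ℤ :=
  if b then n + 1 else -(n + 1)

/-- The signed permutation that sends `p + 1` to `± (n + 1)` and maps the other elements of
`{1, …, n + 1}` to `{1, …, n}` in an order-preserving way. -/
noncomputable def signedCycle (n : ℕ) (c : Fin (n + 1) × Bool) : Equiv.Perm ℤ where
  toFun i := if i = c.1 + 1 then signedTop n c.2 else if i = -(c.1 + 1) then -signedTop n c.2
    else if (c.1 : ℤ) + 1 < i ∧ i ≤ n + 1 then i - 1
    else if -(n + 1 : ℤ) ≤ i ∧ i < -(c.1 + 1) then i + 1 else i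
  invFun j := if j = signedTop n c.2 then c.1 + 1 else if j = -signedTop n c.2 then -(c.1 + 1)
    else if (c.1 : ℤ) + 1 ≤ j ∧ j ≤ n then j + 1
    else if -(n : ℤ) ≤ j ∧ j ≤ -(c.1 + 1) then j - 1 else j
  left_inv := by
    intro i
    obtain ⟨⟨p, hp⟩, b⟩ := c
    cases b <;> simp only [signedTop, if_true, Bool.false_eq_true, if_false] <;>
      split_ifs <;> omega
  right_inv := by
    intro i
    obtain ⟨⟨p, hp⟩, b⟩ := c
    cases b <;> simp only [signedTop, if_true, Bool.false_eq_true, if_false] <;>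
      split_ifs <;> omega

theorem signedCycle_apply (n : ℕ) (c : Fin (n + 1) × Bool) (i : ℤ) :
    signedCycle n c i =
      if i = c.1 + 1 then signedTop n c.2 else if i = -(c.1 + 1) then -signedTop n c.2
      else if (c.1 : ℤ) + 1 < i ∧ i ≤ n + 1 then i - 1
      else if -(n + 1 : ℤ) ≤ i ∧ i < -(c.1 + 1) then i + 1 else i :=
  rfl

theorem signedCycle_neg (n : ℕ) (c : Fin (n + 1) × Bool) (i : ℤ) :
    signedCycle n c (-i) = -signedCycle n c i := by
  simp only [signedCycle_apply]
  split_ifs <;> omega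

theorem signedCycle_of_lt (n : ℕ) (c : Fin (n + 1) × Bool) {i : ℤ} (hi : (n : ℤ) + 1 < |i|) :
    signedCycle n c i = i := by
  rw [lt_abs] at hi
  have := c.1.isLt
  simp only [signedCycle_apply]
  split_ifs <;> omega

theorem signedCycle_apply_add_one (n : ℕ) (c : Fin (n + 1) × Bool) :
    signedCycle n c (c.1 + 1) = signedTop n c.2 := by
  rw [signedCycle_apply, if_pos rfl]

/-! ### Signed permutations and insertion of a letter of largest absolute value -/

namespace SignedPerm

variable {n : ℕ} {π : Equiv.Perm ℤ}

/-- A value beyond `n` would be a fixed point of `π`, hence equal to its own preimage by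
injectivity. -/
theorem abs_apply_le (hπ : π ∈ SignedPerm n) {i : ℤ} (hi : |i| ≤ n) : |π i| ≤ n := by
  by_contra h
  have h1 := hπ.2 (π i) (not_le.1 h)
  rw [π.injective.eq_iff] at h1
  rw [h1] at h
  exact h hi

theorem mono (hπ : π ∈ SignedPerm n) : π ∈ SignedPerm (n + 1) :=
  ⟨hπ.1, fun i hi => hπ.2 i (by push_cast at hi; omega)⟩

theorem mul_mem {π' : Equiv.Perm ℤ} (hπ : π ∈ SignedPerm n) (hπ' : π' ∈ SignedPerm n) :
    π * π' ∈ SignedPerm n :=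
  ⟨fun i => by simp [hπ.1, hπ'.1], fun i hi => by simp [hπ.2 i hi, hπ'.2 i hi]⟩

theorem inv_mem (hπ : π ∈ SignedPerm n) : π⁻¹ ∈ SignedPerm n :=
  ⟨fun i => by
    rw [Equiv.Perm.inv_eq_iff_eq, hπ.1]
    simp, fun i hi => by rw [Equiv.Perm.inv_eq_iff_eq, hπ.2 i hi]⟩

theorem signedCycle_mem (n : ℕ) (c : Fin (n + 1) × Bool) :
    signedCycle n c ∈ SignedPerm (n + 1) :=
  ⟨signedCycle_neg n c, fun i hi => signedCycle_of_lt n c (by simpa using hi)⟩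

theorem apply_signedTop (hπ : π ∈ SignedPerm n) (b : Bool) : π (signedTop n b) = signedTop n b := by
  apply hπ.2
  rw [lt_abs]
  cases b <;> simp [signedTop]

/-- Multiplication on the right acts on positions: the letters of `π` after index `p` move up by
one, and the gap receives `±(n + 1)`, which `π` fixes. -/
theorem word_mul_signedCycle (hπ : π ∈ SignedPerm n) (c : Fin (n + 1) × Bool) {i : ℕ}
    (hi : i ≤ n + 1) :
    (π * signedCycle n c) i = wordInsert (fun i => π i) c.1 (signedTop n c.2) i := by
  rw [Equiv.Perm.mul_apply, signedCycle_apply, wordInsert]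
  have := c.1.isLt
  by_cases h1 : i = (c.1 : ℕ) + 1
  · rw [if_pos (by omega), if_neg (by omega), if_pos h1, apply_signedTop hπ]
  · rw [if_neg (by omega), if_neg (by omega), if_neg h1]
    split_ifs <;> first | omega | rfl | rw [show ((i - 1 : ℕ) : ℤ) = i - 1 by omega]

theorem descentsB_mul_signedCycle (hπ : π ∈ SignedPerm n) (p : Fin (n + 1)) (b : Bool) :
    descentsB (n + 1) (π * signedCycle n (p, b)) = descentsB n π +
      if b then (if (p : ℕ) < n ∧ ¬ π (p + 1) < π p then 1 else 0)
      else if (p : ℕ) < n ∧ π (p + 1) < π p then 0 else 1 := by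
  have hb : ∀ i ≤ n, |π (i : ℤ)| ≤ n := fun i hi => abs_apply_le hπ (by simpa using hi)
  rw [descentsB_eq_wordDescents, descentsB_eq_wordDescents,
    wordDescents_congr fun i hi => word_mul_signedCycle hπ (p, b) hi]
  cases b with
  | true =>
    rw [wordDescents_insert_top _ (Nat.lt_succ_iff.1 p.isLt)]
    · simp
    · intro i hi
      have := abs_le.1 (hb i hi)
      simp only [signedTop, if_true]
      omega
  | false =>
    rw [wordDescents_insert_bot _ (Nat.lt_succ_iff.1 p.isLt)]
    · simp
    · intro i hi
      have := abs_le.1 (hb i hi)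
      simp only [signedTop, Bool.false_eq_true, if_false]
      omega

end SignedPerm

/-- Of the `2(n + 1)` insertions, `k + 1` places preserve the number of descents for the letter `n +
1` and `k` places for `-(n + 1)`. -/
theorem isTriangle_eulerianB :
    IsTriangle (fun _ k => 2 * k + 1) (fun n k => 2 * (n - k) + 1) eulerianB := by
  have key := isTriangle_of_insertion (α := fun _ => Equiv.Perm ℤ)
    (γ := fun n => Fin (n + 1) × Bool) (fun n => SignedPerm n) (fun n π => descentsB n π)
    (fun n π => univ)
    (fun n π c => π * signedCycle n c) (fun _ k => 2 * k + 1) (fun n k => 2 * (n - k) + 1) 1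
    ?_ rfl (fun n π hπ c _ => SignedPerm.mul_mem (SignedPerm.mono hπ) (SignedPerm.signedCycle_mem n c)) ?_ ?_ ?_ ?_ ?_
  · exact key
  · intro π
    refine ⟨fun hπ => ?_, ?_⟩
    · ext1 i
      rcases eq_or_ne i 0 with rfl | hi
      · have := hπ.1 0
        rw [neg_zero] at this
        change π 0 = 0
        omega
      · exact hπ.2 i (by simpa using hi)
    · rintro rfl
      exact ⟨fun i => rfl, fun i _ => rfl⟩
  · rintro n π hπ ⟨p, b⟩ - π' hπ' ⟨p', b'⟩ - h
    -- The position of the value `n + 1` is `p + 1` or `-(p + 1)`, so it reveals both the place and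
    -- the sign.
    have h1 : ∀ {π : Equiv.Perm ℤ} (p : Fin (n + 1)) (b : Bool), π ∈ SignedPerm n →
        (π * signedCycle n (p, b)) (if b then p + 1 else -(p + 1)) = n + 1 := by
      intro π p b hπ
      rw [Equiv.Perm.mul_apply]
      cases b with
      | true =>
        rw [if_pos rfl, signedCycle_apply_add_one n (p, true)]
        exact SignedPerm.apply_signedTop hπ true
      | false =>
        rw [if_neg Bool.false_ne_true, signedCycle_neg, signedCycle_apply_add_one n (p, false),
          signedTop, if_neg Bool.false_ne_true, neg_neg]
        exact SignedPerm.apply_signedTop hπ true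
    have h2 := h1 p b hπ
    rw [h, ← h1 p' b' hπ', (Equiv.injective _).eq_iff] at h2
    have h3 : (p, b) = (p', b') := by
      cases b <;> cases b' <;> simp [Fin.ext_iff] at h2 ⊢ <;> omega
    rw [h3] at h
    exact ⟨mul_right_cancel h, h3⟩
  · intro n τ hτ
    have hj := SignedPerm.abs_apply_le (SignedPerm.inv_mem hτ) (i := n + 1) (by rw [abs_le]; push_cast; omega)
    set j := τ⁻¹ (n + 1) with hj'
    have hτj : τ j = n + 1 := by simp [hj']
    have hj0 : j ≠ 0 := by
      intro h
      have := hτ.1 0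
      rw [neg_zero, ← h, hτj] at this
      omega
    rw [abs_le] at hj
    push_cast at hj
    obtain ⟨c, hc⟩ : ∃ c : Fin (n + 1) × Bool, j = if c.2 then (c.1 : ℤ) + 1 else -(c.1 + 1) := by
      rcases lt_or_gt_of_ne hj0 with h | h
      · exact ⟨(⟨(-j - 1).toNat, by omega⟩, false), by simp; omega⟩
      · exact ⟨(⟨(j - 1).toNat, by omega⟩, true), by simp; omega⟩
    have hcj : signedCycle n c j = n + 1 := by
      obtain ⟨p, b⟩ := c
      rw [hc]
      cases b with
      | true =>
        rw [if_pos rfl, signedCycle_apply_add_one n (p, true)]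
        rfl
      | false =>
        rw [if_neg Bool.false_ne_true, signedCycle_neg, signedCycle_apply_add_one n (p, false)]
        simp [signedTop]
    refine ⟨τ * (signedCycle n c)⁻¹, ⟨fun i => ?_, fun i hi => ?_⟩, c, mem_univ _, by simp⟩
    · exact (SignedPerm.mul_mem hτ (SignedPerm.inv_mem (SignedPerm.signedCycle_mem n c))).1 i
    · have hmem := SignedPerm.mul_mem hτ (SignedPerm.inv_mem (SignedPerm.signedCycle_mem n c))
      -- Fixing `n + 1`, and by oddness `-(n + 1)`, is what brings the quotient from `SignedPerm (n
      -- + 1)` down to `SignedPerm n`.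
      have htop : (τ * (signedCycle n c)⁻¹) (n + 1) = n + 1 := by
        rw [Equiv.Perm.mul_apply, Equiv.Perm.inv_eq_iff_eq.2 hcj.symm, hτj]
      by_cases hi' : (n : ℤ) + 1 < |i|
      · exact hmem.2 i (by simpa using hi')
      · have : |i| = n + 1 := by omega
        rcases (abs_eq (by omega)).1 this with rfl | rfl
        · exact htop
        · rw [hmem.1, htop]
  · rintro n π hπ ⟨p, b⟩ -
    rw [SignedPerm.descentsB_mul_signedCycle hπ]
    split_ifs <;> simp
  · intro n π hπ
    have h1 := card_top_preserving (fun i => π i) n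
    have h2 := card_bot_preserving (fun i => π i) n
    rw [← descentsB_eq_wordDescents, card_filter] at h1 h2
    rw [card_filter, Fintype.sum_prod_type_right, Fintype.sum_bool]
    have h3 : 2 * descentsB n π + 1 = (descentsB n π + 1) + descentsB n π := by ring
    refine (congrArg₂ (· + ·) ((sum_congr rfl fun p _ => ?_).trans h1)
      ((sum_congr rfl fun p _ => ?_).trans h2)).trans h3.symm
    · rw [SignedPerm.descentsB_mul_signedCycle hπ, if_pos rfl]
      push_cast
      split_ifs <;> simp_all
    · rw [SignedPerm.descentsB_mul_signedCycle hπ, if_neg Bool.false_ne_true]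
      push_cast
      split_ifs <;> simp_all
  · intro n π hπ
    have := wordDescents_le (fun i => π i) n
    rw [← descentsB_eq_wordDescents] at this
    rw [card_univ, Fintype.card_prod, Fintype.card_fin, Fintype.card_bool]
    omega

end Gram

namespace Gram

open Finset

/-! ### Set partitions -/

/-- The maps that send every element to the least element of its block in a set partition. -/
def IsMinMap {n : ℕ} (m : Fin n → Fin n) : Prop :=
  (∀ v, m v ≤ v) ∧ ∀ v, m (m v) = m v

/-- Each of `m v`, `m' v` lies in the common block of `v`, and each map sends that whole block to an
element below all its members. -/
theorem IsMinMap.eq_of_ker_eq {n : ℕ} {m m' : Fin n → Fin n} (h : IsMinMap m) (h' : IsMinMap m')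
    (hker : ∀ u v, m u = m v ↔ m' u = m' v) : m = m' := by
  funext v
  apply le_antisymm
  · rw [← (hker (m' v) v).2 (h'.2 v)]
    exact h.1 _
  · rw [← (hker (m v) v).1 (h.2 v)]
    exact h'.1 _

instance decidableRelKer {n : ℕ} (m : Fin n → Fin n) : DecidableRel (Setoid.ker m) :=
  fun u v => inferInstanceAs (Decidable (m u = m v))

theorem IsMinMap.card_parts {n : ℕ} {m : Fin n → Fin n} (h : IsMinMap m) :
    #(Finpartition.ofSetoid (Setoid.ker m)).parts = #{v | m v = v} := by
  rw [Finpartition.ofSetoid, Finpartition.ofSetSetoid_parts]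
  symm
  refine card_bij (fun v _ => {b ∈ (univ : Finset (Fin n)) | (Setoid.ker m).r v b}) ?_ ?_ ?_
  · intro v _
    exact mem_image_of_mem _ (mem_univ v)
  · intro u hu v hv huv
    rw [mem_filter_univ] at hu hv
    have : v ∈ ({b ∈ univ | (Setoid.ker m).r u b} : Finset (Fin n)) := by
      rw [huv, mem_filter_univ]
    rw [mem_filter_univ] at this
    have this : m u = m v := this
    rw [← hu, this, hv]
  · intro s hs
    obtain ⟨v, -, rfl⟩ := mem_image.1 hs
    refine ⟨m v, by rw [mem_filter_univ, h.2], filter_congr fun b _ => ?_⟩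
    change m (m v) = m b ↔ m v = m b
    rw [h.2]

/-- A partition is encoded by the map to the least element of each block; blocks become fixed
points, and insertion becomes extension of a function. -/
theorem stirlingPartition_eq (n k : ℕ) :
    stirlingPartition n k = {m : Fin n → Fin n | IsMinMap m ∧ #{v | m v = v} = k}.ncard := by
  symm
  refine Set.ncard_congr (fun m _ => Finpartition.ofSetoid (Setoid.ker m)) ?_ ?_ ?_
  · rintro m ⟨hm, hk⟩
    exact (IsMinMap.card_parts hm).trans hk
  · rintro m m' ⟨hm, -⟩ ⟨hm', -⟩ h
    refine hm.eq_of_ker_eq hm' fun u v => ?_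
    have h1 := Finpartition.mem_part_ofSetoid_iff_rel (s := Setoid.ker m) (a := u) (b := v)
    have h2 := Finpartition.mem_part_ofSetoid_iff_rel (s := Setoid.ker m') (a := u) (b := v)
    rw [h] at h1
    exact h1.symm.trans h2
  · intro P hP
    have hmem : ∀ v, v ∈ P.part v := fun v => P.mem_part (mem_univ v)
    have hpart : ∀ u v, u ∈ P.part v ↔ P.part u = P.part v := fun u v =>
      P.mem_part_iff_part_eq_part (mem_univ u) (mem_univ v)
    let m : Fin n → Fin n := fun v => (P.part v).min' ⟨v, hmem v⟩
    have hm1 : ∀ v, P.part (m v) = P.part v := fun v => (hpart _ _).1 (min'_mem _ _)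
    have hm : IsMinMap m := by
      refine ⟨fun v => min'_le _ _ (hmem v), fun v => ?_⟩
      simp only [m, hm1]
    have hker : ∀ u v, m u = m v ↔ P.part u = P.part v := by
      intro u v
      refine ⟨fun h => by rw [← hm1 u, h, hm1 v], fun h => ?_⟩
      simp only [m, h]
    have hparts : (Finpartition.ofSetoid (Setoid.ker m)) = P := by
      ext s
      rw [Finpartition.ofSetoid, Finpartition.ofSetSetoid_parts, mem_image]
      have hset : ∀ v, ({b ∈ univ | (Setoid.ker m).r v b} : Finset (Fin n)) = P.part v := by
        intro v
        ext b
        rw [mem_filter_univ, hpart]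
        change m v = m b ↔ _
        rw [hker, eq_comm]
      simp only [hset, mem_univ, true_and]
      constructor
      · rintro ⟨v, rfl⟩
        exact P.part_mem.2 (mem_univ v)
      · intro hs
        obtain ⟨v, hv⟩ := P.nonempty_of_mem_parts hs
        exact ⟨v, P.part_eq_of_mem hs hv⟩
    refine ⟨m, ⟨hm, ?_⟩, hparts⟩
    rw [← hm.card_parts, hparts]
    exact hP

/-- Adding the largest element to a block, given by its least element, or as a new block. -/
def minMapInsert {n : ℕ} (m : Fin n → Fin n) (c : Option (Fin n)) : Fin (n + 1) → Fin (n + 1) :=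
  Fin.snoc (α := fun _ => Fin (n + 1)) (fun v => (m v).castSucc) (c.elim (Fin.last n) Fin.castSucc)

theorem minMapInsert_castSucc {n : ℕ} (m : Fin n → Fin n) (c : Option (Fin n)) (v : Fin n) :
    minMapInsert m c v.castSucc = (m v).castSucc := by
  simp only [minMapInsert, Fin.snoc_castSucc]

theorem minMapInsert_last {n : ℕ} (m : Fin n → Fin n) (c : Option (Fin n)) :
    minMapInsert m c (Fin.last n) = c.elim (Fin.last n) Fin.castSucc := by
  simp only [minMapInsert, Fin.snoc_last]

theorem isTriangle_stirlingPartition :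
    IsTriangle (fun _ k => k) (fun _ _ => 1) stirlingPartition := by
  have hstat : ∀ {n : ℕ} (m : Fin n → Fin n) (c : Option (Fin n)),
      #{v | minMapInsert m c v = v} = #{v | m v = v} + if c = none then 1 else 0 := by
    intro n m c
    simp only [card_filter_fin_succ, minMapInsert_castSucc, minMapInsert_last,
      Fin.castSucc_inj]
    cases c with
    | none => simp
    | some u => simp [(Fin.castSucc_lt_last u).ne]
  have key := isTriangle_of_insertion (α := fun n => Fin n → Fin n)
    (γ := fun n => Option (Fin n)) (fun n => {m | IsMinMap m}) (fun n m => #{v | m v = v})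
    (fun n m => insertNone {v | m v = v}) (fun n m c => minMapInsert m c)
    (fun _ k => k) (fun _ _ => 1) Fin.elim0
    (fun o => ⟨fun _ => Subsingleton.elim _ _, fun _ => ⟨fun v => v.elim0, fun v => v.elim0⟩⟩)
    rfl ?_ ?_ ?_ ?_ ?_ ?_
  · convert key using 3
    exact stirlingPartition_eq _ _
  · intro n m hm c hc
    simp only [mem_insertNone, mem_filter_univ, Option.mem_def] at hc
    constructor
    · intro v
      cases v using Fin.lastCases with
      | last => exact Fin.le_last _
      | cast v =>
        rw [minMapInsert_castSucc]
        exact Fin.castSucc_le_castSucc_iff.2 (hm.1 v)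
    · intro v
      cases v using Fin.lastCases with
      | last =>
        rw [minMapInsert_last]
        cases c with
        | none => exact minMapInsert_last _ _
        | some u => exact (minMapInsert_castSucc _ _ _).trans (by rw [hc u rfl]; rfl)
      | cast v => rw [minMapInsert_castSucc, minMapInsert_castSucc, hm.2]
  · intro n m _ c _ m' _ c' _ h
    refine ⟨funext fun v => ?_, ?_⟩
    · have := congrFun h v.castSucc
      rw [minMapInsert_castSucc, minMapInsert_castSucc] at this
      exact Fin.castSucc_injective _ this
    · have := congrFun h (Fin.last n)
      rw [minMapInsert_last, minMapInsert_last] at this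
      cases c with
      | none =>
        cases c' with
        | none => rfl
        | some u => exact absurd this (Fin.castSucc_lt_last u).ne'
      | some u =>
        cases c' with
        | none => exact absurd this (Fin.castSucc_lt_last u).ne
        | some u' => rw [Fin.castSucc_injective _ this]
  · intro n m' hm'
    have hex : ∀ v : Fin n, ∃ u : Fin n, u.castSucc = m' v.castSucc := fun v =>
      ⟨(m' v.castSucc).castPred ((hm'.1 _).trans_lt (Fin.castSucc_lt_last v)).ne, by simp⟩
    choose m hm using hex
    have hfix : ∀ v : Fin n, m' v.castSucc = v.castSucc → m v = v := fun v h =>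
      Fin.castSucc_injective _ ((hm v).trans h)
    refine ⟨m, ⟨fun v => ?_, fun v => ?_⟩, ?_⟩
    · rw [← Fin.castSucc_le_castSucc_iff, hm]
      exact hm'.1 _
    · apply hfix
      rw [hm, hm'.2]
    · by_cases hlast : m' (Fin.last n) = Fin.last n
      · refine ⟨none, by simp, funext fun v => ?_⟩
        cases v using Fin.lastCases with
        | last => rw [minMapInsert_last, hlast]; rfl
        | cast v => rw [minMapInsert_castSucc, hm]
      · have hu := Fin.castSucc_castPred _ hlast
        refine ⟨some ((m' (Fin.last n)).castPred hlast), ?_, funext fun v => ?_⟩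
        · rw [some_mem_insertNone, mem_filter_univ]
          apply hfix
          rw [hu, hm'.2]
        · cases v using Fin.lastCases with
          | last => rw [minMapInsert_last]; exact hu
          | cast v => rw [minMapInsert_castSucc, hm]
  · intro n m _ c _
    rw [hstat]
    split_ifs <;> simp
  · intro n m _
    have : ({c ∈ insertNone {v | m v = v} | #{v | minMapInsert m c v = v} = #{v | m v = v}}) =
        ({v | m v = v} : Finset _).map Function.Embedding.some := by
      ext c
      cases c <;> simp [hstat]
    rw [this, card_map]
  · intro n m _
    rw [card_insertNone]

/-! ### Inserting a label into a family of lists -/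

/-- A label occurring only once remembers where it was inserted; this makes insertion into lists
injective. -/
theorem _root_.List.idxOf_insertIdx_self {α : Type*} [DecidableEq α] {a : α} {l : List α} {i : ℕ}
    (ha : a ∉ l) (hi : i ≤ l.length) : (l.insertIdx i a).idxOf a = i := by
  induction l generalizing i with
  | nil =>
    obtain rfl : i = 0 := by simpa using hi
    simp
  | cons b l ih =>
    cases i with
    | zero => simp
    | succ i =>
      rw [List.mem_cons, not_or] at ha
      rw [List.insertIdx_succ_cons, List.idxOf_cons_ne _ (Ne.symm ha.1),
        ih ha.2 (by simpa using hi)]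

theorem _root_.List.insertIdx_append_length {α : Type*} (s t : List α) (a : α) :
    (s ++ t).insertIdx s.length a = s ++ a :: t := by
  induction s with
  | nil => simp
  | cons b s ih => simp [ih]

/-- A list of labels, among more labels. -/
def liftList {n : ℕ} (l : List (Fin n)) : List (Fin (n + 1)) :=
  l.map Fin.castSucc

/-- The list obtained by inserting the largest label at position `i`. -/
def listInsert {n : ℕ} (l : List (Fin n)) (i : ℕ) : List (Fin (n + 1)) :=
  (liftList l).insertIdx i (Fin.last n)

section

variable {n : ℕ}

@[simp]
theorem length_liftList (l : List (Fin n)) : (liftList l).length = l.length :=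
  List.length_map _

theorem liftList_injective : Function.Injective (liftList (n := n)) :=
  List.map_injective_iff.2 (Fin.castSucc_injective n)

@[simp]
theorem liftList_eq_nil {l : List (Fin n)} : liftList l = [] ↔ l = [] :=
  List.map_eq_nil_iff

theorem last_notMem_liftList (l : List (Fin n)) : Fin.last n ∉ liftList l := by
  simp [liftList, Fin.castSucc_ne_last]

theorem mem_liftList {l : List (Fin n)} {w : Fin (n + 1)} :
    w ∈ liftList l ↔ ∃ v ∈ l, v.castSucc = w :=
  List.mem_map

theorem castSucc_mem_liftList {l : List (Fin n)} {w : Fin n} : w.castSucc ∈ liftList l ↔ w ∈ l := by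
  simp [mem_liftList]

theorem exists_liftList_eq {l : List (Fin (n + 1))} (h : Fin.last n ∉ l) :
    ∃ l', liftList l' = l := by
  induction l with
  | nil => exact ⟨[], rfl⟩
  | cons a l ih =>
    rw [List.mem_cons, not_or] at h
    obtain ⟨l', rfl⟩ := ih h.2
    exact ⟨a.castPred (Ne.symm h.1) :: l', by simp [liftList]⟩

theorem count_liftList (l : List (Fin n)) (w : Fin n) :
    (liftList l).count w.castSucc = l.count w :=
  List.count_map_of_injective _ _ (Fin.castSucc_injective n) _

theorem listInsert_perm {l : List (Fin n)} {i : ℕ} (hi : i ≤ l.length) :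
    (listInsert l i).Perm (Fin.last n :: liftList l) :=
  List.perm_insertIdx _ _ (by simpa using hi)

theorem mem_listInsert {l : List (Fin n)} {i : ℕ} (hi : i ≤ l.length) {w : Fin (n + 1)} :
    w ∈ listInsert l i ↔ w = Fin.last n ∨ w ∈ liftList l := by
  rw [(listInsert_perm hi).mem_iff, List.mem_cons]

theorem listInsert_ne_nil {l : List (Fin n)} {i : ℕ} (hi : i ≤ l.length) :
    listInsert l i ≠ [] :=
  List.ne_nil_of_mem ((mem_listInsert hi).2 (Or.inl rfl))

theorem count_castSucc_listInsert {l : List (Fin n)} {i : ℕ} (hi : i ≤ l.length) (w : Fin n) :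
    (listInsert l i).count w.castSucc = l.count w := by
  rw [(listInsert_perm hi).count_eq, List.count_cons_of_ne (Fin.castSucc_ne_last w).symm,
    count_liftList]

theorem count_last_listInsert {l : List (Fin n)} {i : ℕ} (hi : i ≤ l.length) :
    (listInsert l i).count (Fin.last n) = 1 := by
  rw [(listInsert_perm hi).count_eq, List.count_cons_self,
    List.count_eq_zero_of_not_mem (last_notMem_liftList l)]

theorem listInsert_injective {l l' : List (Fin n)} {i i' : ℕ} (hi : i ≤ l.length)
    (hi' : i' ≤ l'.length) (h : listInsert l i = listInsert l' i') : l = l' ∧ i = i' := by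
  have h1 := List.idxOf_insertIdx_self (last_notMem_liftList l) (i := i) (by simpa using hi)
  have h2 := List.idxOf_insertIdx_self (last_notMem_liftList l') (i := i') (by simpa using hi')
  rw [listInsert, listInsert] at h
  rw [h, h2] at h1
  subst h1
  exact ⟨liftList_injective (List.insertIdx_injective _ _ h), rfl⟩

theorem exists_listInsert_eq {l : List (Fin (n + 1))} (h : l.count (Fin.last n) = 1) :
    ∃ l' i, i ≤ l'.length ∧ listInsert l' i = l := by
  obtain ⟨s, t, rfl⟩ := List.append_of_mem (List.count_pos_iff.1 (h ▸ Nat.one_pos))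
  rw [List.count_append, List.count_cons_self] at h
  obtain ⟨s, rfl⟩ := exists_liftList_eq (List.count_eq_zero.1 (show s.count (Fin.last n) = 0 by omega))
  obtain ⟨t, rfl⟩ := exists_liftList_eq (List.count_eq_zero.1 (show t.count (Fin.last n) = 0 by omega))
  refine ⟨s ++ t, s.length, by simp, ?_⟩
  rw [listInsert, liftList, List.map_append]
  conv_lhs => rw [← length_liftList s]
  exact List.insertIdx_append_length _ _ _

theorem sum_length_eq_sum_count {ι : Type*} [Fintype ι] (F : ι → List (Fin n)) :
    ∑ j, (F j).length = ∑ w, ∑ j, (F j).count w := by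
  rw [sum_comm]
  refine sum_congr rfl fun j _ => ?_
  have := Multiset.sum_count_eq_card (s := univ) (m := (F j : Multiset (Fin n)))
    (fun a _ => mem_univ a)
  simpa using this.symm

variable {ι : Type*} [DecidableEq ι]

/-- The family of lists obtained by inserting the largest label at position `i` of the list with
index `k`. -/
def familyInsert (F : ι → List (Fin n)) (k : ι) (i : ℕ) : ι → List (Fin (n + 1)) :=
  Function.update (fun j => liftList (F j)) k (listInsert (F k) i)

theorem familyInsert_self (F : ι → List (Fin n)) (k : ι) (i : ℕ) :
    familyInsert F k i k = listInsert (F k) i :=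
  Function.update_self _ _ _

theorem familyInsert_of_ne (F : ι → List (Fin n)) {k j : ι} (h : j ≠ k) (i : ℕ) :
    familyInsert F k i j = liftList (F j) :=
  Function.update_of_ne h _ _

theorem mem_familyInsert {F : ι → List (Fin n)} {k j : ι} {i : ℕ} (hi : i ≤ (F k).length)
    {w : Fin (n + 1)} :
    w ∈ familyInsert F k i j ↔ (j = k ∧ w = Fin.last n) ∨ w ∈ liftList (F j) := by
  by_cases h : j = k
  · subst h
    simp [familyInsert_self, mem_listInsert hi]
  · simp [familyInsert_of_ne F h, h]

theorem count_castSucc_familyInsert {F : ι → List (Fin n)} {k : ι} {i : ℕ}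
    (hi : i ≤ (F k).length) (j : ι) (w : Fin n) :
    (familyInsert F k i j).count w.castSucc = (F j).count w := by
  by_cases h : j = k
  · subst h
    rw [familyInsert_self, count_castSucc_listInsert hi]
  · rw [familyInsert_of_ne F h, count_liftList]

theorem count_last_familyInsert {F : ι → List (Fin n)} {k : ι} {i : ℕ}
    (hi : i ≤ (F k).length) (j : ι) :
    (familyInsert F k i j).count (Fin.last n) = if j = k then 1 else 0 := by
  split_ifs with h
  · subst h
    rw [familyInsert_self, count_last_listInsert hi]
  · rw [familyInsert_of_ne F h, List.count_eq_zero_of_not_mem (last_notMem_liftList _)]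

theorem familyInsert_injective {F F' : ι → List (Fin n)} {k k' : ι} {i i' : ℕ}
    (hi : i ≤ (F k).length) (hi' : i' ≤ (F' k').length)
    (h : familyInsert F k i = familyInsert F' k' i') : F = F' ∧ k = k' ∧ i = i' := by
  have hk : k = k' := by
    have h1 := count_last_familyInsert hi k
    rw [h, count_last_familyInsert hi', if_pos rfl] at h1
    by_contra hne
    simp [hne] at h1
  subst hk
  have h2 := congrFun h k
  rw [familyInsert_self, familyInsert_self] at h2
  obtain ⟨h3, rfl⟩ := listInsert_injective hi hi' h2
  refine ⟨funext fun j => ?_, rfl, rfl⟩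
  by_cases hj : j = k
  · rw [hj, h3]
  · have h4 := congrFun h j
    rw [familyInsert_of_ne F hj, familyInsert_of_ne F' hj] at h4
    exact liftList_injective h4

/-- Total multiplicity one means that the largest label occurs in one list only, once; the other
lists involve smaller labels only. -/
theorem exists_familyInsert_eq [Fintype ι] {F : ι → List (Fin (n + 1))}
    (h : ∑ j, (F j).count (Fin.last n) = 1) :
    ∃ F' k i, i ≤ (F' k).length ∧ familyInsert F' k i = F := by
  obtain ⟨k, -, hk⟩ : ∃ k ∈ univ, (F k).count (Fin.last n) ≠ 0 :=
    exists_ne_zero_of_sum_ne_zero (by rw [h]; exact one_ne_zero)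
  rw [← add_sum_erase _ _ (mem_univ k)] at h
  have hk1 : (F k).count (Fin.last n) = 1 := by omega
  have hk2 : ∑ j ∈ univ.erase k, (F j).count (Fin.last n) = 0 := by omega
  rw [sum_eq_zero_iff] at hk2
  -- The list chosen at `k` is an irrelevant default, overwritten by `l` below.
  have hex : ∀ j, ∃ l, j ≠ k → liftList l = F j := by
    intro j
    by_cases hj : j = k
    · exact ⟨[], fun h => absurd hj h⟩
    · obtain ⟨l, hl⟩ := exists_liftList_eq
        (List.count_eq_zero.1 (hk2 j (mem_erase.2 ⟨hj, mem_univ j⟩)))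
      exact ⟨l, fun _ => hl⟩
  choose G hG using hex
  obtain ⟨l, i, hi, hl⟩ := exists_listInsert_eq hk1
  refine ⟨Function.update G k l, k, i, by simpa using hi, funext fun j => ?_⟩
  by_cases hj : j = k
  · subst hj
    rw [familyInsert_self, Function.update_self, hl]
  · rw [familyInsert_of_ne _ hj, Function.update_of_ne hj, hG j hj]

end

end Gram

namespace Gram

open Finset

/-! ### Forests of lists -/

section ListForest

set_option linter.unusedSectionVars false

variable {K : Type*} [Fintype K] [DecidableEq K] {n : ℕ}

/-- Families of lists in which every label occurs once. The list `F (v, none)` is the list of the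
children of a root whose least entry is `v`, and `F (v, some a)` is the list of the children of
kind `a` of `v`. -/
structure IsListForest (F : Fin n × Option K → List (Fin n)) : Prop where
  count : ∀ w, ∑ p, (F p).count w = 1
  root_le : ∀ v, ∀ w ∈ F (v, none), v ≤ w
  root_mem : ∀ v, F (v, none) ≠ [] → v ∈ F (v, none)
  child_lt : ∀ v a, ∀ w ∈ F (v, some a), v < w

/-- The number of nonempty root lists. -/
def rootCount (F : Fin n × Option K → List (Fin n)) : ℕ :=
  #{v | F (v, none) ≠ []}

/-- Extending a family of lists to a larger index set. -/
def familyExtend {J X : Type*} (F : Fin n × J → List X) (e : J → List X) : Fin (n + 1) × J → List X :=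
  fun p => Fin.lastCases (motive := fun _ => List X) (e p.2) (fun v => F (v, p.2)) p.1

@[simp]
theorem familyExtend_castSucc {J X : Type*} (F : Fin n × J → List X) (e : J → List X) (v : Fin n)
    (j : J) : familyExtend F e (v.castSucc, j) = F (v, j) :=
  Fin.lastCases_castSucc ..

@[simp]
theorem familyExtend_last {J X : Type*} (F : Fin n × J → List X) (e : J → List X) (j : J) :
    familyExtend F e (Fin.last n, j) = e j :=
  Fin.lastCases_last ..

theorem sum_familyExtend {J X : Type*} [Fintype J] (F : Fin n × J → List X) (e : J → List X)
    (g : List X → ℕ) : ∑ p, g (familyExtend F e p) = ∑ p, g (F p) + ∑ j, g (e j) := by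
  rw [Fintype.sum_prod_type, Fin.sum_univ_castSucc, Fintype.sum_prod_type]
  simp

theorem familyExtend_injective {J X : Type*} {F F' : Fin n × J → List X} {e e' : J → List X}
    (h : familyExtend F e = familyExtend F' e') : F = F' ∧ e = e' := by
  refine ⟨funext fun ⟨v, j⟩ => ?_, funext fun j => ?_⟩
  · simpa using congrFun h (v.castSucc, j)
  · simpa using congrFun h (Fin.last n, j)

theorem eq_familyExtend {J X : Type*} (F : Fin (n + 1) × J → List X) :
    F = familyExtend (fun p => F (p.1.castSucc, p.2)) (fun j => F (Fin.last n, j)) := by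
  funext ⟨v, j⟩
  cases v using Fin.lastCases with
  | last => simp
  | cast v => simp

/-- The new root list that consists of the largest label. -/
def newRoot (n : ℕ) (j : Option K) : List (Fin (n + 1)) :=
  j.elim [Fin.last n] fun _ => []

/-- Adding the largest label as a new root list, or to an existing list. -/
def listForestInsert (F : Fin n × Option K → List (Fin n)) :
    Option (Σ _ : Fin n × Option K, ℕ) → Fin (n + 1) × Option K → List (Fin (n + 1))
  | none => familyExtend (fun p => liftList (F p)) (newRoot n)
  | some q => familyExtend (familyInsert F q.1 q.2) fun _ => []

/-- The places at which the largest label can be added. -/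
def listForestPlaces (F : Fin n × Option K → List (Fin n)) :
    Finset (Option (Σ _ : Fin n × Option K, ℕ)) :=
  insertNone (({p | p.2 ≠ none ∨ F p ≠ []} : Finset (Fin n × Option K)).sigma
    fun p => range ((F p).length + 1))

theorem some_mem_listForestPlaces {F : Fin n × Option K → List (Fin n)} {p : Fin n × Option K}
    {i : ℕ} : some ⟨p, i⟩ ∈ listForestPlaces F ↔ (p.2 ≠ none ∨ F p ≠ []) ∧ i ≤ (F p).length := by
  simp [listForestPlaces]

theorem IsListForest.sum_length {F : Fin n × Option K → List (Fin n)} (hF : IsListForest F) :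
    ∑ p, (F p).length = n := by
  rw [sum_length_eq_sum_count]
  simp [hF.count]

/-- A list of length `ℓ` offers `ℓ + 1` positions, and the lengths add up to `n`. The available
lists are the child lists and the nonempty root lists; an empty root list at `v` is excluded, for
its least entry would not become `v`. One more place is the new root list. -/
theorem IsListForest.card_places {F : Fin n × Option K → List (Fin n)} (hF : IsListForest F) :
    #(listForestPlaces F) = (Fintype.card K + 1) * n + rootCount F + 1 := by
  rw [listForestPlaces, card_insertNone, card_sigma]
  congr 1
  simp only [card_range, sum_add_distrib, sum_const, smul_eq_mul, mul_one]
  have h1 : ∑ p with p.2 ≠ none ∨ F p ≠ [], (F p).length = n := by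
    refine Eq.trans (sum_subset (subset_univ _) ?_) hF.sum_length
    intro p _ hp
    rw [mem_filter_univ, not_or, not_not, not_not] at hp
    simp [hp.2]
  have h2 : #{p : Fin n × Option K | p.2 ≠ none ∨ F p ≠ []} =
      rootCount F + Fintype.card K * n := by
    rw [card_filter, Fintype.sum_prod_type]
    simp only [Fintype.sum_option, ne_eq, not_true_eq_false, false_or, reduceCtorEq,
      not_false_eq_true, true_or, if_true, sum_const, smul_eq_mul, mul_one, sum_add_distrib,
      card_univ, Fintype.card_fin]
    rw [rootCount, card_filter, mul_comm]
  rw [h1, h2]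
  ring

theorem IsListForest.insert_none {F : Fin n × Option K → List (Fin n)} (hF : IsListForest F) :
    IsListForest (listForestInsert F none) where
  count w := by
    rw [listForestInsert, sum_familyExtend _ _ (fun l => l.count w), Fintype.sum_option]
    cases w using Fin.lastCases with
    | last =>
      rw [sum_eq_zero fun p _ => List.count_eq_zero_of_not_mem (last_notMem_liftList (F p))]
      simp [newRoot]
    | cast w =>
      simp only [count_liftList, hF.count]
      simp [newRoot, List.count_cons_of_ne (Fin.castSucc_ne_last w).symm]
  root_le v w hw := by
    cases v using Fin.lastCases with
    | last =>
      have hw : w ∈ [Fin.last n] := by simpa [listForestInsert, newRoot] using hw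
      exact (List.mem_singleton.1 hw).ge
    | cast v =>
      rw [listForestInsert, familyExtend_castSucc, mem_liftList] at hw
      obtain ⟨w, hw, rfl⟩ := hw
      exact Fin.castSucc_le_castSucc_iff.2 (hF.root_le v w hw)
  root_mem v := by
    cases v using Fin.lastCases with
    | last => simp [listForestInsert, newRoot]
    | cast v =>
      rw [listForestInsert, familyExtend_castSucc, castSucc_mem_liftList, Ne, liftList_eq_nil]
      exact hF.root_mem v
  child_lt v a w hw := by
    cases v using Fin.lastCases with
    | last => simp [listForestInsert, newRoot] at hw
    | cast v =>
      rw [listForestInsert, familyExtend_castSucc, mem_liftList] at hw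
      obtain ⟨w, hw, rfl⟩ := hw
      exact Fin.castSucc_lt_castSucc_iff.2 (hF.child_lt v a w hw)

theorem IsListForest.insert_some {F : Fin n × Option K → List (Fin n)} (hF : IsListForest F)
    {p : Fin n × Option K} {i : ℕ} (hi : i ≤ (F p).length) (hp : p.2 ≠ none ∨ F p ≠ []) :
    IsListForest (listForestInsert F (some ⟨p, i⟩)) where
  count w := by
    rw [listForestInsert, sum_familyExtend _ _ (fun l => l.count w)]
    cases w using Fin.lastCases with
    | last => simp [count_last_familyInsert hi]
    | cast w => simp [count_castSucc_familyInsert hi, hF.count]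
  root_le v w hw := by
    cases v using Fin.lastCases with
    | last => simp [listForestInsert] at hw
    | cast v =>
      rw [listForestInsert, familyExtend_castSucc, mem_familyInsert hi, mem_liftList] at hw
      obtain ⟨-, rfl⟩ | ⟨w, hw, rfl⟩ := hw
      · exact Fin.le_last _
      · exact Fin.castSucc_le_castSucc_iff.2 (hF.root_le v w hw)
  root_mem v := by
    cases v using Fin.lastCases with
    | last => simp [listForestInsert]
    | cast v =>
      rw [listForestInsert, familyExtend_castSucc, mem_familyInsert hi, castSucc_mem_liftList]
      intro h
      refine Or.inr (hF.root_mem v fun h0 => ?_)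
      by_cases hv : (v, none) = p
      · subst hv
        exact hp.elim (fun h => h rfl) fun h => h h0
      · rw [familyInsert_of_ne F hv, h0] at h
        exact h rfl
  child_lt v a w hw := by
    cases v using Fin.lastCases with
    | last => simp [listForestInsert] at hw
    | cast v =>
      rw [listForestInsert, familyExtend_castSucc, mem_familyInsert hi, mem_liftList] at hw
      obtain ⟨-, rfl⟩ | ⟨w, hw, rfl⟩ := hw
      · exact Fin.castSucc_lt_last _
      · exact Fin.castSucc_lt_castSucc_iff.2 (hF.child_lt v a w hw)

theorem rootCount_insert_none (F : Fin n × Option K → List (Fin n)) :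
    rootCount (listForestInsert F none) = rootCount F + 1 := by
  rw [rootCount, card_filter_fin_succ]
  simp [listForestInsert, newRoot, rootCount]

theorem rootCount_insert_some {F : Fin n × Option K → List (Fin n)} {p : Fin n × Option K} {i : ℕ}
    (hi : i ≤ (F p).length) (hp : p.2 ≠ none ∨ F p ≠ []) :
    rootCount (listForestInsert F (some ⟨p, i⟩)) = rootCount F := by
  rw [rootCount, card_filter_fin_succ]
  simp only [listForestInsert, familyExtend_castSucc, familyExtend_last, ne_eq, not_true_eq_false,
    if_false, add_zero, rootCount]
  congr 1
  apply filter_congr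
  intro v _
  by_cases hv : (v, none) = p
  · subst hv
    rw [familyInsert_self]
    exact iff_of_true (listInsert_ne_nil hi) (hp.resolve_left fun h => h rfl)
  · rw [familyInsert_of_ne F hv, liftList_eq_nil]

/-- Undoing the insertion of the largest label. -/
theorem IsListForest.exists_insert_eq {G : Fin (n + 1) × Option K → List (Fin (n + 1))}
    (hG : IsListForest G) :
    ∃ F : Fin n × Option K → List (Fin n), IsListForest F ∧
      ∃ c ∈ listForestPlaces F, listForestInsert F c = G := by
  have hchild : ∀ a, G (Fin.last n, some a) = [] := fun a =>
    List.eq_nil_iff_forall_not_mem.2 fun w hw => absurd (hG.child_lt _ a w hw) (Fin.le_last w).not_gt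
  have hcount : ∀ w, ∑ p : Fin n × Option K, (G (p.1.castSucc, p.2)).count w +
      (G (Fin.last n, none)).count w = 1 := by
    intro w
    have := hG.count w
    rw [eq_familyExtend G, sum_familyExtend _ _ (fun l => l.count w)] at this
    simpa [Fintype.sum_option, hchild] using this
  have hmem : ∀ w ∈ G (Fin.last n, none), w = Fin.last n := fun w hw =>
    le_antisymm (Fin.le_last w) (hG.root_le _ w hw)
  -- The root list indexed by the largest label is empty or consists of that label alone, which
  -- decides between the two kinds of insertion.
  by_cases hroot : G (Fin.last n, none) = []
  · simp only [hroot, List.count_nil, add_zero] at hcount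
    obtain ⟨F, p, i, hi, hF⟩ := exists_familyInsert_eq (hcount (Fin.last n))
    have hGF : ∀ v j, G (v.castSucc, j) = familyInsert F p i (v, j) := fun v j =>
      (congrFun hF (v, j)).symm
    have hmemG : ∀ v j w, w ∈ F (v, j) → w.castSucc ∈ G (v.castSucc, j) := by
      intro v j w hw
      rw [hGF, mem_familyInsert hi]
      exact Or.inr (castSucc_mem_liftList.2 hw)
    have hnil : ∀ v, F (v, none) ≠ [] → G (v.castSucc, none) ≠ [] := by
      intro v hv
      obtain ⟨w, hw⟩ := List.exists_mem_of_ne_nil _ hv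
      exact List.ne_nil_of_mem (hmemG v none w hw)
    have hmemF : ∀ v, G (v.castSucc, none) ≠ [] → v ∈ F (v, none) := by
      intro v hv
      have := hG.root_mem v.castSucc hv
      rw [hGF, mem_familyInsert hi] at this
      exact castSucc_mem_liftList.1 (this.resolve_left fun h => Fin.castSucc_ne_last v h.2)
    refine ⟨F, ⟨fun w => ?_, fun v w hw => ?_, fun v hv => hmemF v (hnil v hv),
      fun v a w hw => ?_⟩, some ⟨p, i⟩, ?_, ?_⟩
    · rw [← hcount w.castSucc]
      exact sum_congr rfl fun j _ => (count_castSucc_familyInsert hi j w).symm.trans (by rw [hF])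
    · exact Fin.castSucc_le_castSucc_iff.1 (hG.root_le _ _ (hmemG v none w hw))
    · exact Fin.castSucc_lt_castSucc_iff.1 (hG.child_lt _ a _ (hmemG v (some a) w hw))
    · refine some_mem_listForestPlaces.2 ⟨?_, hi⟩
      rw [or_iff_not_imp_left, not_not]
      obtain ⟨v, j⟩ := p
      rintro rfl
      refine List.ne_nil_of_mem (hmemF v ?_)
      rw [hGF, familyInsert_self]
      exact listInsert_ne_nil hi
    · rw [listForestInsert, hF]
      conv_rhs => rw [eq_familyExtend G]
      congr 1
      funext j
      cases j with
      | none => exact hroot.symm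
      | some a => exact (hchild a).symm
  · have hlast := hG.root_mem _ hroot
    have h1 := hcount (Fin.last n)
    have h2 := List.count_pos_iff.2 hlast
    have h3 : ∑ p : Fin n × Option K, (G (p.1.castSucc, p.2)).count (Fin.last n) = 0 := by omega
    have h4 : G (Fin.last n, none) = [Fin.last n] := by
      rw [h3, zero_add, List.eq_replicate_of_mem hmem, List.count_replicate_self] at h1
      rw [List.eq_replicate_of_mem hmem, show (G (Fin.last n, none)).length = 1 by omega]
      rfl
    rw [sum_eq_zero_iff] at h3
    have hex : ∀ p : Fin n × Option K, ∃ l, liftList l = G (p.1.castSucc, p.2) := fun p =>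
      exists_liftList_eq (List.count_eq_zero.1 (h3 p (mem_univ p)))
    choose F hF using hex
    have hmemG : ∀ v j w, w ∈ F (v, j) → w.castSucc ∈ G (v.castSucc, j) := by
      intro v j w hw
      rw [← hF (v, j)]
      exact castSucc_mem_liftList.2 hw
    refine ⟨F, ⟨fun w => ?_, fun v w hw => ?_, fun v hv => ?_, fun v a w hw => ?_⟩, none,
      none_mem_insertNone, ?_⟩
    · rw [← hcount w.castSucc, h4, List.count_cons_of_ne (Fin.castSucc_ne_last w).symm,
        List.count_nil, add_zero]
      exact sum_congr rfl fun p _ => by rw [← hF, count_liftList]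
    · exact Fin.castSucc_le_castSucc_iff.1 (hG.root_le _ _ (hmemG v none w hw))
    · have := hG.root_mem v.castSucc (by rwa [← hF (v, none), Ne, liftList_eq_nil])
      rwa [← hF (v, none), castSucc_mem_liftList] at this
    · exact Fin.castSucc_lt_castSucc_iff.1 (hG.child_lt _ a _ (hmemG v (some a) w hw))
    · rw [listForestInsert]
      conv_rhs => rw [eq_familyExtend G]
      congr 1
      · exact funext hF
      · funext j
        cases j with
        | none => exact h4.symm
        | some a => exact (hchild a).symm

theorem listForestInsert_injective {F F' : Fin n × Option K → List (Fin n)}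
    {c c' : Option (Σ _ : Fin n × Option K, ℕ)} (hc : c ∈ listForestPlaces F)
    (hc' : c' ∈ listForestPlaces F') (h : listForestInsert F c = listForestInsert F' c') :
    F = F' ∧ c = c' := by
  cases c with
  | none =>
    cases c' with
    | none =>
      rw [listForestInsert, listForestInsert] at h
      refine ⟨funext fun p => ?_, rfl⟩
      exact liftList_injective (congrFun (familyExtend_injective h).1 p)
    | some q =>
      rw [listForestInsert, listForestInsert] at h
      have := congrFun (familyExtend_injective h).2 none
      simp [newRoot] at this
  | some q =>
    cases c' with
    | none =>
      rw [listForestInsert, listForestInsert] at h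
      have := congrFun (familyExtend_injective h).2 none
      simp [newRoot] at this
    | some q' =>
      obtain ⟨p, i⟩ := q
      obtain ⟨p', i'⟩ := q'
      rw [listForestInsert, listForestInsert] at h
      obtain ⟨rfl, rfl, rfl⟩ := familyInsert_injective (some_mem_listForestPlaces.1 hc).2
        (some_mem_listForestPlaces.1 hc').2 (familyExtend_injective h).1
      exact ⟨rfl, rfl⟩

-- Indexing a root list by its least entry makes an unordered set of lists a function. A larger
-- label never disturbs this index, and only the insertion as a new root list changes `rootCount`.
variable (K) in
theorem isTriangle_listForest :
    IsTriangle (fun n k => (Fintype.card K + 1) * n + k) (fun _ _ => 1)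
      (fun n k => {F : Fin n × Option K → List (Fin n) |
        IsListForest F ∧ rootCount F = k}.ncard) := by
  refine isTriangle_of_insertion (α := fun n => Fin n × Option K → List (Fin n))
    (γ := fun n => Option (Σ _ : Fin n × Option K, ℕ)) (fun n => {F | IsListForest F})
    (fun n F => rootCount F) (fun n F => listForestPlaces F) (fun n F c => listForestInsert F c)
    _ _ (fun p => p.1.elim0)
    (fun o => ⟨fun _ => funext fun p => p.1.elim0, fun _ => ⟨fun v => v.elim0, fun v => v.elim0,
      fun v => v.elim0, fun v => v.elim0⟩⟩)
    rfl ?_ (fun n F _ c hc F' _ c' hc' h => listForestInsert_injective hc hc' h)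
    (fun n G hG => IsListForest.exists_insert_eq hG) ?_ ?_ ?_
  · rintro n F hF (_ | ⟨p, i⟩) hc
    · exact IsListForest.insert_none hF
    · rw [some_mem_listForestPlaces] at hc
      exact IsListForest.insert_some hF hc.2 hc.1
  · rintro n F hF (_ | ⟨p, i⟩) hc
    · exact Or.inr (rootCount_insert_none F)
    · rw [some_mem_listForestPlaces] at hc
      exact Or.inl (rootCount_insert_some hc.2 hc.1)
  · intro n F hF
    have h1 := IsListForest.card_places hF
    have h2 : {c ∈ listForestPlaces F | rootCount (listForestInsert F c) = rootCount F} =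
        (listForestPlaces F).erase none := by
      ext c
      rcases c with _ | ⟨p, i⟩
      · simp [rootCount_insert_none]
      · rw [mem_filter, mem_erase, and_comm]
        apply and_congr_left
        intro hc
        rw [some_mem_listForestPlaces] at hc
        simp [rootCount_insert_some hc.2 hc.1]
    rw [h2, card_erase_of_mem (show none ∈ listForestPlaces F from none_mem_insertNone), h1, Nat.add_sub_cancel]
  · intro n F hF
    exact IsListForest.card_places hF

/-! ### Root lists as a set of lists -/

/-- The set of the root lists. -/
def rootLists (F : Fin n × Option K → List (Fin n)) : Finset (List (Fin n)) :=
  ({v | F (v, none) ≠ []} : Finset (Fin n)).image fun v => F (v, none)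

theorem rootLists_injOn {F : Fin n × Option K → List (Fin n)}
    (hle : ∀ v, ∀ w ∈ F (v, none), v ≤ w) (hmem : ∀ v, F (v, none) ≠ [] → v ∈ F (v, none)) :
    Set.InjOn (fun v => F (v, none)) {v | F (v, none) ≠ []} := by
  intro v hv w hw h
  have h : F (v, none) = F (w, none) := h
  exact le_antisymm (hle v w (h ▸ hmem w hw)) (hle w v (h ▸ hmem v hv))

theorem card_rootLists {F : Fin n × Option K → List (Fin n)}
    (hle : ∀ v, ∀ w ∈ F (v, none), v ≤ w) (hmem : ∀ v, F (v, none) ≠ [] → v ∈ F (v, none)) :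
    #(rootLists F) = rootCount F := by
  apply card_image_of_injOn
  simpa using rootLists_injOn hle hmem

theorem sum_rootLists {F : Fin n × Option K → List (Fin n)}
    (hle : ∀ v, ∀ w ∈ F (v, none), v ≤ w) (hmem : ∀ v, F (v, none) ≠ [] → v ∈ F (v, none)) :
    ∑ l ∈ rootLists F, (l : Multiset (Fin n)) = ∑ v, (F (v, none) : Multiset (Fin n)) := by
  rw [rootLists, sum_image (by simpa using rootLists_injOn hle hmem)]
  apply sum_subset (subset_univ _)
  intro v _ hv
  rw [mem_filter_univ, not_not] at hv
  simp [hv]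

theorem eq_univ_val_iff (s : Multiset (Fin n)) :
    s = (univ : Finset (Fin n)).val ↔ ∀ w, s.count w = 1 := by
  rw [Multiset.ext]
  refine forall_congr' fun w => ?_
  rw [Multiset.count_eq_one_of_mem univ.nodup (mem_univ w)]

theorem sum_lists_eq_univ_val_iff {F : Fin n × Option K → List (Fin n)}
    (hle : ∀ v, ∀ w ∈ F (v, none), v ≤ w) (hmem : ∀ v, F (v, none) ≠ [] → v ∈ F (v, none)) :
    ∑ l ∈ rootLists F, (l : Multiset (Fin n)) + ∑ v, ∑ a, (F (v, some a) : Multiset (Fin n)) =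
      (univ : Finset (Fin n)).val ↔ ∀ w, ∑ p, (F p).count w = 1 := by
  rw [eq_univ_val_iff, sum_rootLists hle hmem, ← sum_add_distrib]
  refine forall_congr' fun w => ?_
  rw [Multiset.count_sum', Fintype.sum_prod_type]
  simp only [Multiset.count_add, Multiset.count_sum', Multiset.coe_count, Fintype.sum_option]

/-- The list of `R` with the least entry `v`, or the empty list. -/
noncomputable def listWithMin (R : Finset (List (Fin n))) (v : Fin n) : List (Fin n) :=
  open Classical in
  if h : ∃ l ∈ R, v ∈ l ∧ ∀ w ∈ l, v ≤ w then h.choose else []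

theorem listWithMin_spec {R : Finset (List (Fin n))} {v : Fin n} (h : listWithMin R v ≠ []) :
    listWithMin R v ∈ R ∧ v ∈ listWithMin R v ∧ ∀ w ∈ listWithMin R v, v ≤ w := by
  rw [listWithMin] at h ⊢
  split_ifs at h ⊢ with h'
  · exact h'.choose_spec
  · exact absurd rfl h

theorem image_listWithMin {R : Finset (List (Fin n))} (hnil : ∀ l ∈ R, l ≠ [])
    (huniq : ∀ l ∈ R, ∀ l' ∈ R, ∀ v, v ∈ l → v ∈ l' → l = l') :
    ({v | listWithMin R v ≠ []} : Finset (Fin n)).image (listWithMin R) = R := by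
  ext l
  rw [mem_image]
  constructor
  · rintro ⟨v, hv, rfl⟩
    exact (listWithMin_spec ((mem_filter_univ v).1 hv)).1
  · intro hl
    obtain ⟨w, hw⟩ := List.exists_mem_of_ne_nil l (hnil l hl)
    have hne : l.toFinset.Nonempty := ⟨w, List.mem_toFinset.2 hw⟩
    have hv : l.toFinset.min' hne ∈ l := List.mem_toFinset.1 (min'_mem _ _)
    have hmin : ∀ w ∈ l, l.toFinset.min' hne ≤ w := fun w hw =>
      min'_le _ _ (List.mem_toFinset.2 hw)
    set v := l.toFinset.min' hne
    have hex : ∃ l ∈ R, v ∈ l ∧ ∀ w ∈ l, v ≤ w := ⟨l, hl, hv, hmin⟩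
    have heq : listWithMin R v = l := by
      rw [listWithMin, dif_pos hex]
      exact huniq _ hex.choose_spec.1 _ hl v hex.choose_spec.2.1 hv
    refine ⟨v, ?_, heq⟩
    rw [mem_filter_univ, heq]
    exact hnil l hl

-- Disjoint nonempty lists are determined, as a set, by assigning to each label the list of which it
-- is the least entry; this passes between indexed families and unordered forests.
variable (K) in
theorem ncard_listForest (n k : ℕ) :
    {F : Fin n × Option K → List (Fin n) | IsListForest F ∧ rootCount F = k}.ncard =
      {Q : Finset (List (Fin n)) × (Fin n → K → List (Fin n)) |
        #Q.1 = k ∧ (∀ l ∈ Q.1, l ≠ []) ∧ (∀ v a, ∀ w ∈ Q.2 v a, v < w) ∧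
          ∑ l ∈ Q.1, (l : Multiset (Fin n)) + ∑ v, ∑ a, (Q.2 v a : Multiset (Fin n)) =
            (univ : Finset (Fin n)).val}.ncard := by
  refine Set.ncard_congr (fun F _ => (rootLists F, fun v a => F (v, some a))) ?_ ?_ ?_
  · rintro F ⟨hF, hk⟩
    refine ⟨(card_rootLists hF.root_le hF.root_mem).trans hk, ?_, hF.child_lt,
      (sum_lists_eq_univ_val_iff hF.root_le hF.root_mem).2 hF.count⟩
    intro l hl
    obtain ⟨v, hv, rfl⟩ := mem_image.1 hl
    exact (mem_filter_univ v).1 hv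
  · rintro F F' ⟨hF, -⟩ ⟨hF', -⟩ h
    obtain ⟨h1, h2⟩ := Prod.mk.inj h
    have key : ∀ {F F' : Fin n × Option K → List (Fin n)}, IsListForest F → IsListForest F' →
        rootLists F = rootLists F' → ∀ v, F (v, none) ≠ [] → F (v, none) = F' (v, none) := by
      intro F F' hF hF' h v hv
      have hmem : F (v, none) ∈ rootLists F' := by
        rw [← h]
        exact mem_image_of_mem (fun v => F (v, none)) ((mem_filter_univ v).2 hv)
      obtain ⟨u, hu, huv⟩ := mem_image.1 hmem
      have huv : F' (u, none) = F (v, none) := huv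
      rw [mem_filter_univ] at hu
      have h3 := hF'.root_le u v (huv ▸ hF.root_mem v hv)
      have h4 := hF.root_le v u (huv ▸ hF'.root_mem u hu)
      rw [← huv, le_antisymm h3 h4]
    funext ⟨v, j⟩
    cases j with
    | some a => exact congrFun (congrFun h2 v) a
    | none =>
      by_cases hv : F (v, none) = []
      · by_cases hv' : F' (v, none) = []
        · rw [hv, hv']
        · exact (key hF' hF h1.symm v hv').symm
      · exact key hF hF' h1 v hv
  · rintro ⟨R, c⟩ ⟨hk, hnil, hlt, hsum⟩
    -- Two different lists sharing a label would give it multiplicity at least two.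
    have huniq : ∀ l ∈ R, ∀ l' ∈ R, ∀ v, v ∈ l → v ∈ l' → l = l' := by
      intro l hl l' hl' v hv hv'
      by_contra hne
      have h1 := (eq_univ_val_iff _).1 hsum v
      have h1 : Multiset.count v (∑ l ∈ R, (l : Multiset (Fin n)) +
        ∑ v, ∑ a, (c v a : Multiset (Fin n))) = 1 := h1
      rw [Multiset.count_add, Multiset.count_sum', ← add_sum_erase _ _ hl,
        ← add_sum_erase _ _ (mem_erase.2 ⟨Ne.symm hne, hl'⟩)] at h1
      have h2 := List.count_pos_iff.2 hv
      have h3 := List.count_pos_iff.2 hv'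
      simp only [Multiset.coe_count] at h1
      omega
    let F : Fin n × Option K → List (Fin n) := fun p => p.2.elim (listWithMin R p.1) (c p.1)
    have hle : ∀ v, ∀ w ∈ F (v, none), v ≤ w := fun v w hw =>
      (listWithMin_spec (List.ne_nil_of_mem hw)).2.2 w hw
    have hmem : ∀ v, F (v, none) ≠ [] → v ∈ F (v, none) := fun v hv =>
      (listWithMin_spec hv).2.1
    have hR : rootLists F = R := image_listWithMin hnil huniq
    refine ⟨F, ⟨⟨(sum_lists_eq_univ_val_iff hle hmem).1 ?_, hle, hmem, hlt⟩, ?_⟩, ?_⟩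
    · rw [hR]
      exact hsum
    · rw [← card_rootLists hle hmem, hR]
      exact hk
    · rw [hR]
      rfl

end ListForest

/-- With no kinds of children, a list forest is just a set of nonempty lists. -/
theorem isTriangle_lah : IsTriangle (fun n k => n + k) (fun _ _ => 1) lah := by
  have key := isTriangle_listForest Empty
  convert key using 3 with n k n k
  · simp
  · rw [ncard_listForest Empty n k, lah]
    refine Set.ncard_congr (fun S _ => (S, fun _ a => a.elim)) ?_ ?_ ?_
    · rintro S ⟨h1, h2, h3⟩
      exact ⟨h1, h2, fun _ a => a.elim, by simpa using h3⟩
    · intro S S' _ _ h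
      exact (Prod.mk.inj h).1
    · rintro ⟨S, c⟩ ⟨h1, h2, -, h3⟩
      refine ⟨S, ⟨h1, h2, by simpa using h3⟩, Prod.ext rfl (funext fun v => funext fun a => a.elim)⟩

/-- With one kind of children, each labelled vertex has a single list of children; the root lists
belong to the unlabelled roots. -/
theorem isTriangle_organicForests :
    IsTriangle (fun n k => 2 * n + k) (fun _ _ => 1) organicForests := by
  have key := isTriangle_listForest Unit
  convert key using 3 with n k n k
  · simp
  rw [ncard_listForest Unit, organicForests]
  refine Set.ncard_congr (fun Q _ => (Q.1, fun v _ => Q.2 v)) ?_ ?_ ?_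
  · rintro Q ⟨h1, h2, h3, h4⟩
    exact ⟨h1, h2, fun v _ => h3 v, by simpa using h4⟩
  · intro Q Q' _ _ h
    obtain ⟨h1, h2⟩ := Prod.mk.inj h
    exact Prod.ext h1 (funext fun v => congrFun (congrFun h2 v) ())
  · rintro ⟨R, c⟩ ⟨h1, h2, h3, h4⟩
    exact ⟨(R, fun v => c v ()), ⟨h1, h2, fun v => h3 v (), by simpa using h4⟩, rfl⟩

end Gram

namespace Gram

open Finset

/-! ### Increasing mobiles -/

/-- The first entry of a list is a least one. -/
def HeadMin {α : Type*} [LE α] : List α → Prop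
  | [] => True
  | a :: t => ∀ w ∈ t, a ≤ w

theorem HeadMin.exists_isRotated {α : Type*} [LinearOrder α] (l : List α) :
    ∃ l', HeadMin l' ∧ l' ~r l := by
  rcases eq_or_ne l [] with rfl | hl
  · exact ⟨[], trivial, List.IsRotated.refl _⟩
  · have hne : l.toFinset.Nonempty := List.toFinset_nonempty_iff l |>.2 hl
    have ha : l.toFinset.min' hne ∈ l := List.mem_toFinset.1 (min'_mem _ _)
    have hmin : ∀ w ∈ l, l.toFinset.min' hne ≤ w := fun w hw => min'_le _ _ (List.mem_toFinset.2 hw)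
    set a := l.toFinset.min' hne
    clear_value a
    obtain ⟨s, t, rfl⟩ := List.append_of_mem ha
    refine ⟨a :: t ++ s, fun w hw => hmin w ?_, List.isRotated_append⟩
    have hw' : w ∈ t ++ s := hw
    simp only [List.mem_append, List.mem_cons] at hw' ⊢
    tauto

/-- Both heads are the least entry, hence equal. In a list without repetitions a rotation that fixes
the head is trivial. -/
theorem HeadMin.eq_of_isRotated {α : Type*} [LinearOrder α] {l l' : List α} (h : HeadMin l)
    (h' : HeadMin l') (hl : l.Nodup) (hr : l ~r l') : l = l' := by
  cases l with
  | nil => exact (List.isRotated_nil_iff'.1 hr)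
  | cons a t =>
    cases l' with
    | nil => exact (List.isRotated_nil_iff.1 hr)
    | cons b t' =>
      have hab : a = b := by
        apply le_antisymm
        · have : b ∈ a :: t := hr.mem_iff.2 List.mem_cons_self
          rcases List.mem_cons.1 this with hb | hb
          · exact hb.ge
          · exact h b hb
        · have : a ∈ b :: t' := hr.mem_iff.1 List.mem_cons_self
          rcases List.mem_cons.1 this with hb | hb
          · exact hb.ge
          · exact h' a hb
      subst hab
      obtain ⟨k, hk⟩ := hr
      have h0 : ((a :: t).rotate k)[0]'(by simp) = (a :: t)[0]'(by simp) := by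
        simp only [hk, List.getElem_cons_zero]
      rw [List.getElem_rotate, hl.getElem_inj_iff, zero_add] at h0
      rw [← hk, ← List.rotate_mod, h0, List.rotate_zero]

theorem headMin_liftList {n : ℕ} {l : List (Fin n)} : HeadMin (liftList l) ↔ HeadMin l := by
  cases l with
  | nil => exact Iff.rfl
  | cons a t => simp [liftList, HeadMin]

/-- The largest label may not be put in front of a nonempty list. The remaining `ℓ` positions are
the `ℓ` gaps of a circle with `ℓ` entries. -/
theorem headMin_listInsert {n : ℕ} {l : List (Fin n)} {i : ℕ} (hi : i ≤ l.length) :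
    HeadMin (listInsert l i) ↔ HeadMin l ∧ (l ≠ [] → 1 ≤ i) := by
  cases l with
  | nil =>
    obtain rfl : i = 0 := by simpa using hi
    simp [listInsert, liftList, HeadMin]
  | cons a t =>
    cases i with
    | zero => simp [listInsert, liftList, HeadMin]
    | succ i =>
      have h1 : listInsert (a :: t) (i + 1) = a.castSucc :: listInsert t i := rfl
      have hi' : i ≤ t.length := by simpa using hi
      rw [h1]
      simp only [HeadMin, mem_listInsert hi', mem_liftList]
      constructor
      · intro h
        exact ⟨fun w hw => Fin.castSucc_le_castSucc_iff.1 (h _ (Or.inr ⟨w, hw, rfl⟩)),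
          fun _ => Nat.le_add_left 1 i⟩
      · rintro ⟨h, -⟩ w (rfl | ⟨w, hw, rfl⟩)
        · exact Fin.le_last _
        · exact Fin.castSucc_le_castSucc_iff.2 (h w hw)

section Mobile

variable {n : ℕ}

/-- The lists of the children of the nodes of an increasing mobile, where every circle of children
is cut in front of its least element. -/
structure IsMobileFamily (F : Fin (n + 1) → List (Fin (n + 1))) : Prop where
  count : ∀ w, ∑ v, (F v).count w = if w = 0 then 0 else 1
  lt : ∀ v, ∀ w ∈ F v, v < w
  head : ∀ v, HeadMin (F v)

/-- The number of leaves. -/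
def leafCount {m : ℕ} (F : Fin m → List (Fin m)) : ℕ :=
  #{v | F v = []}

/-- Adding a leaf with the largest label as a child of the node `c.1`. -/
def mobileInsert (F : Fin (n + 1) → List (Fin (n + 1))) (c : Σ _ : Fin (n + 1), ℕ) :
    Fin (n + 2) → List (Fin (n + 2)) :=
  Fin.snoc (α := fun _ => List (Fin (n + 2))) (familyInsert F c.1 c.2) []

theorem mobileInsert_castSucc (F : Fin (n + 1) → List (Fin (n + 1))) (c : Σ _ : Fin (n + 1), ℕ)
    (v : Fin (n + 1)) : mobileInsert F c v.castSucc = familyInsert F c.1 c.2 v := by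
  simp only [mobileInsert, Fin.snoc_castSucc]

theorem mobileInsert_last (F : Fin (n + 1) → List (Fin (n + 1))) (c : Σ _ : Fin (n + 1), ℕ) :
    mobileInsert F c (Fin.last (n + 1)) = [] := by
  simp only [mobileInsert, Fin.snoc_last]

/-- The places at which a new leaf can be added. -/
def mobilePlaces (F : Fin (n + 1) → List (Fin (n + 1))) : Finset (Σ _ : Fin (n + 1), ℕ) :=
  univ.sigma fun v => if F v = [] then {0} else Icc 1 (F v).length

theorem mem_mobilePlaces {F : Fin (n + 1) → List (Fin (n + 1))} {v : Fin (n + 1)} {i : ℕ} :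
    ⟨v, i⟩ ∈ mobilePlaces F ↔ i ≤ (F v).length ∧ (F v ≠ [] → 1 ≤ i) := by
  rw [mobilePlaces, mem_sigma]
  by_cases h : F v = []
  · simp [h]
  · simp [h, and_comm]

theorem IsMobileFamily.sum_length {F : Fin (n + 1) → List (Fin (n + 1))} (hF : IsMobileFamily F) :
    ∑ v, (F v).length = n := by
  rw [sum_length_eq_sum_count, Fin.sum_univ_succ]
  simp [hF.count]

theorem IsMobileFamily.last_eq_nil {F : Fin (n + 1) → List (Fin (n + 1))} (hF : IsMobileFamily F) :
    F (Fin.last n) = [] :=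
  List.eq_nil_iff_forall_not_mem.2 fun w hw => absurd (hF.lt _ w hw) (Fin.le_last w).not_gt

theorem IsMobileFamily.leafCount_pos {F : Fin (n + 1) → List (Fin (n + 1))}
    (hF : IsMobileFamily F) : 0 < leafCount F :=
  card_pos.2 ⟨Fin.last n, (mem_filter_univ _).2 hF.last_eq_nil⟩

/-- A node with `ℓ > 0` children offers `ℓ` gaps and a leaf offers one place; the numbers of
children add up to `n`, since every node except the root is a child. -/
theorem IsMobileFamily.card_places {F : Fin (n + 1) → List (Fin (n + 1))}
    (hF : IsMobileFamily F) : #(mobilePlaces F) = leafCount F + n := by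
  rw [mobilePlaces, card_sigma, leafCount, card_filter]
  refine Eq.trans ?_ (congrArg (_ + ·) hF.sum_length)
  rw [← sum_add_distrib]
  refine sum_congr rfl fun v _ => ?_
  split_ifs with h
  · simp [h]
  · simp

theorem IsMobileFamily.insert {F : Fin (n + 1) → List (Fin (n + 1))} (hF : IsMobileFamily F)
    {c : Σ _ : Fin (n + 1), ℕ} (hc : c ∈ mobilePlaces F) : IsMobileFamily (mobileInsert F c) := by
  obtain ⟨u, i⟩ := c
  obtain ⟨hi, h1⟩ := mem_mobilePlaces.1 hc
  refine ⟨fun w => ?_, fun v w hw => ?_, fun v => ?_⟩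
  · rw [Fin.sum_univ_castSucc, mobileInsert_last, List.count_nil, add_zero]
    simp only [mobileInsert_castSucc]
    cases w using Fin.lastCases with
    | last => simp [count_last_familyInsert hi]
    | cast w => simp [count_castSucc_familyInsert hi, hF.count]
  · cases v using Fin.lastCases with
    | last => simp [mobileInsert_last] at hw
    | cast v =>
      rw [mobileInsert_castSucc, mem_familyInsert hi, mem_liftList] at hw
      obtain ⟨-, rfl⟩ | ⟨w, hw, rfl⟩ := hw
      · exact Fin.castSucc_lt_last _
      · exact Fin.castSucc_lt_castSucc_iff.2 (hF.lt v w hw)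
  · cases v using Fin.lastCases with
    | last => rw [mobileInsert_last]; trivial
    | cast v =>
      rw [mobileInsert_castSucc]
      by_cases hv : v = u
      · subst hv
        rw [familyInsert_self, headMin_listInsert hi]
        exact ⟨hF.head v, h1⟩
      · rw [familyInsert_of_ne F hv, headMin_liftList]
        exact hF.head v

theorem IsMobileFamily.exists_insert_eq {G : Fin (n + 2) → List (Fin (n + 2))}
    (hG : IsMobileFamily G) :
    ∃ F : Fin (n + 1) → List (Fin (n + 1)), IsMobileFamily F ∧
      ∃ c ∈ mobilePlaces F, mobileInsert F c = G := by
  have hcount : ∀ w, ∑ v : Fin (n + 1), (G v.castSucc).count w = if w = 0 then 0 else 1 := by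
    intro w
    rw [← hG.count, Fin.sum_univ_castSucc (n := n + 1), hG.last_eq_nil]
    simp
  obtain ⟨F, u, i, hi, hF⟩ := exists_familyInsert_eq
    ((hcount (Fin.last (n + 1))).trans (if_neg (Fin.last_pos).ne'))
  have hGF : ∀ v, G v.castSucc = familyInsert F u i v := fun v => (congrFun hF v).symm
  have hhead : ∀ v, HeadMin (F v) ∧ (v = u → F v ≠ [] → 1 ≤ i) := by
    intro v
    have := hG.head v.castSucc
    rw [hGF] at this
    by_cases hv : v = u
    · subst hv
      rw [familyInsert_self, headMin_listInsert hi] at this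
      exact ⟨this.1, fun _ => this.2⟩
    · rw [familyInsert_of_ne F hv, headMin_liftList] at this
      exact ⟨this, fun h => absurd h hv⟩
  refine ⟨F, ⟨fun w => ?_, fun v w hw => ?_, fun v => (hhead v).1⟩, ⟨u, i⟩,
    mem_mobilePlaces.2 ⟨hi, (hhead u).2 rfl⟩, funext fun v => ?_⟩
  · have := hcount w.castSucc
    rw [sum_congr rfl fun v _ => (by rw [hGF, count_castSucc_familyInsert hi] :
      (G v.castSucc).count w.castSucc = (F v).count w)] at this
    rw [this]
    simp
  · refine Fin.castSucc_lt_castSucc_iff.1 (hG.lt v.castSucc w.castSucc ?_)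
    rw [hGF, mem_familyInsert hi]
    exact Or.inr (castSucc_mem_liftList.2 hw)
  · cases v using Fin.lastCases with
    | last => rw [mobileInsert_last, hG.last_eq_nil]
    | cast v => rw [mobileInsert_castSucc, hGF]

theorem mobileInsert_injective {F F' : Fin (n + 1) → List (Fin (n + 1))}
    {c c' : Σ _ : Fin (n + 1), ℕ} (hc : c ∈ mobilePlaces F) (hc' : c' ∈ mobilePlaces F')
    (h : mobileInsert F c = mobileInsert F' c') : F = F' ∧ c = c' := by
  obtain ⟨u, i⟩ := c
  obtain ⟨u', i'⟩ := c'
  have h1 : familyInsert F u i = familyInsert F' u' i' := by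
    funext v
    have := congrFun h v.castSucc
    rwa [mobileInsert_castSucc, mobileInsert_castSucc] at this
  obtain ⟨rfl, rfl, rfl⟩ := familyInsert_injective (mem_mobilePlaces.1 hc).1
    (mem_mobilePlaces.1 hc').1 h1
  exact ⟨rfl, rfl⟩

/-- The new node is a leaf; the gain is cancelled if its parent was a leaf before. -/
theorem leafCount_mobileInsert {F : Fin (n + 1) → List (Fin (n + 1))}
    {c : Σ _ : Fin (n + 1), ℕ} (hc : c ∈ mobilePlaces F) :
    leafCount (mobileInsert F c) = leafCount F + if F c.1 = [] then 0 else 1 := by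
  obtain ⟨u, i⟩ := c
  have hi := (mem_mobilePlaces.1 hc).1
  rw [leafCount, card_filter_fin_succ, mobileInsert_last, if_pos rfl]
  have h1 : ({v | mobileInsert F ⟨u, i⟩ v.castSucc = []} : Finset (Fin (n + 1))) =
      ({v | F v = []} : Finset (Fin (n + 1))).erase u := by
    ext v
    rw [mem_erase, mem_filter_univ, mem_filter_univ, mobileInsert_castSucc]
    by_cases hv : v = u
    · subst hv
      simp [familyInsert_self, listInsert_ne_nil hi]
    · simp [familyInsert_of_ne F hv, hv]
  rw [h1, leafCount]
  by_cases hu : F u = []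
  · rw [card_erase_add_one (by simpa using hu)]
    simp [hu]
  · rw [erase_eq_of_notMem (by simpa using hu)]
    simp [hu]

/-- The count of leaves is lowered by one so that the single node has statistic `0`. The `k + 1`
leaves are the preserving places, and the `n` gaps in circles are the others. -/
theorem isTriangle_mobileFamily :
    IsTriangle (fun _ k => k + 1) (fun n _ => n) (fun n k =>
      {F : Fin (n + 1) → List (Fin (n + 1)) | IsMobileFamily F ∧ leafCount F - 1 = k}.ncard) := by
  refine isTriangle_of_insertion (α := fun n => Fin (n + 1) → List (Fin (n + 1)))
    (γ := fun n => Σ _ : Fin (n + 1), ℕ) (fun n => {F | IsMobileFamily F})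
    (fun n F => leafCount F - 1) (fun n F => mobilePlaces F) (fun n F c => mobileInsert F c)
    _ _ (fun _ => []) (fun F => ⟨fun hF => funext fun v => ?_, ?_⟩) rfl
    (fun n F hF c hc => IsMobileFamily.insert hF hc)
    (fun n F _ c hc F' _ c' hc' h => mobileInsert_injective hc hc' h)
    (fun n G hG => IsMobileFamily.exists_insert_eq hG) ?_ ?_ ?_
  · rw [show v = Fin.last 0 from Subsingleton.elim (α := Fin 1) v (Fin.last 0)]
    exact IsMobileFamily.last_eq_nil hF
  · rintro rfl
    exact ⟨fun w => by simp [show w = 0 from Subsingleton.elim (α := Fin 1) w 0], fun v w hw => by simp at hw,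
      fun _ => trivial⟩
  · intro n F hF c hc
    have := IsMobileFamily.leafCount_pos hF
    rw [leafCount_mobileInsert hc]
    split_ifs <;> omega
  · intro n F hF
    have hpos := IsMobileFamily.leafCount_pos hF
    have h1 : {c ∈ mobilePlaces F | leafCount (mobileInsert F c) - 1 = leafCount F - 1} =
        ({v | F v = []} : Finset (Fin (n + 1))).sigma fun _ => {0} := by
      ext ⟨v, i⟩
      rw [mem_filter, mem_sigma, mem_filter_univ, mem_singleton]
      constructor
      · rintro ⟨hc, h⟩
        rw [leafCount_mobileInsert hc] at h
        have hv : F v = [] := by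
          by_contra hv
          simp only [hv, if_false] at h
          omega
        refine ⟨hv, ?_⟩
        have := (mem_mobilePlaces.1 hc).1
        simpa [hv] using this
      · rintro ⟨hv, hi⟩
        have hv : F v = [] := hv
        have hi : i = 0 := hi
        have hc : ⟨v, i⟩ ∈ mobilePlaces F := mem_mobilePlaces.2 (by simp [hv, hi])
        refine ⟨hc, ?_⟩
        rw [leafCount_mobileInsert hc, if_pos hv, add_zero]
    rw [h1, card_sigma]
    simp only [card_singleton, sum_const, smul_eq_mul, mul_one]
    rw [← leafCount]
    omega
  · intro n F hF
    have hpos := IsMobileFamily.leafCount_pos hF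
    have := IsMobileFamily.card_places hF
    omega

/-- Each circle has a unique representative list starting with its least entry. Labels increase, so
`0` is no child and must be the root. -/
theorem increasingMobiles_eq (n k : ℕ) :
    increasingMobiles (n + 1) k =
      {F : Fin (n + 1) → List (Fin (n + 1)) | IsMobileFamily F ∧ leafCount F = k}.ncard := by
  have hroot : ∀ F : Fin (n + 1) → List (Fin (n + 1)), (∀ v, ∀ w ∈ F v, v < w) → ∀ root,
      {root} + ∑ v, (F v : Cycle (Fin (n + 1))).toMultiset =
        (univ : Finset (Fin (n + 1))).val ↔
      root = 0 ∧ ∀ w, ∑ v, (F v).count w = if w = 0 then 0 else 1 := by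
    intro F hF root
    have h0 : ∑ v, (F v).count 0 = 0 := sum_eq_zero fun v _ =>
      List.count_eq_zero_of_not_mem fun h => absurd (hF v 0 h) (Fin.zero_le v).not_gt
    rw [eq_univ_val_iff]
    simp only [Multiset.count_add, Multiset.count_singleton, Multiset.count_sum',
      Cycle.coe_toMultiset, Multiset.coe_count]
    constructor
    · intro h
      have h1 := h 0
      rw [h0, add_zero] at h1
      have hr : root = 0 := by
        by_contra hne
        simp [Ne.symm hne] at h1
      subst hr
      refine ⟨rfl, fun w => ?_⟩
      have := h w
      split_ifs at this ⊢ <;> omega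
    · rintro ⟨rfl, h⟩ w
      rw [h w]
      split_ifs <;> rfl
  symm
  refine Set.ncard_congr (fun F _ v => (F v : Cycle (Fin (n + 1)))) ?_ ?_ ?_
  · rintro F ⟨hF, hk⟩
    refine ⟨⟨0, (hroot F hF.lt 0).2 ⟨rfl, hF.count⟩⟩, fun v w hw => hF.lt v w hw, ?_⟩
    rw [← hk, leafCount]
    congr 1
    exact filter_congr fun v _ => Cycle.coe_eq_nil _
  · rintro F F' ⟨hF, -⟩ ⟨hF', -⟩ h
    funext v
    refine (hF.head v).eq_of_isRotated (hF'.head v) ?_ (Cycle.coe_eq_coe.1 (congrFun h v))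
    rw [List.nodup_iff_count_le_one]
    intro w
    refine (single_le_sum (f := fun v => (F v).count w) (fun _ _ => Nat.zero_le _)
      (mem_univ v)).trans ?_
    rw [hF.count]
    split_ifs <;> simp
  · rintro c ⟨⟨root, hr⟩, hlt, hk⟩
    have hex : ∀ v, ∃ l : List (Fin (n + 1)), HeadMin l ∧ (l : Cycle (Fin (n + 1))) = c v := by
      intro v
      induction c v using Quotient.inductionOn' with
      | h l =>
        obtain ⟨l', h1, h2⟩ := HeadMin.exists_isRotated l
        exact ⟨l', h1, Cycle.coe_eq_coe.2 h2⟩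
    choose F hhead hF using hex
    obtain rfl : (fun v => (F v : Cycle (Fin (n + 1)))) = c := funext hF
    have hlt' : ∀ v, ∀ w ∈ F v, v < w := fun v w hw => hlt v w hw
    refine ⟨F, ⟨⟨((hroot F hlt' root).1 hr).2, hlt', hhead⟩, ?_⟩, rfl⟩
    rw [← hk, leafCount]
    congr 1
    exact filter_congr fun v _ => (Cycle.coe_eq_nil _).symm

/-- In the triangle of mobile families `b 0 k = 0` and `a 0 0 = 1`, so row `1` is again `1, 0, 0, …`
and the triangle may be started there, at two nodes. -/
theorem isTriangle_increasingMobiles :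
    IsTriangle (fun _ k => k + 1) (fun n _ => n + 1)
      (fun n k => increasingMobiles (n + 2) (k + 1)) := by
  have hpred : ∀ n k, {F : Fin (n + 1) → List (Fin (n + 1)) |
      IsMobileFamily F ∧ leafCount F - 1 = k} = {F | IsMobileFamily F ∧ leafCount F = k + 1} := by
    intro n k
    ext F
    refine and_congr_right fun hF => ?_
    have := IsMobileFamily.leafCount_pos hF
    omega
  have key := isTriangle_mobileFamily
  simp only [hpred, ← increasingMobiles_eq] at key
  exact
    { zero_zero := by rw [key.succ_zero, key.zero_zero]
      zero_succ := fun k => by rw [key.succ_succ, key.zero_succ]; simp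
      succ_zero := fun n => key.succ_zero (n + 1)
      succ_succ := fun n k => key.succ_succ (n + 1) k }

end Mobile

end Gram

/-! ### The twelve identities -/

theorem mainTheorem2 (n : ℕ) (hn : 1 ≤ n) :
    -- (c1)
    (Gram.derivPow (Gram.x * Gram.y ^ 2) (Gram.x ^ 2 * Gram.y) n (Gram.x * Gram.y) =
      Gram.x * Gram.y * ∑ k ∈ Finset.range (n + 1),
        (Gram.eulerianB n k : MvPolynomial (Fin 2) ℚ) *
          Gram.x ^ (2 * n - 2 * k) * Gram.y ^ (2 * k)) ∧
    -- (c2)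
    (Gram.derivPow (Gram.x * Gram.y ^ 2) (Gram.x ^ 2 * Gram.y) n (Gram.x ^ 2 * Gram.y ^ 2) =
      2 ^ n * Gram.x ^ 2 * Gram.y ^ 2 * ∑ k ∈ Finset.range (n + 1),
        (Gram.eulerian (n + 1) k : MvPolynomial (Fin 2) ℚ) *
          Gram.x ^ (2 * n - 2 * k) * Gram.y ^ (2 * k)) ∧
    -- (c3)
    (Gram.derivPow (Gram.x * Gram.y ^ 2) (Gram.x ^ 2 * Gram.y) n Gram.x =
      Gram.x * ∑ k ∈ Finset.Icc 1 n,
        (Gram.oddMatchings n k : MvPolynomial (Fin 2) ℚ) *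
          Gram.x ^ (2 * n - 2 * k) * Gram.y ^ (2 * k)) ∧
    -- (c4)
    (∀ r : ℕ, Gram.derivPow (Gram.x * Gram.y) (Gram.x * Gram.y) n (Gram.x * Gram.y ^ r) =
      Gram.x * ∑ k ∈ Finset.range (n + 1),
        (Gram.restrictedEulerian r (n + r) k : MvPolynomial (Fin 2) ℚ) *
          Gram.x ^ k * Gram.y ^ (n + r - k)) ∧
    -- (c5)
    (Gram.derivPow (Gram.x * Gram.y ^ 2) (Gram.x * Gram.y) n Gram.x =
      Gram.x * ∑ k ∈ Finset.range n,
        2 ^ k * (Gram.eulerian n k : MvPolynomial (Fin 2) ℚ) *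
          Gram.x ^ k * Gram.y ^ (2 * n - 2 * k)) ∧
    -- (c6)
    (Gram.sqrtA = 1 + PowerSeries.mk (fun m : ℕ => if m = 0 then 0 else
        (1 / (m.factorial : ℚ)) • ∑ k ∈ Finset.Icc 1 m,
          Polynomial.C (Gram.T m k) * Polynomial.X ^ k) ∧
      Gram.derivPow (Gram.x * Gram.y ^ 2) (Gram.x * Gram.y) n Gram.y =
        ∑ k ∈ Finset.Icc 1 n,
          MvPolynomial.C (Gram.T n k) * Gram.x ^ k * Gram.y ^ (2 * n - 2 * k + 1)) ∧
    -- (c7)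
    (Gram.derivPow (Gram.x ^ 2 * Gram.y) Gram.y n Gram.x =
      Gram.x * ∑ k ∈ Finset.Icc 1 n,
        (k.factorial : MvPolynomial (Fin 2) ℚ) * (Gram.stirlingPartition n k) *
          Gram.x ^ k * Gram.y ^ k) ∧
    -- (c8)
    (Gram.derivPow (Gram.x ^ 2 * Gram.y) (Gram.y ^ 2) n Gram.x =
      Gram.x * ∑ k ∈ Finset.Icc 1 n,
        (k.factorial : MvPolynomial (Fin 2) ℚ) * (Gram.stirlingCycle n k) *
          Gram.x ^ k * Gram.y ^ n) ∧
    -- (c9)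
    (Gram.derivPow (Gram.x * Gram.y ^ 2) (Gram.y ^ 2) n Gram.x =
      Gram.x * ∑ k ∈ Finset.Icc 1 n,
        (Gram.lah n k : MvPolynomial (Fin 2) ℚ) * Gram.y ^ (n + k)) ∧
    -- (c10)
    (Gram.derivPow (Gram.x * Gram.y ^ 3) (Gram.y ^ 3) n Gram.x =
      Gram.x * ∑ k ∈ Finset.Icc 1 n,
        (Gram.organicForests n k : MvPolynomial (Fin 2) ℚ) * Gram.y ^ (2 * n + k)) ∧
    -- (c11)
    (∀ r : ℕ, 4 ≤ r → Gram.derivPow (Gram.x * Gram.y ^ r) (Gram.y ^ r) n Gram.x =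
      Gram.x * ∑ k ∈ Finset.Icc 1 n,
        (Gram.increasingForests r n k : MvPolynomial (Fin 2) ℚ) *
          Gram.y ^ ((r - 1) * n + k)) ∧
    -- (c12)
    (Gram.derivPow (Gram.x ^ 2 * Gram.y) (Gram.x * Gram.y) n Gram.y =
      Gram.x ^ n * ∑ k ∈ Finset.Icc 1 n,
        (Gram.increasingMobiles (n + 1) k : MvPolynomial (Fin 2) ℚ) * Gram.y ^ k) := by
  have hE := Gram.isTriangle_eulerian
  refine ⟨?_, ?_, ?_, fun r => ?_, ?_, ⟨?_, ?_⟩, ?_, ?_, ?_, ?_, fun r hr => ?_, ?_⟩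
  · exact Gram.derivPow_c1 _ Gram.isTriangle_eulerianB
  · exact Gram.derivPow_c2 _ hE
  · exact Gram.derivPow_c3 _ hn Gram.isTriangle_oddMatchings
  · have h := Gram.derivPow_c4 n r (Gram.isTriangle_restrictedEulerian r)
    exact h
  -- The term `k = n` vanishes: `n ≥ 1` letters have at most `n - 1` descents.
  · rw [Gram.derivPow_c5 _ hE, Finset.sum_range_succ,
      hE.self_eq_zero (fun n => Nat.sub_self n) hn]
    simp
  · exact Gram.sqrtA_eq_sum_T hE
  · exact Gram.derivPow_y_eq_sum_T hE _ hn
  · exact Gram.derivPow_c7 _ hn Gram.isTriangle_stirlingPartition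
  · exact Gram.derivPow_c8 _ hn Gram.isTriangle_stirlingCycle
  · have h := Gram.derivPow_x_of_pow (f := Gram.lah) n hn 1
      (by simpa only [one_mul] using Gram.isTriangle_lah)
    simpa only [one_mul, Nat.reduceAdd] using h
  · have h := Gram.derivPow_x_of_pow n hn 2 Gram.isTriangle_organicForests
    simpa only [Nat.reduceAdd] using h
  · obtain ⟨s, rfl⟩ := Nat.exists_eq_add_of_le' (show 1 ≤ r by omega)
    have h := Gram.derivPow_x_of_pow n hn s (Gram.isTriangle_increasingForests s)
    simpa only [Nat.add_sub_cancel] using h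
  · obtain ⟨m, rfl⟩ := Nat.exists_eq_add_of_le' hn
    have h := Gram.derivPow_c12 m Gram.isTriangle_increasingMobiles
    -- Column `k` of the triangle counts mobiles with `k + 1` leaves, so the sum is shifted by one.
    rw [h, Finset.range_eq_Ico,
      Finset.sum_Ico_add' (fun k => (Gram.increasingMobiles (m + 2) k : MvPolynomial (Fin 2) ℚ) *
        Gram.y ^ k) 0 (m + 1) 1]
    exact Finset.sum_congr rfl fun k _ => rfl
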